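/- Let $n\ge 1$, $m\ge 0$, $s\ge 1$ be integers and let $X$ be a smooth (Hausdorff, second countable) manifold of dimension $N=n+m$. Let $\mathrm{Imm}T^s_nX$ be the manifold of $s$-jets $j^s_0\gamma$ at $0$ of smooth immersions $\gamma:U\to X$ defined on neighbourhoods $U$ of $0\in\mathbb R^n$, let $L^s_n$ be the group of invertible $s$-jets of maps $(\mathbb R^n,0)\to(\mathbb R^n,0)$, acting on the right by $\phi_a(j^s_0\gamma)=j^s_0\gamma\cdot j^s_0\alpha=j^s_0(\gamma\circ\alpha)$ for $a=j^s_0\alpha$, and let $\rho:\mathrm{Imm}T^s_nX\to P^s_nX=\mathrm{Imm}T^s_nX/L^s_n$ be the projection onto the Grassmann manifold. A chart $\psi=(x^A)=(x^i,x^\sigma)$ of $X$ ($1\le i\le n$, $\sigma=1,\dots,m$) gives coordinates $x^A_J$, $|J|\le s$, on $\mathrm{Imm}T^s_nX$ by $x^A_J(j^s_0\gamma)=\partial_J(x^A\circ\gamma)(0)$. Let $W$ be the set of velocities over the chart domain with $\det(\mathbf x):=\det(x^i_j)\neq0$, let $(z^i_j)$ be the inverse matrix of $(x^i_j)$, let $d_j=\sum_{|J|\le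 s-1}x^A_{jJ}\,\partial/\partial x^A_J$ (a sum over symmetric multi-indices), and define on $W$ the invariant functions $y^\sigma=x^\sigma$, $y^\sigma_{i_1\dots i_k}=z^j_{i_1}d_jy^\sigma_{i_2\dots i_k}$ ($k\le s$). Then $(x^i,y^\sigma_J)_{|J|\le s}$ are coordinates on $\rho(W)\subset P^s_nX$. Put there $D_i=\partial/\partial x^i+\sum_{|J|\le s-1}y^\sigma_{iJ}\,\partial/\partial y^\sigma_J$, $\Delta_\sigma=\partial/\partial y^\sigma$, $\omega^\sigma_J=dy^\sigma_J-y^\sigma_{iJ}dx^i$ for $|J|\le s-1$, and $\theta_0=dx^1\wedge\dots\wedge dx^n$. An $(n+1)$-form on $P^s_nX$ (or on $\rho(W)$) is called strongly contact if in every chart (respectively in the given chart) it is a sum of terms $\eta_1\wedge\eta_2\wedge\Phi$, where each of $\eta_1,\eta_2$ is one of the forms $\omega^\sigma_J$ ($|J|\le s-1$) or $d\omega^\sigma_I$ ($|I|=s-1$) and $\Phi$ is a smooth form; write $\Omega^s_{n+1}(PX)$ for the smooth $(n+1)$-forms on $P^s_nX$ and $\Omega^s_{n+1(c)}(PX)$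 for the strongly contact ones. Let $\mathcal T$ be a homogeneous differential equation on $\mathrm{Imm}T^s_nX$, that is, a smooth $1$-form with local expressions $\mathcal T=\mathcal T_A\,dx^A$ such that $(\phi_a)^*\mathcal T=\det(a)\,\mathcal T$ for all $a\in L^s_n$ (where $\det(a)=\det(a^i_j)$ is the determinant of the linear part of $a$) and $(j^s\gamma)^*\mathcal T=0$ for every immersion $\gamma$, where $j^s\gamma$ is the prolongation $t\mapsto j^s_0(\gamma(t+\cdot))$. Then: 1. For every chart of $X$ there are smooth functions $T_\sigma$ on $\rho(W)$ such that on $W$ $$\mathcal T_\sigma=\det(\mathbf x)\,T_\sigma\circ\rho,\qquad \mathcal T_i=-\det(\mathbf x)\,y^\sigma_i\,T_\sigma\circ\rho .$$ 2. If $\psi$, $\bar\psi$ are two charts of $X$, then on $\rho(W\cap\bar W)$ $$T_\sigma=\mathcal J\,P^\nu_\sigma\,\bar T_\nu,\qquad \mathcal J=\det(D_i\bar x^j),\quad P^\nu_\sigma=\Delta_\sigma\bar y^\nu-\bar y^\nu_i\,\Delta_\sigma\bar x^i .$$ 3. There is a unique class $[T]\in\Omega^s_{n+1}(PX)/\Omega^s_{n+1(c)}(PX)$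 whose representatives differ on every $\rho(W)$ from $T_\sigma\,\omega^\sigma\wedge\theta_0$ by a strongly contact form. -/

import Mathlib

open Set Filter Topology
open scoped Manifold ContDiff

universe u v

noncomputable section

namespace Grassmann

/-! ### Differential forms on a set with a system of charts -/

/-- A system of charts on `M` with values in a normed space `E`: a family of domains together with
coordinate maps on these domains. -/
structure ChartSystem (M : Type u) (E : Type v) where
  ι : Type u
  dom : ι → Set M
  coord : ι → M → E

namespace ChartSystem

variable {M : Type u} {E : Type v}

/-- The set of coordinate values of the chart `i`. -/
def range (A : ChartSystem M E) (i : A.ι) : Set E := A.coord i '' A.dom i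

open Classical in
/-- The local expression `f ∘ (coord i)⁻¹` of a map `f` in the chart `i`, extended by zero outside
the set of coordinate values of the chart. -/
def expr {F : Type*} [Zero F] (A : ChartSystem M E) (i : A.ι) (f : M → F) : E → F :=
  fun w => if h : ∃ p ∈ A.dom i, A.coord i p = w then f h.choose else 0

variable [NormedAddCommGroup E] [NormedSpace ℝ E]

/-- The local expression, in the chart `i` and at the point `p`, of the pull-back `f^* η` of a
`q`-form `η` (given by its local expressions) along `f : M → M'`. It is computed with the
chart `j` around `f p`. -/
def pullbackAt {M' : Type*} {E' : Type*} [NormedAddCommGroup E'] [NormedSpace ℝ E'] {q : ℕ}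
    (A : ChartSystem M E) (B : ChartSystem M' E') (f : M → M')
    (η : B.ι → E' → E' [⋀^Fin q]→L[ℝ] ℝ) (i : A.ι) (j : B.ι) (p : M) : E [⋀^Fin q]→L[ℝ] ℝ :=
  (η j (B.coord j (f p))).compContinuousLinearMap
    (fderiv ℝ (A.expr i (fun p' => B.coord j (f p'))) (A.coord i p))

/-- The space of smooth differential `q`-forms: families of smooth local expressions, one for every
chart, which are related by pull-back along the changes of charts. The
local expressions are normalised to vanish outside the set of coordinate values of the chart. -/
def DForm (A : ChartSystem M E) (q : ℕ) : AddSubgroup (A.ι → E → E [⋀^Fin q]→L[ℝ] ℝ) where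
  carrier := {η | (∀ i, ContDiffOn ℝ ∞ (η i) (A.range i)) ∧
    (∀ i, ∀ w ∉ A.range i, η i w = 0) ∧
    ∀ i j, ∀ p ∈ A.dom i ∩ A.dom j, η i (A.coord i p) = A.pullbackAt A id η i j p}
  zero_mem' := by
    refine ⟨fun i => contDiffOn_const, fun _ _ _ => rfl, fun i j p _ => ?_⟩
    ext v
    rfl
  add_mem' := by
    rintro a b ⟨ha, ha', ha''⟩ ⟨hb, hb', hb''⟩
    refine ⟨fun i => (ha i).add (hb i), fun i w hw => ?_, fun i j p hp => ?_⟩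
    · simp [ha' i w hw, hb' i w hw]
    · have h1 := ha'' i j p hp
      have h2 := hb'' i j p hp
      simp only [Pi.add_apply, h1, h2]
      ext v
      rfl
  neg_mem' := by
    rintro a ⟨ha, ha', ha''⟩
    refine ⟨fun i => (ha i).neg, fun i w hw => ?_, fun i j p hp => ?_⟩
    · simp [ha' i w hw]
    · have h1 := ha'' i j p hp
      simp only [Pi.neg_apply, h1]
      ext v
      rfl

end ChartSystem

/-- The wedge product `α ∧ β` of a `1`-form `α` with a `q`-form `β`:
`(α ∧ β)(v_0, …, v_q) = ∑_k (-1)^k α(v_k) β(v_0, …, v̂_k, …, v_q)`. -/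
def wedge {E : Type*} [NormedAddCommGroup E] [NormedSpace ℝ E] {q : ℕ} (α : E →L[ℝ] ℝ)
    (β : E [⋀^Fin q]→L[ℝ] ℝ) : E [⋀^Fin (q + 1)]→L[ℝ] ℝ :=
  ContinuousAlternatingMap.alternatizeUncurryFin (α.smulRight β)

/-- `α_0 ∧ (α_1 ∧ (⋯ ∧ α_{q-1}))`. -/
def wedgeAll {E : Type*} [NormedAddCommGroup E] [NormedSpace ℝ E] :
    (q : ℕ) → (Fin q → E →L[ℝ] ℝ) → E [⋀^Fin q]→L[ℝ] ℝ
  | 0, _ => ContinuousAlternatingMap.constOfIsEmpty ℝ E (Fin 0) 1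
  | q + 1, α => wedge (α 0) (wedgeAll q (fun k => α k.succ))

/-! ### Multi-indices and partial derivatives -/

/-- Symmetric multi-indices `J = {j_1 ≤ ⋯ ≤ j_k}` in `{1, …, n}` with `|J| = k ≤ s`. The
juxtaposition `jJ` is `j ::ₘ J`. -/
abbrev MultiIndex (n s : ℕ) : Type := {J : Multiset (Fin n) // J.card ≤ s}

instance (n s : ℕ) : Finite (MultiIndex n s) := by
  refine Finite.of_surjective
    (fun x : (Σ k : Fin (s + 1), Sym (Fin n) k) =>
      (⟨(x.2 : Multiset (Fin n)), by
        have h := x.2.2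
        have h' := x.1.2
        exact (le_of_eq h).trans (by omega)⟩ : MultiIndex n s)) ?_
  rintro ⟨J, hJ⟩
  exact ⟨⟨⟨J.card, by omega⟩, ⟨J, rfl⟩⟩, rfl⟩

instance (n s : ℕ) : Fintype (MultiIndex n s) := Fintype.ofFinite _

/-- The empty multi-index. -/
def MultiIndex.empty (n s : ℕ) : MultiIndex n s := ⟨0, Nat.zero_le s⟩

/-- The iterated partial derivative `∂^k f / ∂t^{j_1} ⋯ ∂t^{j_k}` for `L = [j_1, …, j_k]`. -/
def partialD {n : ℕ} {F : Type*} [NormedAddCommGroup F] [NormedSpace ℝ F] (L : List (Fin n))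
    (f : (Fin n → ℝ) → F) (t : Fin n → ℝ) : F :=
  iteratedFDeriv ℝ L.length f t (fun k => Pi.single (L.get k) 1)

/-! ### Regular velocities -/

/-- The coordinates `x^A_J`, `|J| ≤ s`, on the manifold of velocities. -/
abbrev TCoord (n m s : ℕ) : Type := Fin (n + m) × MultiIndex n s → ℝ

/-- `x^A_J`, with the convention that it is `0` for `|J| > s`. -/
def TCoord.get {n m s : ℕ} (w : TCoord n m s) (A : Fin (n + m)) (J : Multiset (Fin n)) : ℝ :=
  if h : J.card ≤ s then w (A, ⟨J, h⟩) else 0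

section Velocities

variable (n m s : ℕ) (X : Type u) [TopologicalSpace X]
  [ChartedSpace (EuclideanSpace ℝ (Fin (n + m))) X]

/-- The charts of the smooth manifold `X` of dimension `N = n + m`. The first `n` coordinates are
`x^i`, the last `m` are `x^σ`. Since all permutations of the coordinates of a chart are again
charts, any choice of `n` coordinates of a chart occurs as the first `n`. -/
abbrev XChart : Type u :=
  {ψ : OpenPartialHomeomorph X (EuclideanSpace ℝ (Fin (n + m))) //
    ψ ∈ IsManifold.maximalAtlas (𝓡 (n + m)) ∞ X}

/-- Smooth immersions `γ : U → X` of an open neighbourhood `U` of `0 ∈ ℝⁿ`. -/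
structure Immersion where
  toFun : (Fin n → ℝ) → X
  dom : Set (Fin n → ℝ)
  isOpen_dom : IsOpen dom
  zero_mem : 0 ∈ dom
  smooth : ContMDiffOn 𝓘(ℝ, Fin n → ℝ) (𝓡 (n + m)) ∞ toFun dom
  injective : ∀ t ∈ dom,
    Function.Injective (mfderiv 𝓘(ℝ, Fin n → ℝ) (𝓡 (n + m)) toFun t)

/-- Two immersions have the same `s`-jet at `0` when they have the same value at `0` and, in the
charts around this value, the same partial derivatives at `0` up to order `s`. -/
def jetSetoid : Setoid (Immersion n m X) where
  r γ δ := γ.toFun 0 = δ.toFun 0 ∧ ∀ ψ : XChart n m X, γ.toFun 0 ∈ ψ.1.source → ∀ k ≤ s,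
    iteratedFDeriv ℝ k (fun t => ψ.1 (γ.toFun t)) 0 =
      iteratedFDeriv ℝ k (fun t => ψ.1 (δ.toFun t)) 0
  iseqv := by
    refine ⟨fun γ => ⟨rfl, fun _ _ _ _ => rfl⟩, ?_, ?_⟩
    · rintro γ δ ⟨h0, h⟩
      exact ⟨h0.symm, fun ψ hψ k hk => (h ψ (h0 ▸ hψ) k hk).symm⟩
    · rintro γ δ ε ⟨h0, h⟩ ⟨h0', h'⟩
      exact ⟨h0.trans h0', fun ψ hψ k hk => (h ψ hψ k hk).trans (h' ψ (h0 ▸ hψ) k hk)⟩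

/-- The manifold `Imm T^s_n X` of regular velocities of order `s`. -/
def ImmT : Type u := Quotient (jetSetoid n m s X)

variable {n m s X}

/-- The coordinates of the `s`-jet of `γ` at `t` in the chart `ψ`:
`x^A_J = ∂^{|J|} (x^A ∘ γ) / ∂t^J (t)`. As a function of `t` this is the
expression of the prolongation `j^s γ` in the chart associated to `ψ`. -/
def jetCoords (s : ℕ) (ψ : XChart n m X) (γ : Immersion n m X) (t : Fin n → ℝ) : TCoord n m s :=
  fun w => partialD w.2.1.sort (fun t' => ψ.1 (γ.toFun t')) t w.1

namespace ImmT

/-- The point `γ(0)` of `X`. -/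
def target (p : ImmT n m s X) : X :=
  Quotient.lift (s := jetSetoid n m s X) (fun γ => γ.toFun 0) (fun _ _ h => h.1) p

open Classical in
/-- The coordinates of `p` in the chart associated to `ψ` (and `0` outside its domain). -/
def coord (ψ : XChart n m X) (p : ImmT n m s X) : TCoord n m s :=
  Quotient.lift (s := jetSetoid n m s X)
    (fun γ => if γ.toFun 0 ∈ ψ.1.source then jetCoords s ψ γ 0 else 0)
    (by
      rintro γ δ ⟨h0, h⟩
      by_cases hγ : γ.toFun 0 ∈ ψ.1.source
      · have hδ : δ.toFun 0 ∈ ψ.1.source := h0 ▸ hγ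
        simp only [hγ, hδ, if_true]
        funext w
        have hk : (w.2.1.sort).length ≤ s := by
          rw [Multiset.length_sort]; exact w.2.2
        simp only [jetCoords, partialD, h ψ hγ _ hk]
      · have hδ : δ.toFun 0 ∉ ψ.1.source := h0 ▸ hγ
        simp only [hγ, hδ, if_false]) p

variable (n m s X) in
/-- The system of associated charts on `Imm T^s_n X`. -/
abbrev charts : ChartSystem (ImmT n m s X) (TCoord n m s) where
  ι := XChart n m X
  dom ψ := {p | p.target ∈ ψ.1.source}
  coord := coord

end ImmT

end Velocities

/-! ### The differential group and its action -/

/-- Local diffeomorphisms of `ℝⁿ` around `0` which fix `0`. -/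
structure LocalDiff (n : ℕ) where
  toFun : (Fin n → ℝ) → (Fin n → ℝ)
  dom : Set (Fin n → ℝ)
  isOpen_dom : IsOpen dom
  zero_mem : 0 ∈ dom
  map_zero : toFun 0 = 0
  smooth : ContDiffOn ℝ ∞ toFun dom
  invertible : ∀ t ∈ dom, Function.Bijective (fderiv ℝ toFun t)

/-- Equality of `s`-jets at `0`. -/
def diffSetoid (n s : ℕ) : Setoid (LocalDiff n) where
  r α β := ∀ k ≤ s, iteratedFDeriv ℝ k α.toFun 0 = iteratedFDeriv ℝ k β.toFun 0
  iseqv := ⟨fun _ _ _ => rfl, fun h k hk => (h k hk).symm,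
    fun h h' k hk => (h k hk).trans (h' k hk)⟩

/-- The differential group `L^s_n` of invertible `s`-jets with source and target `0 ∈ ℝⁿ`. -/
def DiffGroup (n s : ℕ) : Type := Quotient (diffSetoid n s)

/-- The canonical coordinates `a^i_J` on `L^s_n`, `|J| ≤ s`. -/
def DiffGroup.coord {n s : ℕ} (a : DiffGroup n s) : Fin n × MultiIndex n s → ℝ :=
  Quotient.lift (s := diffSetoid n s) (fun α w => partialD w.2.1.sort α.toFun 0 w.1)
    (by
      intro α β h
      funext w
      have hk : (w.2.1.sort).length ≤ s := by
        rw [Multiset.length_sort]; exact w.2.2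
      simp only [partialD, h _ hk]) a

/-- `det(a) = det(a^i_j)` (for `s ≥ 1`). -/
def DiffGroup.det {n s : ℕ} (a : DiffGroup n s) : ℝ :=
  Matrix.det (Matrix.of fun i j : Fin n =>
    if h : ({j} : Multiset (Fin n)).card ≤ s then a.coord (i, ⟨{j}, h⟩) else 0)

section Action

variable {n m s : ℕ} {X : Type u} [TopologicalSpace X]
  [ChartedSpace (EuclideanSpace ℝ (Fin (n + m))) X]

/-- Reparametrisation `γ ∘ α`. -/
def Immersion.comp (γ : Immersion n m X) (α : LocalDiff n) : Immersion n m X where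
  toFun t := γ.toFun (α.toFun t)
  dom := α.dom ∩ α.toFun ⁻¹' γ.dom
  isOpen_dom := α.smooth.continuousOn.isOpen_inter_preimage α.isOpen_dom γ.isOpen_dom
  zero_mem := ⟨α.zero_mem, by simpa [α.map_zero] using γ.zero_mem⟩
  smooth := γ.smooth.comp (α.smooth.contMDiffOn.mono inter_subset_left) (fun _ ht => ht.2)
  injective := by
    intro t ht
    have h1 : MDifferentiableAt 𝓘(ℝ, Fin n → ℝ) (𝓡 (n + m)) γ.toFun (α.toFun t) :=
      (γ.smooth.contMDiffAt (γ.isOpen_dom.mem_nhds ht.2)).mdifferentiableAt (by simp)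
    have h2 : MDifferentiableAt 𝓘(ℝ, Fin n → ℝ) 𝓘(ℝ, Fin n → ℝ) α.toFun t :=
      ((α.smooth.contMDiffOn).contMDiffAt (α.isOpen_dom.mem_nhds ht.1)).mdifferentiableAt
        (by simp)
    have h3 := mfderiv_comp t h1 h2
    have h4 : (fun t => γ.toFun (α.toFun t)) = γ.toFun ∘ α.toFun := rfl
    rw [h4, h3, mfderiv_eq_fderiv]
    exact (γ.injective _ ht.2).comp (α.invertible t ht.1).1

theorem taylorComp_congr {E F G : Type*} [NormedAddCommGroup E] [NormedSpace ℝ E]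
    [NormedAddCommGroup F] [NormedSpace ℝ F] [NormedAddCommGroup G] [NormedSpace ℝ G]
    {g g' : FormalMultilinearSeries ℝ F G} {f f' : FormalMultilinearSeries ℝ E F} {k : ℕ}
    (hg : ∀ l ≤ k, g l = g' l) (hf : ∀ l ≤ k, f l = f' l) :
    g.taylorComp f k = g'.taylorComp f' k := by
  unfold FormalMultilinearSeries.taylorComp
  refine Finset.sum_congr rfl fun c _ => ?_
  have h1 : g c.length = g' c.length := hg _ c.length_le
  have h2 : (fun i => f (c.partSize i)) = fun i => f' (c.partSize i) := by
    funext i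
    exact hf _ (c.partSize_le i)
  unfold FormalMultilinearSeries.compAlongOrderedFinpartition
  rw [h1, h2]

theorem contDiffAt_chart [IsManifold (𝓡 (n + m)) ∞ X] (γ : Immersion n m X) (ψ : XChart n m X)
    (h : γ.toFun 0 ∈ ψ.1.source) : ContDiffAt ℝ ∞ (fun t => ψ.1 (γ.toFun t)) 0 := by
  have h1 : ContMDiffAt (𝓡 (n + m)) (𝓡 (n + m)) ∞ ψ.1 (γ.toFun 0) :=
    contMDiffAt_of_mem_maximalAtlas ψ.2 h
  have h2 := γ.smooth.contMDiffAt (γ.isOpen_dom.mem_nhds γ.zero_mem)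
  exact (h1.comp (0 : Fin n → ℝ) h2).contDiffAt

/-- The right action `j^s_0 γ · j^s_0 α = j^s_0 (γ ∘ α)` of the differential group. -/
def ImmT.act [IsManifold (𝓡 (n + m)) ∞ X] (p : ImmT n m s X) (a : DiffGroup n s) :
    ImmT n m s X :=
  Quotient.map₂ (sa := jetSetoid n m s X) (sb := diffSetoid n s) (sc := jetSetoid n m s X)
    Immersion.comp
    (by
      rintro γ δ ⟨h0, h⟩ α β hα
      refine ⟨by simpa [Immersion.comp, α.map_zero, β.map_zero] using h0, ?_⟩
      intro ψ hψ k hk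
      have hγ : γ.toFun 0 ∈ ψ.1.source := by simpa [Immersion.comp, α.map_zero] using hψ
      have hδ : δ.toFun 0 ∈ ψ.1.source := h0 ▸ hγ
      have sγ : ContDiffAt ℝ k (fun t => ψ.1 (γ.toFun t)) (α.toFun 0) := by
        rw [α.map_zero]
        exact (contDiffAt_chart γ ψ hγ).of_le (by exact_mod_cast le_top)
      have sδ : ContDiffAt ℝ k (fun t => ψ.1 (δ.toFun t)) (β.toFun 0) := by
        rw [β.map_zero]
        exact (contDiffAt_chart δ ψ hδ).of_le (by exact_mod_cast le_top)
      have sα : ContDiffAt ℝ k α.toFun 0 :=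
        (α.smooth.contDiffAt (α.isOpen_dom.mem_nhds α.zero_mem)).of_le (by exact_mod_cast le_top)
      have sβ : ContDiffAt ℝ k β.toFun 0 :=
        (β.smooth.contDiffAt (β.isOpen_dom.mem_nhds β.zero_mem)).of_le (by exact_mod_cast le_top)
      have e1 := iteratedFDeriv_comp sγ sα (i := k) le_rfl
      have e2 := iteratedFDeriv_comp sδ sβ (i := k) le_rfl
      refine e1.trans (Eq.trans ?_ e2.symm)
      refine taylorComp_congr (fun l hl => ?_) (fun l hl => ?_)
      · rw [α.map_zero, β.map_zero]
        exact h ψ hγ l (hl.trans hk)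
      · exact hα l (hl.trans hk)) p a

end Action

/-! ### Invariants and the Grassmann manifold -/

/-- The formal derivative `d_j f = ∑_{|J| ≤ s-1} x^A_{jJ} ∂f/∂x^A_J`. -/
def formalD {n m s : ℕ} (j : Fin n) (f : TCoord n m s → ℝ) : TCoord n m s → ℝ :=
  fun w => fderiv ℝ f w (fun AJ => w.get AJ.1 (j ::ₘ AJ.2.1))

/-- The matrix `(x^i_j)`. -/
def xMat {n m s : ℕ} (w : TCoord n m s) : Matrix (Fin n) (Fin n) ℝ :=
  Matrix.of fun i j => w.get (Fin.castAdd m i) {j}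

/-- The functions `y^σ_{i_1, …, i_k}`: `y^σ = x^σ` and
`y^σ_{i_1, …, i_k} = z^j_{i_1} d_j y^σ_{i_2, …, i_k}`, where `(z^i_j)` is the inverse of `(x^i_j)`. -/
def yFun {n m s : ℕ} (σ : Fin m) : List (Fin n) → TCoord n m s → ℝ
  | [] => fun w => w.get (Fin.natAdd n σ) 0
  | i :: L => fun w => ∑ j, (xMat w)⁻¹ j i * formalD j (yFun σ L) w

/-- The coordinates `x^i` and `y^σ_J`, `|J| ≤ s`, on the Grassmann manifold. -/
abbrev PCoord (n m s : ℕ) : Type := Fin n ⊕ (Fin m × MultiIndex n s) → ℝ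

/-- `y^σ_J`, with the convention that it is `0` for `|J| > s`. -/
def PCoord.get {n m s : ℕ} (w : PCoord n m s) (σ : Fin m) (J : Multiset (Fin n)) : ℝ :=
  if h : J.card ≤ s then w (Sum.inr (σ, ⟨J, h⟩)) else 0

section Grassmannian

variable (n m s : ℕ) (X : Type u) [TopologicalSpace X]
  [ChartedSpace (EuclideanSpace ℝ (Fin (n + m))) X] [IsManifold (𝓡 (n + m)) ∞ X]

/-- The Grassmann manifold `P^s_n X = Imm T^s_n X / L^s_n`. -/
def GrassmannManifold : Type u :=
  Quot (fun p p' : ImmT n m s X => ∃ a : DiffGroup n s, p' = p.act a)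

variable {n m s X}

/-- The projection `ρ : Imm T^s_n X → P^s_n X`. -/
def rho (p : ImmT n m s X) : GrassmannManifold n m s X := Quot.mk _ p

/-- The open set `W^s` of those `p` over the chart domain of `ψ` with `det(x^i_j) ≠ 0`. -/
def W (s : ℕ) (ψ : XChart n m X) : Set (ImmT n m s X) :=
  {p | p.target ∈ ψ.1.source ∧ (xMat (p.coord ψ)).det ≠ 0}

open Classical in
/-- The coordinates `(x^i, y^σ_J)` of a point of `ρ(W^s)`, computed on a representative in `W^s`
(they are invariant functions), and `0` outside `ρ(W^s)`. -/
def GrassmannManifold.coord (ψ : XChart n m X) (c : GrassmannManifold n m s X) : PCoord n m s :=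
  if h : ∃ p ∈ W s ψ, rho p = c then
    Sum.elim (fun i => (h.choose.coord ψ).get (Fin.castAdd m i) 0)
      (fun σJ => yFun σJ.1 σJ.2.1.sort (h.choose.coord ψ))
  else 0

variable (n m s X) in
/-- The system of charts `(ρ(W^s), (x^i, y^σ_J))` on `P^s_n X`. -/
abbrev GrassmannManifold.charts :
    ChartSystem (GrassmannManifold n m s X) (PCoord n m s) where
  ι := XChart n m X
  dom ψ := rho '' W s ψ
  coord := GrassmannManifold.coord

end Grassmannian

/-! ### Forms and derivations in a chart of the Grassmann manifold -/

section Local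

variable {n m s : ℕ}

/-- `dx^i`. -/
def dX (i : Fin n) : PCoord n m s →L[ℝ] ℝ := ContinuousLinearMap.proj (Sum.inl i)

/-- `dy^σ_J` for `|J| ≤ s`. -/
def dY (σ : Fin m) (J : Multiset (Fin n)) : PCoord n m s →L[ℝ] ℝ :=
  if h : J.card ≤ s then ContinuousLinearMap.proj (Sum.inr (σ, ⟨J, h⟩)) else 0

/-- `θ_0 = dx^1 ∧ ⋯ ∧ dx^n`. -/
def theta0 : PCoord n m s [⋀^Fin n]→L[ℝ] ℝ := wedgeAll n dX

/-- `ω^σ_J = dy^σ_J - y^σ_{iJ} dx^i`, for `|J| ≤ s - 1`. -/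
def omega (σ : Fin m) (J : Multiset (Fin n)) (w : PCoord n m s) : PCoord n m s →L[ℝ] ℝ :=
  dY σ J - ∑ i, w.get σ (i ::ₘ J) • dX i

/-- `dω^σ_J ∧ β`, where `dω^σ_J = - dy^σ_{iJ} ∧ dx^i`, for `|J| ≤ s - 1`. -/
def dOmegaWedge {q : ℕ} (σ : Fin m) (J : Multiset (Fin n))
    (β : PCoord n m s [⋀^Fin q]→L[ℝ] ℝ) : PCoord n m s [⋀^Fin (q + 2)]→L[ℝ] ℝ :=
  -∑ i, wedge (dY σ (i ::ₘ J)) (wedge (dX i) β)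

/-- `IsContactPow D k q ρ`: on the set `D` of coordinate values, the `q`-form `ρ` is a sum of terms
`η_1 ∧ ⋯ ∧ η_k ∧ Φ`, where every `η_l` is one of the forms `ω^σ_J` with `|J| ≤ s - 1` or one of
the forms `dω^σ_I` with `|I| = s - 1`, and `Φ` is a smooth form of the complementary degree
(there is no such term when this degree is negative). -/
inductive IsContactPow (D : Set (PCoord n m s)) :
    (k q : ℕ) → (PCoord n m s → PCoord n m s [⋀^Fin q]→L[ℝ] ℝ) → Prop
  | smooth {q : ℕ} (β : PCoord n m s → PCoord n m s [⋀^Fin q]→L[ℝ] ℝ)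
      (hβ : ContDiffOn ℝ ∞ β D) : IsContactPow D 0 q β
  | omega_wedge {k q : ℕ} (σ : Fin m) (J : Multiset (Fin n)) (hJ : J.card + 1 ≤ s)
      (β : PCoord n m s → PCoord n m s [⋀^Fin q]→L[ℝ] ℝ) (hβ : IsContactPow D k q β) :
      IsContactPow D (k + 1) (q + 1) (fun w => wedge (omega σ J w) (β w))
  | dOmega_wedge {k q : ℕ} (σ : Fin m) (I : Multiset (Fin n)) (hI : I.card + 1 = s)
      (β : PCoord n m s → PCoord n m s [⋀^Fin q]→L[ℝ] ℝ) (hβ : IsContactPow D k q β) :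
      IsContactPow D (k + 1) (q + 2) (fun w => dOmegaWedge σ I (β w))
  | zero {k q : ℕ} : IsContactPow D k q 0
  | add {k q : ℕ} (β β' : PCoord n m s → PCoord n m s [⋀^Fin q]→L[ℝ] ℝ)
      (hβ : IsContactPow D k q β) (hβ' : IsContactPow D k q β') : IsContactPow D k q (β + β')
  | neg {k q : ℕ} (β : PCoord n m s → PCoord n m s [⋀^Fin q]→L[ℝ] ℝ)
      (hβ : IsContactPow D k q β) : IsContactPow D k q (-β)
  | congr {k q : ℕ} (β β' : PCoord n m s → PCoord n m s [⋀^Fin q]→L[ℝ] ℝ)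
      (hβ : IsContactPow D k q β) (h : EqOn β' β D) : IsContactPow D k q β'

/-- Strongly contact `(n+1)`-forms in a chart: those with `k = (n + 1) - n + 1 = 2` contact
factors. -/
def IsStronglyContactOn (D : Set (PCoord n m s))
    (ρ : PCoord n m s → PCoord n m s [⋀^Fin (n + 1)]→L[ℝ] ℝ) : Prop :=
  IsContactPow D 2 (n + 1) ρ

/-- The total derivative `D_i = ∂/∂x^i + ∑_{|J| ≤ s-1} y^σ_{iJ} ∂/∂y^σ_J`. -/
def totalD (i : Fin n) (f : PCoord n m s → ℝ) : PCoord n m s → ℝ :=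
  fun w => fderiv ℝ f w
    (Sum.elim (fun k => if k = i then 1 else 0) (fun σJ => w.get σJ.1 (i ::ₘ σJ.2.1)))

/-- `Δ_σ = ∂/∂y^σ`. -/
def deltaD (σ : Fin m) (f : PCoord n m s → ℝ) : PCoord n m s → ℝ :=
  fun w => fderiv ℝ f w (Pi.single (Sum.inr (σ, MultiIndex.empty n s)) 1)

end Local

section Global

variable {n m s : ℕ} {X : Type u} [TopologicalSpace X]
  [ChartedSpace (EuclideanSpace ℝ (Fin (n + m))) X] [IsManifold (𝓡 (n + m)) ∞ X]

variable (n m s X) in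
/-- The space `Ω^s_{n+1}(PX)` of smooth `(n+1)`-forms on `P^s_n X`. -/
abbrev Omega : AddSubgroup (XChart n m X → PCoord n m s → PCoord n m s [⋀^Fin (n + 1)]→L[ℝ] ℝ) :=
  (GrassmannManifold.charts n m s X).DForm (n + 1)

variable (n m s X) in
/-- The space `Ω^s_{n+1(c)}(PX)` of strongly contact `(n+1)`-forms on `P^s_n X`. -/
def OmegaContact : AddSubgroup (Omega n m s X) where
  carrier := {ρ | ∀ ψ : XChart n m X,
    IsStronglyContactOn ((GrassmannManifold.charts n m s X).range ψ) (ρ.1 ψ)}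
  zero_mem' := fun _ => IsContactPow.zero
  add_mem' := fun ha hb ψ => IsContactPow.add _ _ (ha ψ) (hb ψ)
  neg_mem' := fun ha ψ => IsContactPow.neg _ (ha ψ)

/-- `x̄^j` (coordinate of the chart `φ`) as a function of the coordinates `(x^i, y^σ_J)` of `ψ`. -/
def xBar (ψ φ : XChart n m X) (j : Fin n) : PCoord n m s → ℝ :=
  (GrassmannManifold.charts n m s X).expr ψ (fun c => c.coord φ (Sum.inl j))

/-- `ȳ^ν` (coordinate of the chart `φ`) as a function of the coordinates `(x^i, y^σ_J)` of `ψ`. -/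
def yBar (ψ φ : XChart n m X) (ν : Fin m) : PCoord n m s → ℝ :=
  (GrassmannManifold.charts n m s X).expr ψ (fun c => (c.coord φ).get ν 0)

/-- `𝒥 = det(D_i x̄^j)` on the overlap of the charts `ψ` and `φ` (barred). -/
def jac (ψ φ : XChart n m X) (c : GrassmannManifold n m s X) : ℝ :=
  Matrix.det (Matrix.of fun i j : Fin n => totalD i (xBar (s := s) ψ φ j) (c.coord ψ))

/-- `P^ν_σ = Δ_σ ȳ^ν - ȳ^ν_i Δ_σ x̄^i` on the overlap of the charts `ψ` and `φ` (barred). -/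
def pMat (ψ φ : XChart n m X) (c : GrassmannManifold n m s X) (ν σ : Fin m) : ℝ :=
  deltaD σ (yBar (s := s) ψ φ ν) (c.coord ψ) -
    ∑ i, (c.coord φ).get ν {i} * deltaD σ (xBar (s := s) ψ φ i) (c.coord ψ)

/-- The component `𝒯_A` of a `1`-form on `Imm T^s_n X` in the chart associated to `ψ`,
as a function of the point. -/
def component (𝒯 : (ImmT.charts n m s X).DForm 1) (ψ : XChart n m X) (A : Fin (n + m))
    (p : ImmT n m s X) : ℝ :=
  𝒯.1 ψ (p.coord ψ) (fun _ => Pi.single (A, MultiIndex.empty n s) 1)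

/-- A differential equation on `Imm T^s_n X`: a `1`-form with local expressions
`𝒯 = 𝒯_A dx^A`. -/
def IsDifferentialEquation (𝒯 : (ImmT.charts n m s X).DForm 1) : Prop :=
  ∀ (ψ : XChart n m X) (p : ImmT n m s X), p.target ∈ ψ.1.source → ∀ v : TCoord n m s,
    𝒯.1 ψ (p.coord ψ) (fun _ => v) =
      ∑ A, component 𝒯 ψ A p * v (A, MultiIndex.empty n s)

/-- A homogeneous differential equation: `(φ_a)^* 𝒯 = det(a) 𝒯` for all `a ∈ L^s_n` and
`(j^s γ)^* 𝒯 = 0` for all immersions `γ`. -/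
structure IsHomogeneous (𝒯 : (ImmT.charts n m s X).DForm 1) : Prop where
  isDifferentialEquation : IsDifferentialEquation 𝒯
  equivariant : ∀ (a : DiffGroup n s) (ψ φ : XChart n m X) (p : ImmT n m s X),
    p ∈ (ImmT.charts n m s X).dom ψ → p.act a ∈ (ImmT.charts n m s X).dom φ →
      (ImmT.charts n m s X).pullbackAt (ImmT.charts n m s X) (fun p' => p'.act a) 𝒯.1 ψ φ p =
        a.det • 𝒯.1 ψ (p.coord ψ)
  pullback_jet : ∀ (γ : Immersion n m X) (ψ : XChart n m X), ∀ t ∈ γ.dom,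
    γ.toFun t ∈ ψ.1.source →
      (𝒯.1 ψ (jetCoords s ψ γ t)).compContinuousLinearMap
        (fderiv ℝ (jetCoords s ψ γ) t) = 0

/-- The functions `T_σ` are the local components on `ρ(W^s)` of the
non-homogeneous equation associated to `𝒯` in the chart `ψ`: they are smooth and
`𝒯_σ = det(x) T_σ ∘ ρ`, `𝒯_i = - det(x) y^σ_i T_σ ∘ ρ` on `W^s`. -/
def IsLocalForm (𝒯 : (ImmT.charts n m s X).DForm 1) (ψ : XChart n m X)
    (T : Fin m → GrassmannManifold n m s X → ℝ) : Prop :=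
  (∀ σ, ContDiffOn ℝ ∞ ((GrassmannManifold.charts n m s X).expr ψ (T σ))
    ((GrassmannManifold.charts n m s X).range ψ)) ∧
  ∀ p ∈ W s ψ,
    (∀ σ, component 𝒯 ψ (Fin.natAdd n σ) p = (xMat (p.coord ψ)).det * T σ (rho p)) ∧
    ∀ i, component 𝒯 ψ (Fin.castAdd m i) p =
      -(xMat (p.coord ψ)).det * ∑ σ, yFun σ [i] (p.coord ψ) * T σ (rho p)

/-- The `(n+1)`-form `T_σ ω^σ ∧ θ_0` in the chart `ψ`. -/
def localForm (ψ : XChart n m X) (T : Fin m → GrassmannManifold n m s X → ℝ) :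
    PCoord n m s → PCoord n m s [⋀^Fin (n + 1)]→L[ℝ] ℝ :=
  fun w => ∑ σ, (GrassmannManifold.charts n m s X).expr ψ (T σ) w • wedge (omega σ 0 w) theta0

end Global

end Grassmann

end

noncomputable section

namespace Grassmann

set_option linter.unusedSectionVars false

/-! ### Calculus of iterated partial derivatives -/

section PartialDerivatives

variable {n : ℕ} {F G : Type*} [NormedAddCommGroup F] [NormedSpace ℝ F]
  [NormedAddCommGroup G] [NormedSpace ℝ G]

/-! Everything rests on a normal form for the points of `W`. By the inverse function theorem a
velocity with `det(x^i_j) ≠ 0` can be reparametrised so that it comes from a graph `t ↦ (x + t, f(x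
+ t))` (`exists_graph`). For any parametrisation of that graph the invariants `y^σ_J` are the
partial derivatives of `f^σ` (`yFun_jetOf`), so they do not change along orbits (`pc_coord_act`),
and each orbit in `W` has exactly one representative with the coordinates `canon (x, y)`. Hence
`canon` is the coordinate form of a smooth section of `ρ` over `ρ(W)`, and on it the matrix
`(x^i_j)` is the identity.

Statement 1. Under the group, `𝒯_σ` and `det(x)` are both multiplied by `det(a)`, so `𝒯_σ / det(x)`
descends to a function `T_σ`; along the section it equals `𝒯_σ`, which gives smoothness. Vanishing
along prolongations means `𝒯_A x^A_j = 0`. Since `x^σ_j = y^σ_i x^i_j` and `(x^i_j)` is invertible,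
`𝒯_i = -y^σ_i 𝒯_σ`. Together, `𝒯 = det(x) T_σ (dx^σ - y^σ_i dx^i)` on `W`.

Statement 2. Read this identity in two charts at the graph velocity of the first one. There `det(x)
= 1`, while the determinant in the second chart is `𝒥`. So `T_σ ω^σ` is `𝒥` times the pull-back of
the barred form (`IsLocalForm.sum_contact_eq`); evaluation on `∂/∂y^σ` gives the transformation
rule.

Statement 3. Uniqueness is formal: two classes with the property have representatives whose
difference is strongly contact in every chart. For existence, `T_σ ω^σ ∧ θ_0` does not glue, because
`θ_0` acquires the factor `𝒥` only modulo contact forms. A Riemannian metric on `X` repairs this.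
Let `β^j` be the components, in the frame of a contact element, of the orthogonal projection onto
it. They have the form `dx^j` plus a combination of the `ω^σ` (`tanCoef_comp_hor`) and transform
exactly by the Jacobi matrix `(D_j x̄^i)` (`tanCoef_trans`). So `β^1 ∧ ⋯ ∧ β^n` produces exactly the
determinant that cancels the factor of `T_σ ω^σ`, and `T_σ ω^σ ∧ β^1 ∧ ⋯ ∧ β^n` is a global form. It
differs from `T_σ ω^σ ∧ θ_0` by terms with two contact factors. Only a partition of unity on `X` is
needed, none on the Grassmann manifold. -/

theorem partialD_nil (f : (Fin n → ℝ) → F) (t : Fin n → ℝ) : partialD [] f t = f t := by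
  simp [partialD]

theorem partialD_congr {f g : (Fin n → ℝ) → F} {t : Fin n → ℝ} (L : List (Fin n))
    (h : f =ᶠ[𝓝 t] g) : partialD L f t = partialD L g t := by
  unfold partialD
  rw [(h.iteratedFDeriv (𝕜 := ℝ) L.length).eq_of_nhds]

theorem partialD_cons {f : (Fin n → ℝ) → F} {t : Fin n → ℝ} (hf : ContDiffAt ℝ ∞ f t)
    (i : Fin n) (L : List (Fin n)) :
    partialD (i :: L) f t = fderiv ℝ (partialD L f) t (Pi.single i 1) := by
  have hd : DifferentiableAt ℝ (iteratedFDeriv ℝ L.length f) t :=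
    hf.differentiableAt_iteratedFDeriv (by exact_mod_cast WithTop.coe_lt_top _)
  have h := (ContinuousMultilinearMap.apply ℝ (fun _ : Fin L.length => Fin n → ℝ) F
    (fun k => Pi.single (L.get k) 1)).hasFDerivAt.comp t hd.hasFDerivAt
  have h2 : partialD L f = (ContinuousMultilinearMap.apply ℝ (fun _ : Fin L.length => Fin n → ℝ) F
    (fun k => Pi.single (L.get k) 1)) ∘ iteratedFDeriv ℝ L.length f := rfl
  rw [h2, h.fderiv]
  exact iteratedFDeriv_succ_apply_left _

theorem contDiffAt_partialD {f : (Fin n → ℝ) → F} {t : Fin n → ℝ} (hf : ContDiffAt ℝ ∞ f t)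
    (L : List (Fin n)) : ContDiffAt ℝ ∞ (partialD L f) t := by
  have h : ContDiffAt ℝ ∞ (iteratedFDeriv ℝ L.length f) t :=
    hf.iteratedFDeriv_right (by exact_mod_cast le_top)
  exact (ContinuousMultilinearMap.apply ℝ (fun _ : Fin L.length => Fin n → ℝ) F
    (fun k => Pi.single (L.get k) 1)).contDiff.contDiffAt.comp t h

theorem partialD_clm_comp {f : (Fin n → ℝ) → F} {t : Fin n → ℝ} (hf : ContDiffAt ℝ ∞ f t)
    (g : F →L[ℝ] G) (L : List (Fin n)) :
    partialD L (fun t' => g (f t')) t = g (partialD L f t) := by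
  have h := g.iteratedFDeriv_comp_left hf (i := L.length) (by exact_mod_cast le_top)
  have h' : (fun t' => g (f t')) = g ∘ f := rfl
  unfold partialD
  rw [h', h]
  rfl

/-- Symmetry of second derivatives, applied to adjacent transpositions. The claim is made on an open
set and not at one point because the `cons` step differentiates the inductive identity. -/
theorem partialD_perm {f : (Fin n → ℝ) → F} {U : Set (Fin n → ℝ)} (hU : IsOpen U)
    (hf : ContDiffOn ℝ ∞ f U) {L L' : List (Fin n)} (h : L.Perm L') :
    ∀ t ∈ U, partialD L f t = partialD L' f t := by
  have hfa : ∀ t ∈ U, ContDiffAt ℝ ∞ f t := fun t ht => hf.contDiffAt (hU.mem_nhds ht)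
  induction h with
  | nil => exact fun _ _ => rfl
  | cons i _ ih =>
    intro t ht
    rw [partialD_cons (hfa t ht), partialD_cons (hfa t ht)]
    have : partialD _ f =ᶠ[𝓝 t] partialD _ f :=
      Filter.mem_of_superset (hU.mem_nhds ht) (fun t' ht' => ih t' ht')
    rw [this.fderiv_eq]
  | swap i j L =>
    intro t ht
    have key : ∀ a b : Fin n, partialD (a :: b :: L) f t =
        fderiv ℝ (fderiv ℝ (partialD L f)) t (Pi.single a 1) (Pi.single b 1) := by
      intro a b
      rw [partialD_cons (hfa t ht)]
      have h1 : partialD (b :: L) f =ᶠ[𝓝 t] fun t' => fderiv ℝ (partialD L f) t' (Pi.single b 1) :=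
        Filter.mem_of_superset (hU.mem_nhds ht) (fun t' ht' => partialD_cons (hfa t' ht') b L)
      rw [h1.fderiv_eq]
      have h2 : DifferentiableAt ℝ (fderiv ℝ (partialD L f)) t :=
        ((contDiffAt_partialD (hfa t ht) L).fderiv_right (m := ∞) (by simp)).differentiableAt
          (by simp)
      rw [fderiv_clm_apply h2 (differentiableAt_const _)]
      simp
    rw [key, key]
    have hs : IsSymmSndFDerivAt ℝ (partialD L f) t :=
      (contDiffAt_partialD (hfa t ht) L).isSymmSndFDerivAt
        (by
          simp only [minSmoothness_of_isRCLikeNormedField]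
          exact WithTop.coe_le_coe.2 (le_top : (2 : ℕ∞) ≤ ⊤))
    exact hs _ _
  | trans _ _ ih1 ih2 => exact fun t ht => (ih1 t ht).trans (ih2 t ht)

theorem partialD_sort_cons {f : (Fin n → ℝ) → F} {U : Set (Fin n → ℝ)} (hU : IsOpen U)
    (hf : ContDiffOn ℝ ∞ f U) (j : Fin n) (J : Multiset (Fin n)) {t : Fin n → ℝ} (ht : t ∈ U) :
    partialD (j ::ₘ J).sort f t = fderiv ℝ (partialD J.sort f) t (Pi.single j 1) := by
  rw [← partialD_cons (hf.contDiffAt (hU.mem_nhds ht))]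
  refine partialD_perm hU hf ?_ t ht
  rw [← Multiset.coe_eq_coe, ← Multiset.cons_coe, Multiset.sort_eq, Multiset.sort_eq]

theorem partialD_singleton {f : (Fin n → ℝ) → F} {t : Fin n → ℝ} (hf : ContDiffAt ℝ ∞ f t)
    (i : Fin n) : partialD ({i} : Multiset (Fin n)).sort f t = fderiv ℝ f t (Pi.single i 1) := by
  have h : partialD [] f = f := funext fun t' => partialD_nil f t'
  rw [Multiset.sort_singleton, partialD_cons hf, h]

/-- A multilinear map is determined by its values on basis vectors, and the order of the indices is
irrelevant. This leads back from the coordinates `x^A_J`, defined with sorted indices, to the full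
derivatives that define a jet. -/
theorem iteratedFDeriv_eq_of_partialD_eq {f g : (Fin n → ℝ) → F} {U : Set (Fin n → ℝ)}
    (hU : IsOpen U) (hf : ContDiffOn ℝ ∞ f U) (hg : ContDiffOn ℝ ∞ g U) {t : Fin n → ℝ}
    (ht : t ∈ U) {k : ℕ} (h : ∀ J : Multiset (Fin n), J.card = k →
      partialD J.sort f t = partialD J.sort g t) :
    iteratedFDeriv ℝ k f t = iteratedFDeriv ℝ k g t := by
  have h' : ∀ L : List (Fin n), L.length = k → partialD L f t = partialD L g t := by
    intro L hL
    have hp : L.Perm (L : Multiset (Fin n)).sort := by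
      rw [← Multiset.coe_eq_coe, Multiset.sort_eq]
    rw [partialD_perm hU hf hp t ht, partialD_perm hU hg hp t ht]
    exact h _ (by simpa using hL)
  apply ContinuousMultilinearMap.toMultilinearMap_injective
  refine Module.Basis.ext_multilinear (fun _ => Pi.basisFun ℝ (Fin n)) fun v => ?_
  have h1 := h' (List.ofFn v) (by simp)
  have key : ∀ (φ : (Fin n → ℝ) → F), partialD (List.ofFn v) φ t =
      iteratedFDeriv ℝ k φ t (fun i => Pi.single (v i) 1) := by
    intro φ
    have aux : ∀ (L : List (Fin n)) (hL : L.length = k), partialD L φ t =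
      iteratedFDeriv ℝ k φ t (fun i => Pi.single (L.get (Fin.cast hL.symm i)) 1) := by
      intro L hL
      subst hL
      rfl
    rw [aux _ (by simp)]
    congr 1
    funext i
    simp
  rw [key, key] at h1
  simpa [Pi.basisFun_apply] using h1

/-- Partial derivatives depend smoothly on parameters. -/
theorem contDiffOn_partialD_param {P : Type*} [NormedAddCommGroup P] [NormedSpace ℝ P]
    {H : P × (Fin n → ℝ) → F} {U : Set (P × (Fin n → ℝ))} (hU : IsOpen U)
    (hH : ContDiffOn ℝ ∞ H U) (L : List (Fin n)) :
    ContDiffOn ℝ ∞ (fun x : P × (Fin n → ℝ) => partialD L (fun t => H (x.1, t)) x.2) U := by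
  induction L with
  | nil => simpa only [partialD_nil] using hH
  | cons i L ih =>
    -- A partial derivative in `t` is the joint derivative in the direction `(0, e_i)`, which is
    -- smooth in both variables.
    have h1 := (ih.fderiv_of_isOpen hU (m := ∞) (by simp)).clm_apply
      (contDiffOn_const (c := ((0 : P), (Pi.single i 1 : Fin n → ℝ))))
    refine h1.congr ?_
    rintro ⟨p, t⟩ hx
    have hcurve : HasFDerivAt (fun t' : Fin n → ℝ => (p, t'))
        (ContinuousLinearMap.inr ℝ P (Fin n → ℝ)) t := hasFDerivAt_prodMk_right p t
    have hHa : ContDiffAt ℝ ∞ (fun t' => H (p, t')) t :=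
      ContDiffAt.comp t (hH.contDiffAt (hU.mem_nhds hx)) (contDiffAt_const.prodMk contDiffAt_id)
    have h2 := ((ih.contDiffAt (hU.mem_nhds hx)).differentiableAt (by simp)).hasFDerivAt.comp t
      hcurve
    simp only
    rw [partialD_cons hHa]
    have h3 : partialD L (fun t' => H (p, t')) =
      (fun x : P × (Fin n → ℝ) => partialD L (fun t => H (x.1, t)) x.2) ∘ fun t' => (p, t') := rfl
    rw [h3, h2.fderiv]
    simp

/-! ### Monomials -/

/-- The monomial `t^J / J!`. -/
def mono (J : Multiset (Fin n)) (t : Fin n → ℝ) : ℝ :=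
  ∏ k, t k ^ J.count k / (J.count k).factorial

theorem contDiff_mono (J : Multiset (Fin n)) : ContDiff ℝ ∞ (mono J) := by
  unfold mono
  fun_prop

theorem mono_zero (J : Multiset (Fin n)) : mono J 0 = if J = 0 then 1 else 0 := by
  unfold mono
  split_ifs with h
  · simp [h]
  · obtain ⟨k, hk⟩ := Multiset.exists_mem_of_ne_zero h
    refine Finset.prod_eq_zero (Finset.mem_univ k) ?_
    have : J.count k ≠ 0 := Multiset.count_ne_zero.2 hk
    simp [this]

/-- The factor `1/J!` absorbs the exponent, so differentiation merely removes an index. This is what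
makes monomials and derivatives at `0` dual bases in `partialD_mono_zero`. -/
theorem fderiv_mono (J : Multiset (Fin n)) (t : Fin n → ℝ) (i : Fin n) :
    fderiv ℝ (mono J) t (Pi.single i 1) = if i ∈ J then mono (J.erase i) t else 0 := by
  have hg : ∀ k ∈ (Finset.univ : Finset (Fin n)),
      HasFDerivAt (fun t : Fin n → ℝ => t k ^ J.count k / (J.count k).factorial)
        (((J.count k * t k ^ (J.count k - 1)) / (J.count k).factorial : ℝ) •
          (ContinuousLinearMap.proj k : (Fin n → ℝ) →L[ℝ] ℝ)) t := by
    intro k _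
    have h1 : HasDerivAt (fun x : ℝ => x ^ J.count k / (J.count k).factorial)
        ((J.count k * t k ^ (J.count k - 1)) / (J.count k).factorial) (t k) := by
      simpa using (hasDerivAt_pow (J.count k) (t k)).div_const _
    exact h1.comp_hasFDerivAt t
      (ContinuousLinearMap.proj k : (Fin n → ℝ) →L[ℝ] ℝ).hasFDerivAt
  have h := HasFDerivAt.finsetProd hg
  unfold mono
  rw [h.fderiv]
  simp only [_root_.sum_apply, _root_.smul_apply,
    ContinuousLinearMap.proj_apply, smul_eq_mul]
  rw [Finset.sum_eq_single i]
  · rw [← Finset.mul_prod_erase Finset.univ _ (Finset.mem_univ i)]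
    split_ifs with hi
    · have hc : J.count i ≠ 0 := Multiset.count_ne_zero.2 hi
      rw [Multiset.count_erase_self]
      have h2 : ∏ x ∈ Finset.univ.erase i, t x ^ (J.erase i).count x / ((J.erase i).count x).factorial
          = ∏ x ∈ Finset.univ.erase i, t x ^ J.count x / (J.count x).factorial := by
        refine Finset.prod_congr rfl fun x hx => ?_
        rw [Multiset.count_erase_of_ne (Finset.ne_of_mem_erase hx)]
      rw [h2, mul_comm]
      congr 1
      obtain ⟨c, hc'⟩ := Nat.exists_eq_succ_of_ne_zero hc
      rw [hc']
      simp only [Nat.succ_eq_add_one, Nat.add_sub_cancel, Nat.factorial_succ, Pi.single_eq_same,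
        mul_one]
      push_cast
      have : (c.factorial : ℝ) ≠ 0 := by positivity
      field_simp
    · simp [Multiset.count_eq_zero.2 hi]
  · intro k _ hk
    simp [Pi.single_eq_of_ne hk]
  · simp

theorem partialD_mono (L : List (Fin n)) (J : Multiset (Fin n)) (t : Fin n → ℝ) :
    partialD L (mono J) t = if (L : Multiset (Fin n)) ≤ J then mono (J - (L : Multiset (Fin n))) t else 0 := by
  induction L generalizing t with
  | nil => simp [partialD_nil]
  | cons i L ih =>
    rw [partialD_cons (contDiff_mono J).contDiffAt]
    have h : partialD L (mono J) = fun t => if (L : Multiset (Fin n)) ≤ J then mono (J - (L : Multiset (Fin n))) t else 0 :=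
      funext ih
    rw [h]
    have hiff : ((i :: L : List (Fin n)) : Multiset (Fin n)) ≤ J ↔
        (L : Multiset (Fin n)) ≤ J ∧ i ∈ J - (L : Multiset (Fin n)) := by
      rw [← Multiset.cons_coe]
      constructor
      · intro h
        refine ⟨(Multiset.le_cons_self _ _).trans h, ?_⟩
        rw [← Multiset.count_pos, Multiset.count_sub]
        have := Multiset.le_iff_count.1 h i
        rw [Multiset.count_cons_self] at this
        omega
      · rintro ⟨h1, h2⟩
        rw [Multiset.le_iff_count]
        intro a
        have h3 := Multiset.le_iff_count.1 h1 a
        rcases eq_or_ne a i with rfl | ha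
        · rw [← Multiset.count_pos, Multiset.count_sub] at h2
          rw [Multiset.count_cons_self]
          omega
        · rwa [Multiset.count_cons_of_ne ha]
    by_cases hL : (L : Multiset (Fin n)) ≤ J
    · simp only [hL, if_true]
      have := fderiv_mono (J - (L : Multiset (Fin n))) t i
      rw [show (fun t => mono (J - (L : Multiset (Fin n))) t) = mono (J - (L : Multiset (Fin n))) from rfl, this]
      simp only [hiff, hL, true_and]
      congr 2
      rw [← Multiset.cons_coe, Multiset.sub_cons]
      ext a
      rcases eq_or_ne a i with rfl | ha
      · simp only [Multiset.count_erase_self, Multiset.count_sub]; omega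
      · simp only [Multiset.count_erase_of_ne ha, Multiset.count_sub]
    · simp [hL, hiff]

theorem partialD_mono_zero (L : List (Fin n)) (J : Multiset (Fin n)) :
    partialD L (mono J) 0 = if (L : Multiset (Fin n)) = J then 1 else 0 := by
  rw [partialD_mono, mono_zero]
  by_cases h : (L : Multiset (Fin n)) = J
  · simp [h]
  · simp only [h, if_false, ite_eq_right_iff]
    intro h1 h2
    exact absurd (le_antisymm h1 (tsub_eq_zero_iff_le.1 h2)) h

end PartialDerivatives

/-! ### Jets of maps into the model space -/

section Jets

variable {n m s : ℕ}

/-- The model space of a manifold of dimension `n + m`. -/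
abbrev Model (n m : ℕ) : Type := EuclideanSpace ℝ (Fin (n + m))

/-- The coordinates of the `s`-jet at `t` of a map into the model space. -/
def jetOf (s : ℕ) (c : (Fin n → ℝ) → Model n m) (t : Fin n → ℝ) : TCoord n m s :=
  fun w => partialD w.2.1.sort c t w.1

/-- The coordinate functions of the model space. -/
abbrev modelCoord (A : Fin (n + m)) : Model n m →L[ℝ] ℝ := EuclideanSpace.proj A

theorem get_jetOf (c : (Fin n → ℝ) → Model n m) (t : Fin n → ℝ) (A : Fin (n + m))
    {J : Multiset (Fin n)} (hJ : J.card ≤ s) :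
    (jetOf s c t).get A J = partialD J.sort c t A := by
  simp [TCoord.get, hJ, jetOf]

theorem get_jetOf_singleton (hs : 1 ≤ s) {c : (Fin n → ℝ) → Model n m} {t : Fin n → ℝ}
    (hc : ContDiffAt ℝ ∞ c t) (A : Fin (n + m)) (i : Fin n) :
    (jetOf s c t).get A {i} = fderiv ℝ c t (Pi.single i 1) A := by
  rw [get_jetOf _ _ _ (by simpa using hs), partialD_singleton hc]

theorem get_jetOf_zero {c : (Fin n → ℝ) → Model n m} {t : Fin n → ℝ} (A : Fin (n + m)) :
    (jetOf s c t).get A 0 = c t A := by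
  rw [get_jetOf _ _ _ (by simp), Multiset.sort_zero, partialD_nil]

theorem jetOf_congr {c c' : (Fin n → ℝ) → Model n m} {t : Fin n → ℝ} (h : c =ᶠ[𝓝 t] c') :
    jetOf s c t = jetOf s c' t := by
  funext w
  simp only [jetOf, partialD_congr _ h]

/-- The polynomial map with the jet `w` at `0`. -/
def poly (w : TCoord n m s) (t : Fin n → ℝ) : Model n m :=
  WithLp.toLp 2 fun A => ∑ J, w (A, J) * mono J.1 t

theorem contDiff_poly : ContDiff ℝ ∞ (fun x : TCoord n m s × (Fin n → ℝ) => poly x.1 x.2) := by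
  unfold poly
  rw [contDiff_euclidean]
  intro A
  refine ContDiff.sum fun J _ => ?_
  have h : ContDiff ℝ ∞ (fun x : TCoord n m s × (Fin n → ℝ) => x.1 (A, J)) := by fun_prop
  exact h.mul ((contDiff_mono J.1).comp contDiff_snd)

theorem contDiff_poly_right (w : TCoord n m s) : ContDiff ℝ ∞ (poly w) :=
  contDiff_poly.comp (contDiff_const.prodMk contDiff_id)

theorem poly_zero (w : TCoord n m s) :
    poly w 0 = WithLp.toLp 2 fun A => w (A, MultiIndex.empty n s) := by
  unfold poly
  congr 1
  funext A
  rw [Finset.sum_eq_single (MultiIndex.empty n s)]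
  · simp [mono_zero, MultiIndex.empty]
  · intro J _ hJ
    have : J.1 ≠ 0 := fun h => hJ (Subtype.ext h)
    simp [mono_zero, this]
  · simp

/-- For `α` the identity this computes the jet of `poly w`; for a reparametrisation it shows that
the group acts linearly in the coordinates `w`, which is the map `reparam`. -/
theorem partialD_poly_comp {α : (Fin n → ℝ) → (Fin n → ℝ)} {t : Fin n → ℝ}
    (hα : ContDiffAt ℝ ∞ α t) (w : TCoord n m s) (L : List (Fin n)) (A : Fin (n + m)) :
    partialD L (fun t' => poly w (α t')) t A =
      ∑ J, w (A, J) * partialD L (fun t' => mono J.1 (α t')) t := by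
  have h1 : ContDiffAt ℝ ∞ (fun t' => poly w (α t')) t :=
    (contDiff_poly_right w).contDiffAt.comp t hα
  have h2 := (partialD_clm_comp h1 (modelCoord A) L).symm
  have hm : ∀ J : MultiIndex n s, ContDiffAt ℝ ∞ (fun t' => mono J.1 (α t')) t := fun J =>
    (contDiff_mono J.1).contDiffAt.comp t hα
  have h3 : ContDiffAt ℝ ∞ (fun t' => fun J : MultiIndex n s => mono J.1 (α t')) t :=
    contDiffAt_pi.2 hm
  have h4 := partialD_clm_comp h3
    (∑ J, w (A, J) • (ContinuousLinearMap.proj J : (MultiIndex n s → ℝ) →L[ℝ] ℝ)) L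
  have h5 : ∀ J, partialD L (fun t' => mono J.1 (α t')) t =
      partialD L (fun t' => fun J : MultiIndex n s => mono J.1 (α t')) t J := fun J =>
    partialD_clm_comp h3 (ContinuousLinearMap.proj J : (MultiIndex n s → ℝ) →L[ℝ] ℝ) L
  simp only [_root_.sum_apply, _root_.smul_apply,
    ContinuousLinearMap.proj_apply, smul_eq_mul] at h4
  simp only [h5]
  rw [← h4]
  exact h2

theorem jetOf_poly (w : TCoord n m s) : jetOf s (poly w) 0 = w := by
  funext ⟨A, K⟩
  have h := partialD_poly_comp (α := fun t => t) (t := (0 : Fin n → ℝ)) contDiffAt_id w K.1.sort A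
  simp only [jetOf]
  rw [h, Finset.sum_eq_single K]
  · rw [show (fun t' => mono K.1 t') = mono K.1 from rfl, partialD_mono_zero]
    simp
  · intro J _ hJ
    rw [show (fun t' => mono J.1 t') = mono J.1 from rfl, partialD_mono_zero]
    have : K.1 ≠ J.1 := fun h => hJ (Subtype.ext h.symm)
    simp [this]
  · simp

end Jets

/-! ### Smoothness of inverse matrices -/

section MatrixSmooth

variable {P : Type*} [NormedAddCommGroup P] [NormedSpace ℝ P] {n : ℕ}

theorem contDiffOn_det {M : P → Matrix (Fin n) (Fin n) ℝ} {S : Set P}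
    (hM : ∀ i j, ContDiffOn ℝ ∞ (fun p => M p i j) S) : ContDiffOn ℝ ∞ (fun p => (M p).det) S := by
  simp only [Matrix.det_apply']
  exact ContDiffOn.sum fun σ _ => contDiffOn_const.mul (contDiffOn_prod fun i _ => hM _ _)

theorem contDiffOn_matrix_inv {M : P → Matrix (Fin n) (Fin n) ℝ} {S : Set P}
    (hM : ∀ i j, ContDiffOn ℝ ∞ (fun p => M p i j) S) (h : ∀ p ∈ S, (M p).det ≠ 0) (i j : Fin n) :
    ContDiffOn ℝ ∞ (fun p => (M p)⁻¹ i j) S := by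
  simp only [Matrix.inv_def, Ring.inverse_eq_inv', Matrix.smul_apply, smul_eq_mul,
    Matrix.adjugate_apply]
  refine ((contDiffOn_det hM).inv h).mul (contDiffOn_det fun a b => ?_)
  by_cases ha : a = j
  · subst ha
    simpa using contDiffOn_const
  · simpa [Matrix.updateRow_ne ha] using hM a b

end MatrixSmooth

/-! ### The invariants `y^σ_J` and the graph normal form -/

section Invariants

variable {n m s : ℕ}

/-- The coordinate function `x^A_J`. -/
def getCLM (A : Fin (n + m)) (J : Multiset (Fin n)) : TCoord n m s →L[ℝ] ℝ :=
  if h : J.card ≤ s then ContinuousLinearMap.proj (A, ⟨J, h⟩) else 0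

theorem getCLM_apply (A : Fin (n + m)) (J : Multiset (Fin n)) (w : TCoord n m s) :
    getCLM A J w = w.get A J := by
  unfold getCLM TCoord.get
  split_ifs <;> rfl

/-- The direction `∑ x^A_{jJ} ∂/∂x^A_J` of the formal derivative. -/
def formalDir (j : Fin n) : TCoord n m s →L[ℝ] TCoord n m s :=
  ContinuousLinearMap.pi fun AJ => getCLM AJ.1 (j ::ₘ AJ.2.1)

theorem formalD_eq (j : Fin n) (f : TCoord n m s → ℝ) (w : TCoord n m s) :
    formalD j f w = fderiv ℝ f w (formalDir j w) := by
  simp only [formalD, formalDir]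
  congr 1
  funext AJ
  simp [getCLM_apply]

theorem contDiff_xMat (i j : Fin n) : ContDiff ℝ ∞ (fun w : TCoord n m s => xMat w i j) := by
  have : (fun w : TCoord n m s => xMat w i j) = getCLM (Fin.castAdd m i) {j} := by
    funext w
    rw [getCLM_apply]
    rfl
  rw [this]
  exact ContinuousLinearMap.contDiff _

variable (n m s) in
/-- The coordinates of the regular velocities whose first `n` components are independent. -/
def regSet : Set (TCoord n m s) := {w | (xMat w).det ≠ 0}

theorem isOpen_regSet : IsOpen (regSet n m s) := by
  have h : ContDiffOn ℝ ∞ (fun w : TCoord n m s => (xMat w).det) univ :=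
    contDiffOn_det fun i j => (contDiff_xMat i j).contDiffOn
  exact isOpen_compl_singleton.preimage (continuousOn_univ.1 h.continuousOn)

theorem contDiffOn_yFun (σ : Fin m) (L : List (Fin n)) :
    ContDiffOn ℝ ∞ (yFun σ L) (regSet n m s) := by
  induction L with
  | nil =>
    have : (yFun σ [] : TCoord n m s → ℝ) = getCLM (Fin.natAdd n σ) 0 := by
      funext w
      rw [getCLM_apply]
      rfl
    rw [this]
    exact (ContinuousLinearMap.contDiff _).contDiffOn
  | cons i L ih =>
    have : (yFun σ (i :: L) : TCoord n m s → ℝ) =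
        fun w => ∑ j, (xMat w)⁻¹ j i * fderiv ℝ (yFun σ L) w (formalDir j w) := by
      funext w
      simp only [yFun, formalD_eq]
    rw [this]
    refine ContDiffOn.sum fun j _ => ContDiffOn.mul ?_ ?_
    · exact contDiffOn_matrix_inv (fun a b => (contDiff_xMat a b).contDiffOn) (fun _ h => h) _ _
    · exact (ih.fderiv_of_isOpen isOpen_regSet (m := ∞) (by simp)).clm_apply
        (formalDir j).contDiff.contDiffOn

/-- Agreement of the coordinates of order at most `k`. -/
def AgreeUpTo (k : ℕ) (w w' : TCoord n m s) : Prop :=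
  ∀ A, ∀ J : MultiIndex n s, J.1.card ≤ k → w (A, J) = w' (A, J)

theorem AgreeUpTo.get_eq {k : ℕ} {w w' : TCoord n m s} (h : AgreeUpTo k w w') (A : Fin (n + m))
    {J : Multiset (Fin n)} (hJ : J.card ≤ k) : w.get A J = w'.get A J := by
  unfold TCoord.get
  split_ifs with h'
  · exact h A ⟨J, h'⟩ hJ
  · rfl

/-- A function of the coordinates of order at most `k` has a derivative that sees only those. It is
used to ignore the truncation at order `s` in `formalD`: the components that are set to zero never
enter the derivative of `y_L` when `|L| < s`. -/
theorem fderiv_apply_eq_of_agreeUpTo {k : ℕ} {f : TCoord n m s → ℝ}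
    (hf : ∀ w w', AgreeUpTo k w w' → f w = f w') {w w' v v' : TCoord n m s}
    (hw : AgreeUpTo k w w') (hv : AgreeUpTo k v v') : fderiv ℝ f w v = fderiv ℝ f w' v' := by
  have h1 : fderiv ℝ f w = fderiv ℝ f w' := by
    -- The vector `w' - w` has no components of order at most `k`, so `f` is invariant under
    -- translation by it. This needs no differentiability.
    have h2 : f = fun x => f (x + (w' - w)) := by
      funext x
      refine hf _ _ fun A J hJ => ?_
      simp [hw A J hJ]
    conv_lhs => rw [h2]
    rw [fderiv_comp_add_right]
    simp
  rw [h1]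
  -- If `f` is differentiable, its derivative along `v - v'` vanishes because `f` is constant on
  -- that line; otherwise `fderiv` is the default value `0` and both sides agree.
  by_cases hd : DifferentiableAt ℝ f w'
  · rw [← sub_eq_zero, ← map_sub, ← hd.lineDeriv_eq_fderiv, lineDeriv]
    have h3 : (fun t : ℝ => f (w' + t • (v - v'))) = fun _ => f w' := by
      funext t
      refine hf _ _ fun A J hJ => ?_
      simp [hv A J hJ]
    rw [h3, deriv_const]
  · simp [fderiv_zero_of_not_differentiableAt hd]

theorem yFun_eq_of_agreeUpTo (σ : Fin m) (L : List (Fin n)) :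
    ∀ w w' : TCoord n m s, AgreeUpTo L.length w w' → yFun σ L w = yFun σ L w' := by
  induction L with
  | nil => exact fun w w' h => h.get_eq _ (by simp)
  | cons i L ih =>
    intro w w' h
    have hx : xMat w = xMat w' := by
      ext a b
      exact h.get_eq _ (by simp)
    simp only [yFun, hx]
    refine Finset.sum_congr rfl fun j _ => ?_
    congr 1
    refine fderiv_apply_eq_of_agreeUpTo ih (fun A J hJ => h A J (by simp; omega)) ?_
    intro A J hJ
    exact h.get_eq _ (by simpa using hJ)

/-- The projection of the model space to the first `n` coordinates. -/
def baseCLM (n m : ℕ) : Model n m →L[ℝ] (Fin n → ℝ) :=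
  ContinuousLinearMap.pi fun i => modelCoord (Fin.castAdd m i)

@[simp]
theorem baseCLM_apply (e : Model n m) (i : Fin n) : baseCLM n m e i = e (Fin.castAdd m i) := rfl

theorem xMat_jetOf (hs : 1 ≤ s) {c : (Fin n → ℝ) → Model n m} {t : Fin n → ℝ}
    (hc : ContDiffAt ℝ ∞ c t) (i j : Fin n) :
    xMat (jetOf s c t) i j = fderiv ℝ c t (Pi.single j 1) (Fin.castAdd m i) :=
  get_jetOf_singleton hs hc _ _

theorem fderiv_apply_eq_sum {F : Type*} [NormedAddCommGroup F] [NormedSpace ℝ F]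
    (f' : (Fin n → ℝ) →L[ℝ] F) (v : Fin n → ℝ) : f' v = ∑ j, v j • f' (Pi.single j 1) := by
  conv_lhs => rw [← Finset.univ_sum_single v, map_sum]
  refine Finset.sum_congr rfl fun j _ => ?_
  rw [← map_smul]
  congr 1
  rw [← Pi.single_smul]
  simp

theorem xMat_jetOf_mulVec (hs : 1 ≤ s) {c : (Fin n → ℝ) → Model n m} {t : Fin n → ℝ}
    (hc : ContDiffAt ℝ ∞ c t) (v : Fin n → ℝ) :
    (xMat (jetOf s c t)).mulVec v = baseCLM n m (fderiv ℝ c t v) := by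
  funext i
  rw [fderiv_apply_eq_sum (fderiv ℝ c t) v]
  simp [Matrix.mulVec, dotProduct, xMat_jetOf hs hc, mul_comm]

theorem fderiv_injective_of_det_ne_zero (hs : 1 ≤ s) {c : (Fin n → ℝ) → Model n m}
    {t : Fin n → ℝ} (hc : ContDiffAt ℝ ∞ c t) (hdet : (xMat (jetOf s c t)).det ≠ 0) :
    Function.Injective (fderiv ℝ c t) := by
  rw [injective_iff_map_eq_zero]
  intro v hv
  refine Matrix.eq_zero_of_mulVec_eq_zero hdet ?_
  rw [xMat_jetOf_mulVec hs hc, hv, map_zero]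

theorem hasFDerivAt_jetOf {c : (Fin n → ℝ) → Model n m} {t : Fin n → ℝ}
    (hc : ContDiffAt ℝ ∞ c t) :
    HasFDerivAt (jetOf s c) (ContinuousLinearMap.pi fun AJ : Fin (n + m) × MultiIndex n s =>
      (modelCoord AJ.1).comp (fderiv ℝ (partialD AJ.2.1.sort c) t)) t := by
  rw [hasFDerivAt_pi]
  intro AJ
  exact (modelCoord AJ.1).hasFDerivAt.comp t
    ((contDiffAt_partialD hc _).differentiableAt (by simp)).hasFDerivAt

/-- If `c` parametrises the graph of `f`, the invariants `y_L` of its jets are the partial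
derivatives of `f`. -/
theorem yFun_jetOf (hs : 1 ≤ s) {c : (Fin n → ℝ) → Model n m} {U : Set (Fin n → ℝ)}
    (hU : IsOpen U) (hc : ContDiffOn ℝ ∞ c U)
    (hdet : ∀ t ∈ U, (xMat (jetOf s c t)).det ≠ 0)
    {f : (Fin n → ℝ) → ℝ} {U' : Set (Fin n → ℝ)} (hU' : IsOpen U') (hf : ContDiffOn ℝ ∞ f U')
    (hmap : ∀ t ∈ U, baseCLM n m (c t) ∈ U') (σ : Fin m)
    (hcf : ∀ t ∈ U, c t (Fin.natAdd n σ) = f (baseCLM n m (c t)))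
    (L : List (Fin n)) (hL : L.length ≤ s) :
    ∀ t ∈ U, yFun σ L (jetOf s c t) = partialD L f (baseCLM n m (c t)) := by
  induction L with
  | nil =>
    intro t ht
    rw [partialD_nil, ← hcf t ht]
    exact get_jetOf_zero _
  | cons i L ih =>
    intro t ht
    have hL' : L.length < s := by simpa using hL
    have hca := hc.contDiffAt (hU.mem_nhds ht)
    have hfa := hf.contDiffAt (hU'.mem_nhds (hmap t ht))
    -- On a prolongation the formal derivative is `∂/∂t^j`. The chain rule applied to `∂_L f`
    -- composed with the base part of `c` produces the factor `x^k_j`, which the inverse matrix in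
    -- `yFun` then cancels.
    have hformal : ∀ j, formalD j (yFun σ L) (jetOf s c t) =
        ∑ k, xMat (jetOf s c t) k j * partialD (k :: L) f (baseCLM n m (c t)) := by
      intro j
      have h1 : formalD j (yFun σ L) (jetOf s c t) =
          fderiv ℝ (yFun σ L) (jetOf s c t) (fderiv ℝ (jetOf s c) t (Pi.single j 1)) := by
        refine fderiv_apply_eq_of_agreeUpTo (yFun_eq_of_agreeUpTo σ L) (fun _ _ _ => rfl) ?_
        intro A J hJ
        rw [(hasFDerivAt_jetOf hca).fderiv]
        simp only [ContinuousLinearMap.coe_pi', ContinuousLinearMap.comp_apply]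
        rw [← partialD_sort_cons hU hc j J.1 ht, get_jetOf _ _ _ (by simp; omega)]
        rfl
      have hy := ((contDiffOn_yFun σ L).contDiffAt
        (isOpen_regSet.mem_nhds (hdet t ht))).differentiableAt (by simp)
      have h2 := hy.hasFDerivAt.comp t (hasFDerivAt_jetOf (s := s) hca)
      -- The inductive hypothesis holds on all of `U`, so it may be differentiated at `t`.
      have h3 : (yFun σ L ∘ jetOf s c) =ᶠ[𝓝 t] partialD L f ∘ fun t' => baseCLM n m (c t') :=
        Filter.mem_of_superset (hU.mem_nhds ht) (fun t' ht' => ih hL'.le t' ht')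
      have h4 := (((contDiffAt_partialD hfa L).differentiableAt (by simp)).hasFDerivAt).comp t
        ((baseCLM n m).hasFDerivAt.comp t (hca.differentiableAt (by simp)).hasFDerivAt)
      have h5 := h2.unique (h4.congr_of_eventuallyEq h3)
      rw [h1, (hasFDerivAt_jetOf hca).fderiv]
      have h6 := congrArg (fun φ => φ (Pi.single j 1)) h5
      simp only [ContinuousLinearMap.comp_apply] at h6
      rw [h6, fderiv_apply_eq_sum]
      refine Finset.sum_congr rfl fun k _ => ?_
      rw [partialD_cons hfa, smul_eq_mul, xMat_jetOf hs hca]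
      rfl
    simp only [yFun, hformal]
    have hinv : xMat (jetOf s c t) * (xMat (jetOf s c t))⁻¹ = 1 :=
      Matrix.mul_nonsing_inv _ (isUnit_iff_ne_zero.2 (hdet t ht))
    simp only [Finset.mul_sum]
    rw [Finset.sum_comm]
    have h7 : ∀ k, ∑ j, (xMat (jetOf s c t))⁻¹ j i *
        (xMat (jetOf s c t) k j * partialD (k :: L) f (baseCLM n m (c t))) =
        (1 : Matrix (Fin n) (Fin n) ℝ) k i * partialD (k :: L) f (baseCLM n m (c t)) := by
      intro k
      rw [← hinv, Matrix.mul_apply, Finset.sum_mul]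
      exact Finset.sum_congr rfl fun j _ => by ring
    simp [h7, Matrix.one_apply]

/-- The coordinates `(x^i, y^σ_J)` computed from the coordinates `x^A_J`. -/
def pc (w : TCoord n m s) : PCoord n m s :=
  Sum.elim (fun i => w.get (Fin.castAdd m i) 0) (fun σJ => yFun σJ.1 σJ.2.1.sort w)

/-- The coordinates `x^A_J` of the velocity of the graph parametrisation
`t ↦ (x + t, f(x + t))`. -/
def canon (w : PCoord n m s) : TCoord n m s := fun AJ =>
  Fin.addCases (motive := fun _ => ℝ)
    (fun i => if AJ.2.1 = 0 then w (Sum.inl i) else if AJ.2.1 = {i} then 1 else 0)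
    (fun σ => w (Sum.inr (σ, AJ.2))) AJ.1

theorem canon_natAdd (w : PCoord n m s) (σ : Fin m) (J : MultiIndex n s) :
    canon w (Fin.natAdd n σ, J) = w (Sum.inr (σ, J)) := by
  simp [canon]

theorem canon_castAdd (w : PCoord n m s) (i : Fin n) (J : MultiIndex n s) :
    canon w (Fin.castAdd m i, J) =
      if J.1 = 0 then w (Sum.inl i) else if J.1 = {i} then 1 else 0 := by
  simp [canon]

theorem contDiff_canon : ContDiff ℝ ∞ (canon : PCoord n m s → TCoord n m s) := by
  rw [contDiff_pi]
  rintro ⟨A, J⟩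
  induction A using Fin.addCases with
  | left i =>
    simp only [canon_castAdd]
    split_ifs
    · fun_prop
    · exact contDiff_const
    · exact contDiff_const
  | right σ =>
    simp only [canon_natAdd]
    fun_prop

theorem contDiffOn_pc : ContDiffOn ℝ ∞ (pc : TCoord n m s → PCoord n m s) (regSet n m s) := by
  rw [contDiffOn_pi]
  rintro (i | ⟨σ, J⟩)
  · have : (fun w : TCoord n m s => pc w (Sum.inl i)) = getCLM (Fin.castAdd m i) 0 := by
      funext w
      rw [getCLM_apply]
      rfl
    rw [this]
    exact (ContinuousLinearMap.contDiff _).contDiffOn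
  · exact contDiffOn_yFun σ _

theorem get_canon_natAdd (w : PCoord n m s) (σ : Fin m) (J : Multiset (Fin n)) :
    (canon w).get (Fin.natAdd n σ) J = w.get σ J := by
  unfold TCoord.get PCoord.get
  split_ifs
  · exact canon_natAdd _ _ _
  · rfl

theorem xMat_canon (hs : 1 ≤ s) (w : PCoord n m s) : xMat (canon w) = 1 := by
  ext i j
  have h : ({j} : Multiset (Fin n)).card ≤ s := by simpa using hs
  simp only [xMat, Matrix.of_apply, TCoord.get, h, dif_pos, canon_castAdd]
  simp [Matrix.one_apply, eq_comm]

theorem canon_mem_regSet (hs : 1 ≤ s) (w : PCoord n m s) : canon w ∈ regSet n m s := by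
  simp [regSet, xMat_canon hs]

theorem poly_canon_castAdd (hs : 1 ≤ s) (w : PCoord n m s) (t : Fin n → ℝ) (i : Fin n) :
    poly (canon w) t (Fin.castAdd m i) = w (Sum.inl i) + t i := by
  have h1 : ({i} : Multiset (Fin n)).card ≤ s := by simpa using hs
  have h0 : (MultiIndex.empty n s) ≠ ⟨{i}, h1⟩ := by
    intro h
    have := congrArg (fun J : MultiIndex n s => J.1.card) h
    simp [MultiIndex.empty] at this
  have hm : mono ({i} : Multiset (Fin n)) t = t i := by
    unfold mono
    rw [Finset.prod_eq_single i]
    · simp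
    · intro k _ hk
      simp [hk]
    · simp
  simp only [poly, canon_castAdd]
  rw [Fintype.sum_eq_add (MultiIndex.empty n s) ⟨{i}, h1⟩ h0]
  · have hm0 : mono (0 : Multiset (Fin n)) t = 1 := by simp [mono]
    simp [MultiIndex.empty, hm, hm0]
  · rintro J ⟨hJ, hJ'⟩
    have h2 : J.1 ≠ 0 := fun h => hJ (Subtype.ext h)
    have h3 : J.1 ≠ {i} := fun h => hJ' (Subtype.ext h)
    simp [h2, h3]

/-- The jet of a map with first components `x + t` has canonical coordinates. -/
theorem jetOf_eq_canon (hs : 1 ≤ s) {c : (Fin n → ℝ) → Model n m} (hc : ContDiffAt ℝ ∞ c 0)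
    (x : Fin n → ℝ) (hx : ∀ᶠ t in 𝓝 0, ∀ i, c t (Fin.castAdd m i) = x i + t i) :
    jetOf s c 0 = canon (Sum.elim x fun σJ : Fin m × MultiIndex n s =>
      partialD σJ.2.1.sort (fun t => c t (Fin.natAdd n σJ.1)) 0) := by
  set w : PCoord n m s := Sum.elim x fun σJ : Fin m × MultiIndex n s =>
      partialD σJ.2.1.sort (fun t => c t (Fin.natAdd n σJ.1)) 0 with hw
  funext ⟨A, J⟩
  have hA := partialD_clm_comp hc (modelCoord A) J.1.sort
  induction A using Fin.addCases with
  | left i =>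
    have h1 := congrFun (jetOf_poly (canon w)) (Fin.castAdd m i, J)
    have h2 := partialD_clm_comp (contDiff_poly_right (canon w)).contDiffAt
      (modelCoord (Fin.castAdd m i)) J.1.sort (t := (0 : Fin n → ℝ))
    rw [← h1]
    refine hA.symm.trans (Eq.trans (partialD_congr _ ?_) h2)
    filter_upwards [hx] with t ht
    exact (ht i).trans (poly_canon_castAdd hs w t i).symm
  | right σ =>
    rw [canon_natAdd]
    exact hA.symm

theorem partialD_comp_add {F : Type*} [NormedAddCommGroup F] [NormedSpace ℝ F]
    (f : (Fin n → ℝ) → F) (x t : Fin n → ℝ) (L : List (Fin n)) :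
    partialD L (fun t' => f (x + t')) t = partialD L f (x + t) := by
  unfold partialD
  rw [iteratedFDeriv_comp_add_left]

/-- The polynomial map with jet `canon w` parametrises a graph over the translation `t ↦ x + t`, and
the derivatives of its last components at `0` are the prescribed `y^σ_J`. Consequently every value
of `(x, y)` over the chart is attained. -/
theorem pc_canon (hs : 1 ≤ s) (w : PCoord n m s) : pc (canon w) = w := by
  set c : (Fin n → ℝ) → Model n m := poly (canon w)
  have hc : ContDiff ℝ ∞ c := contDiff_poly_right _
  set x : Fin n → ℝ := fun i => w (Sum.inl i)
  have hb : ∀ t, baseCLM n m (c t) = x + t := fun t => by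
    funext i
    exact poly_canon_castAdd hs w t i
  have hjet : jetOf s c 0 = canon w := jetOf_poly _
  have hdet : ∀ t, (xMat (jetOf s c t)).det ≠ 0 := by
    intro t
    have : xMat (jetOf s c t) = 1 := by
      ext i j
      rw [xMat_jetOf hs hc.contDiffAt]
      have h1 := ((baseCLM n m).hasFDerivAt.comp t (hc.differentiable (by simp) t).hasFDerivAt)
      have h2 : (baseCLM n m ∘ c) = fun t => x + t := funext hb
      rw [h2] at h1
      have h3 := h1.unique ((hasFDerivAt_id t).const_add x)
      have h4 := congrFun (congrArg (fun φ => φ (Pi.single j 1)) h3) i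
      simp only [ContinuousLinearMap.comp_apply, ContinuousLinearMap.id_apply, baseCLM_apply] at h4
      rw [h4, Matrix.one_apply, Pi.single_apply]
    rw [this]
    simp
  funext z
  rcases z with i | ⟨σ, J⟩
  · simp only [pc, Sum.elim_inl]
    have h0 : (0 : Multiset (Fin n)).card ≤ s := by simp
    simp [TCoord.get, canon_castAdd]
  · simp only [pc, Sum.elim_inr]
    -- The base part of `c` is `x + t`, so the function whose graph it parametrises is obtained by
    -- substituting `t = y - x`.
    have hf : ContDiff ℝ ∞ (fun y : Fin n → ℝ => c (y - x) (Fin.natAdd n σ)) :=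
      (modelCoord _).contDiff.comp (hc.comp (contDiff_id.sub contDiff_const))
    have h := yFun_jetOf hs isOpen_univ hc.contDiffOn (fun t _ => hdet t) isOpen_univ
      hf.contDiffOn (fun _ _ => mem_univ _) σ (fun t _ => by rw [hb]; simp) J.1.sort
      (by rw [Multiset.length_sort]; exact J.2) 0 (mem_univ _)
    rw [hjet] at h
    rw [h, hb, ← partialD_comp_add]
    simp only [add_sub_cancel_left]
    have h5 := partialD_clm_comp hc.contDiffAt (modelCoord (Fin.natAdd n σ)) J.1.sort
      (t := (0 : Fin n → ℝ))
    refine Eq.trans h5 ?_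
    rw [← canon_natAdd w σ J, ← hjet]
    rfl

end Invariants

/-! ### Velocities in charts -/


section Velocities

variable {n m s : ℕ} {X : Type u} [TopologicalSpace X]
  [ChartedSpace (EuclideanSpace ℝ (Fin (n + m))) X]

/-- The `s`-jet at `0` of an immersion. -/
def velocity (s : ℕ) (γ : Immersion n m X) : ImmT n m s X := Quotient.mk (jetSetoid n m s X) γ

@[simp]
theorem target_velocity (γ : Immersion n m X) : (velocity s γ).target = γ.toFun 0 := rfl

theorem coord_velocity {γ : Immersion n m X} {ψ : XChart n m X} (h : γ.toFun 0 ∈ ψ.1.source) :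
    (velocity s γ).coord ψ = jetOf s (fun t => ψ.1 (γ.toFun t)) 0 :=
  if_pos h

theorem exists_velocity_eq (p : ImmT n m s X) : ∃ γ, velocity s γ = p := Quotient.exists_rep p

/-- The part of the domain of an immersion which is mapped to the domain of a chart. -/
def chartDom (γ : Immersion n m X) (ψ : XChart n m X) : Set (Fin n → ℝ) :=
  γ.dom ∩ γ.toFun ⁻¹' ψ.1.source

theorem isOpen_chartDom (γ : Immersion n m X) (ψ : XChart n m X) : IsOpen (chartDom γ ψ) :=
  γ.smooth.continuousOn.isOpen_inter_preimage γ.isOpen_dom ψ.1.open_source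

/-- The value, as a point of the model space. -/
def val : TCoord n m s →L[ℝ] Model n m :=
  (EuclideanSpace.equiv (Fin (n + m)) ℝ).symm.toContinuousLinearMap.comp
    (ContinuousLinearMap.pi fun A => ContinuousLinearMap.proj (A, MultiIndex.empty n s))

@[simp]
theorem val_apply (w : TCoord n m s) (A : Fin (n + m)) :
    val w A = w (A, MultiIndex.empty n s) := rfl

theorem poly_zero_eq_val (w : TCoord n m s) : poly w 0 = val w := poly_zero w

theorem val_jetOf (c : (Fin n → ℝ) → Model n m) (t : Fin n → ℝ) : val (jetOf s c t) = c t := by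
  ext A
  simp [jetOf, MultiIndex.empty, partialD_nil]

theorem val_coord {p : ImmT n m s X} {ψ : XChart n m X} (h : p.target ∈ ψ.1.source) :
    val (p.coord ψ) = ψ.1 p.target := by
  obtain ⟨γ, rfl⟩ := exists_velocity_eq p
  rw [coord_velocity h, val_jetOf]
  rfl

/-- The coordinates in the chart `ψ` of the points of `W`. -/
def velDom (s : ℕ) (ψ : XChart n m X) : Set (TCoord n m s) :=
  val ⁻¹' ψ.1.target ∩ regSet n m s

theorem isOpen_velDom (ψ : XChart n m X) : IsOpen (velDom s ψ) :=
  (ψ.1.open_target.preimage val.continuous).inter isOpen_regSet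

theorem coord_mem_velDom {p : ImmT n m s X} {ψ : XChart n m X} (hp : p ∈ W s ψ) :
    p.coord ψ ∈ velDom s ψ := by
  refine ⟨?_, hp.2⟩
  rw [mem_preimage, val_coord hp.1]
  exact ψ.1.map_source hp.1

variable [IsManifold (𝓡 (n + m)) ∞ X]

theorem contDiffOn_chart_comp (γ : Immersion n m X) (ψ : XChart n m X) :
    ContDiffOn ℝ ∞ (fun t => ψ.1 (γ.toFun t)) (chartDom γ ψ) :=
  ((contMDiffOn_of_mem_maximalAtlas ψ.2).comp (γ.smooth.mono inter_subset_left)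
    (fun _ h => h.2)).contDiffOn

/-- The change of charts `φ ∘ ψ⁻¹`. -/
def chartTrans (ψ φ : XChart n m X) : Model n m → Model n m := fun e => φ.1 (ψ.1.symm e)

/-- The domain of the change of charts. -/
def transDom (ψ φ : XChart n m X) : Set (Model n m) := ψ.1.target ∩ ψ.1.symm ⁻¹' φ.1.source

theorem isOpen_transDom (ψ φ : XChart n m X) : IsOpen (transDom ψ φ) :=
  ψ.1.symm.isOpen_inter_preimage φ.1.open_source

theorem contDiffOn_chartTrans (ψ φ : XChart n m X) :
    ContDiffOn ℝ ∞ (chartTrans ψ φ) (transDom ψ φ) :=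
  ((contMDiffOn_of_mem_maximalAtlas φ.2).comp
    ((contMDiffOn_symm_of_mem_maximalAtlas ψ.2).mono inter_subset_left)
    (fun _ h => h.2)).contDiffOn

/-- A velocity is determined by its coordinates in one chart. -/
theorem coord_injective {p p' : ImmT n m s X} {ψ : XChart n m X} (hp : p.target ∈ ψ.1.source)
    (hp' : p'.target ∈ ψ.1.source) (h : p.coord ψ = p'.coord ψ) : p = p' := by
  have hv : p.target = p'.target := by
    refine ψ.1.injOn hp hp' ?_
    rw [← val_coord hp, ← val_coord hp', h]
  obtain ⟨γ, rfl⟩ := exists_velocity_eq p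
  obtain ⟨δ, rfl⟩ := exists_velocity_eq p'
  simp only [target_velocity] at hp hp' hv
  rw [coord_velocity hp, coord_velocity hp'] at h
  refine Quotient.sound ⟨hv, fun φ hφ k hk => ?_⟩
  have hk' : ∀ l ≤ s, iteratedFDeriv ℝ l (fun t => ψ.1 (γ.toFun t)) 0 =
      iteratedFDeriv ℝ l (fun t => ψ.1 (δ.toFun t)) 0 := by
    intro l hl
    refine iteratedFDeriv_eq_of_partialD_eq ((isOpen_chartDom γ ψ).inter (isOpen_chartDom δ ψ))
      ((contDiffOn_chart_comp γ ψ).mono inter_subset_left)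
      ((contDiffOn_chart_comp δ ψ).mono inter_subset_right)
      ⟨⟨γ.zero_mem, hp⟩, ⟨δ.zero_mem, hp'⟩⟩ fun J hJ => ?_
    ext A
    exact congrFun h (A, ⟨J, hJ.trans_le hl⟩)
  -- By the Faà di Bruno formula the `k`-jet in `φ` is computed from the jet of `φ ∘ ψ⁻¹` and the
  -- jet in `ψ`, so agreement in one chart carries over to every other.
  have key : ∀ ε : Immersion n m X, ε.toFun 0 ∈ ψ.1.source → ε.toFun 0 ∈ φ.1.source →
      iteratedFDeriv ℝ k (fun t => φ.1 (ε.toFun t)) 0 =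
        (ftaylorSeries ℝ (chartTrans ψ φ) (ψ.1 (ε.toFun 0))).taylorComp
          (ftaylorSeries ℝ (fun t => ψ.1 (ε.toFun t)) 0) k := by
    intro ε h1 h2
    have h3 : (fun t => φ.1 (ε.toFun t)) =ᶠ[𝓝 0]
        (chartTrans ψ φ ∘ fun t => ψ.1 (ε.toFun t)) := by
      filter_upwards [(isOpen_chartDom ε ψ).mem_nhds ⟨ε.zero_mem, h1⟩] with t ht
      simp only [Function.comp_apply, chartTrans]
      rw [ψ.1.left_inv ht.2]
    rw [(h3.iteratedFDeriv (𝕜 := ℝ) k).eq_of_nhds]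
    refine iteratedFDeriv_comp (n := k) ?_ ?_ le_rfl
    · refine ((contDiffOn_chartTrans ψ φ).contDiffAt ((isOpen_transDom ψ φ).mem_nhds ?_)).of_le
        (by exact_mod_cast le_top)
      exact ⟨ψ.1.map_source h1, by simpa [ψ.1.left_inv h1] using h2⟩
    · exact ((contDiffOn_chart_comp ε ψ).contDiffAt
        ((isOpen_chartDom ε ψ).mem_nhds ⟨ε.zero_mem, h1⟩)).of_le (by exact_mod_cast le_top)
  rw [key γ hp hφ, key δ hp' (hv ▸ hφ), hv]
  exact taylorComp_congr (fun _ _ => rfl) (fun l hl => hk' l (hl.trans hk))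

/-- The immersion with polynomial local expression `poly w`. -/
def polyImm (hs : 1 ≤ s) (ψ : XChart n m X) (w : TCoord n m s) (hw : w ∈ velDom s ψ) :
    Immersion n m X where
  toFun t := ψ.1.symm (poly w t)
  dom := poly w ⁻¹' ψ.1.target ∩ {t | Function.Injective (fderiv ℝ (poly w) t)}
  isOpen_dom := (ψ.1.open_target.preimage (contDiff_poly_right w).continuous).inter
    (ContinuousLinearMap.isOpen_injective.preimage
      ((contDiff_poly_right w).continuous_fderiv (by simp)))
  zero_mem := by
    refine ⟨?_, ?_⟩
    · rw [mem_preimage, poly_zero_eq_val]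
      exact hw.1
    · refine fderiv_injective_of_det_ne_zero hs (contDiff_poly_right w).contDiffAt ?_
      rw [jetOf_poly]
      exact hw.2
  smooth := (contMDiffOn_symm_of_mem_maximalAtlas ψ.2).comp
    (contDiff_poly_right w).contMDiff.contMDiffOn (fun _ h => h.1)
  injective := by
    rintro t ⟨ht, hinj⟩
    have h1 : MDifferentiableAt (𝓡 (n + m)) (𝓡 (n + m)) ψ.1.symm (poly w t) :=
      ((contMDiffOn_symm_of_mem_maximalAtlas ψ.2).contMDiffAt
        (ψ.1.open_target.mem_nhds ht)).mdifferentiableAt (by simp)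
    have h2 : MDifferentiableAt 𝓘(ℝ, Fin n → ℝ) (𝓡 (n + m)) (poly w) t :=
      (contDiff_poly_right w).contMDiff.mdifferentiableAt (by simp)
    have h3 : MDifferentiableAt (𝓡 (n + m)) (𝓡 (n + m)) ψ.1 (ψ.1.symm (poly w t)) :=
      ((contMDiffOn_of_mem_maximalAtlas ψ.2).contMDiffAt
        (ψ.1.open_source.mem_nhds (ψ.1.map_target ht))).mdifferentiableAt (by simp)
    have h12 : MDifferentiableAt 𝓘(ℝ, Fin n → ℝ) (𝓡 (n + m)) (fun t => ψ.1.symm (poly w t)) t :=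
      h1.comp t h2
    -- Composition with the chart recovers `poly w`, whose derivative is injective on the domain;
    -- hence so is the derivative before composition.
    have h4 := mfderiv_comp t h3 h12
    have h5 : (ψ.1 ∘ fun t => ψ.1.symm (poly w t)) =ᶠ[𝓝 t] poly w := by
      filter_upwards [(ψ.1.open_target.preimage (contDiff_poly_right w).continuous).mem_nhds ht]
        with t' ht'
      exact ψ.1.right_inv ht'
    have h6 : mfderiv 𝓘(ℝ, Fin n → ℝ) (𝓡 (n + m)) (poly w) t = fderiv ℝ (poly w) t :=
      mfderiv_eq_fderiv
    rw [h5.mfderiv_eq, h6] at h4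
    intro v v' hv
    refine hinj ?_
    rw [h4]
    exact congrArg (mfderiv (𝓡 (n + m)) (𝓡 (n + m)) ψ.1 (ψ.1.symm (poly w t))) hv

theorem polyImm_zero_mem (hs : 1 ≤ s) {ψ : XChart n m X} {w : TCoord n m s}
    (hw : w ∈ velDom s ψ) : (polyImm hs ψ w hw).toFun 0 ∈ ψ.1.source := by
  simp only [polyImm, poly_zero_eq_val]
  exact ψ.1.map_target hw.1

theorem eventually_poly_mem {w : TCoord n m s} {S : Set (Model n m)} (hS : IsOpen S)
    (hw : val w ∈ S) : ∀ᶠ t in 𝓝 0, poly w t ∈ S :=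
  (hS.preimage (contDiff_poly_right w).continuous).mem_nhds
    (by rwa [mem_preimage, poly_zero_eq_val])

theorem coord_polyImm (hs : 1 ≤ s) {ψ : XChart n m X} {w : TCoord n m s}
    (hw : w ∈ velDom s ψ) : (velocity s (polyImm hs ψ w hw)).coord ψ = w := by
  rw [coord_velocity (polyImm_zero_mem hs hw)]
  conv_rhs => rw [← jetOf_poly w]
  refine jetOf_congr ?_
  filter_upwards [eventually_poly_mem ψ.1.open_target hw.1] with t ht
  exact ψ.1.right_inv ht

theorem polyImm_mem_W (hs : 1 ≤ s) {ψ : XChart n m X} {w : TCoord n m s}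
    (hw : w ∈ velDom s ψ) : velocity s (polyImm hs ψ w hw) ∈ W s ψ := by
  refine ⟨polyImm_zero_mem hs hw, ?_⟩
  rw [coord_polyImm]
  exact hw.2

/-- The point chosen in `expr` is unique because coordinates separate velocities, so it may be
replaced by an explicit one. The open set `velDom` suffices for computing derivatives at points of
`W`. -/
theorem expr_immT (hs : 1 ≤ s) {F : Type*} [Zero F] {ψ : XChart n m X} (f : ImmT n m s X → F)
    {w : TCoord n m s} (hw : w ∈ velDom s ψ) :
    (ImmT.charts n m s X).expr ψ f w = f (velocity s (polyImm hs ψ w hw)) := by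
  have h : ∃ p ∈ (ImmT.charts n m s X).dom ψ, (ImmT.charts n m s X).coord ψ p = w :=
    ⟨velocity s (polyImm hs ψ w hw), polyImm_zero_mem hs hw, coord_polyImm hs hw⟩
  unfold ChartSystem.expr
  rw [dif_pos h]
  congr 1
  exact coord_injective h.choose_spec.1 (polyImm_zero_mem hs hw)
    (h.choose_spec.2.trans (coord_polyImm hs hw).symm)

theorem eq_velocity_polyImm (hs : 1 ≤ s) {p : ImmT n m s X} {ψ : XChart n m X} (hp : p ∈ W s ψ) :
    p = velocity s (polyImm hs ψ (p.coord ψ) (coord_mem_velDom hp)) :=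
  coord_injective hp.1 (polyImm_zero_mem hs _) (coord_polyImm hs _).symm

/-! ### Change of charts -/

/-- The change of associated charts. -/
def jetTrans (ψ φ : XChart n m X) (w : TCoord n m s) : TCoord n m s :=
  jetOf s (fun t => chartTrans ψ φ (poly w t)) 0

theorem val_jetTrans (ψ φ : XChart n m X) (w : TCoord n m s) :
    val (jetTrans ψ φ w) = chartTrans ψ φ (val w) := by
  rw [jetTrans, val_jetOf, poly_zero_eq_val]

theorem coord_polyImm_trans (hs : 1 ≤ s) {ψ φ : XChart n m X} {w : TCoord n m s}
    (hw : w ∈ velDom s ψ) (hφ : val w ∈ transDom ψ φ) :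
    (velocity s (polyImm hs ψ w hw)).coord φ = jetTrans ψ φ w := by
  refine coord_velocity ?_
  simp only [polyImm, poly_zero_eq_val]
  exact hφ.2

theorem contDiffOn_jetTrans (ψ φ : XChart n m X) :
    ContDiffOn ℝ ∞ (jetTrans ψ φ : TCoord n m s → TCoord n m s) (val ⁻¹' transDom ψ φ) := by
  rw [contDiffOn_pi]
  rintro ⟨A, J⟩
  have hU : IsOpen {x : TCoord n m s × (Fin n → ℝ) | poly x.1 x.2 ∈ transDom ψ φ} :=
    (isOpen_transDom ψ φ).preimage contDiff_poly.continuous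
  have hH : ContDiffOn ℝ ∞
      (fun x : TCoord n m s × (Fin n → ℝ) => chartTrans ψ φ (poly x.1 x.2))
      {x : TCoord n m s × (Fin n → ℝ) | poly x.1 x.2 ∈ transDom ψ φ} :=
    (contDiffOn_chartTrans ψ φ).comp contDiff_poly.contDiffOn (fun _ h => h)
  have h1 := contDiffOn_partialD_param hU hH J.1.sort
  have h2 := h1.comp (s := val ⁻¹' transDom ψ φ)
    (f := fun w : TCoord n m s => (w, (0 : Fin n → ℝ)))
    (contDiff_id.prodMk contDiff_const).contDiffOn (fun w hw => by
      simp only [mem_ofPred_eq, poly_zero_eq_val]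
      exact hw)
  exact (modelCoord A).contDiff.comp_contDiffOn h2

theorem coord_trans_val {p : ImmT n m s X} {ψ φ : XChart n m X} (hp : p ∈ W s ψ)
    (hφ : p.target ∈ φ.1.source) : val (p.coord ψ) ∈ transDom ψ φ := by
  rw [val_coord hp.1]
  exact ⟨ψ.1.map_source hp.1, by simpa [ψ.1.left_inv hp.1] using hφ⟩

theorem coord_eq_jetTrans (hs : 1 ≤ s) {p : ImmT n m s X} {ψ φ : XChart n m X} (hp : p ∈ W s ψ)
    (hφ : p.target ∈ φ.1.source) : p.coord φ = jetTrans ψ φ (p.coord ψ) := by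
  conv_lhs => rw [eq_velocity_polyImm hs hp]
  exact coord_polyImm_trans hs _ (coord_trans_val hp hφ)

theorem expr_coord_eventuallyEq (hs : 1 ≤ s) {p : ImmT n m s X} {ψ φ : XChart n m X}
    (hp : p ∈ W s ψ) (hφ : p.target ∈ φ.1.source) :
    (ImmT.charts n m s X).expr ψ (fun p' => p'.coord φ) =ᶠ[𝓝 (p.coord ψ)] jetTrans ψ φ := by
  filter_upwards [(isOpen_velDom ψ).mem_nhds (coord_mem_velDom hp),
    ((isOpen_transDom ψ φ).preimage val.continuous).mem_nhds (coord_trans_val hp hφ)]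
    with w hw hw'
  rw [expr_immT hs _ hw, coord_polyImm_trans hs hw hw']

/-- The derivative of the change of charts on the components of order zero. -/
theorem val_fderiv_expr_coord (hs : 1 ≤ s) {p : ImmT n m s X} {ψ φ : XChart n m X}
    (hp : p ∈ W s ψ) (hφ : p.target ∈ φ.1.source) (v : TCoord n m s) :
    val (fderiv ℝ ((ImmT.charts n m s X).expr ψ (fun p' => p'.coord φ)) (p.coord ψ) v) =
      fderiv ℝ (chartTrans ψ φ) (val (p.coord ψ)) (val v) := by
  have hm := coord_trans_val hp hφ
  rw [(expr_coord_eventuallyEq hs hp hφ).fderiv_eq]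
  have h1 := val.hasFDerivAt.comp (p.coord ψ) (((contDiffOn_jetTrans ψ φ).contDiffAt
    (((isOpen_transDom ψ φ).preimage val.continuous).mem_nhds hm)).differentiableAt
      (by simp)).hasFDerivAt
  have h2 := ((((contDiffOn_chartTrans ψ φ).contDiffAt
    ((isOpen_transDom ψ φ).mem_nhds hm)).differentiableAt (by simp)).hasFDerivAt).comp
      (p.coord ψ) (val (n := n) (m := m) (s := s)).hasFDerivAt
  have h3 : (val ∘ jetTrans ψ φ) = (chartTrans ψ φ ∘ (val (n := n) (m := m) (s := s))) :=
    funext fun w => val_jetTrans ψ φ w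
  rw [h3] at h1
  exact congrArg (fun f => f v) (h1.unique h2)

/-! ### The action of the differential group -/

/-- The linear action of a reparametrisation on coordinates of velocities. -/
def reparam (α : LocalDiff n) : TCoord n m s →L[ℝ] TCoord n m s :=
  ContinuousLinearMap.pi fun AJ => ∑ K : MultiIndex n s,
    partialD AJ.2.1.sort (fun t => mono K.1 (α.toFun t)) 0 •
      (ContinuousLinearMap.proj (AJ.1, K) : TCoord n m s →L[ℝ] ℝ)

theorem LocalDiff.contDiffAt (α : LocalDiff n) : ContDiffAt ℝ ∞ α.toFun 0 :=
  α.smooth.contDiffAt (α.isOpen_dom.mem_nhds α.zero_mem)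

theorem reparam_apply (α : LocalDiff n) (w : TCoord n m s) :
    reparam α w = jetOf s (fun t => poly w (α.toFun t)) 0 := by
  funext ⟨A, J⟩
  simp only [jetOf]
  rw [partialD_poly_comp α.contDiffAt]
  simp [reparam, mul_comm]

theorem val_reparam (α : LocalDiff n) (w : TCoord n m s) : val (reparam α w) = val w := by
  rw [reparam_apply, val_jetOf, α.map_zero, poly_zero_eq_val]

/-- The class of a local diffeomorphism in the differential group. -/
def DiffGroup.mk (s : ℕ) (α : LocalDiff n) : DiffGroup n s := Quotient.mk (diffSetoid n s) α

theorem DiffGroup.exists_mk_eq (a : DiffGroup n s) : ∃ α, DiffGroup.mk s α = a :=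
  Quotient.exists_rep a

theorem velocity_act (γ : Immersion n m X) (α : LocalDiff n) :
    (velocity s γ).act (DiffGroup.mk s α) = velocity s (γ.comp α) := rfl

theorem target_act (p : ImmT n m s X) (a : DiffGroup n s) : (p.act a).target = p.target := by
  obtain ⟨γ, rfl⟩ := exists_velocity_eq p
  obtain ⟨α, rfl⟩ := a.exists_mk_eq
  rw [velocity_act]
  simp [Immersion.comp, α.map_zero]

/-- Locally the action is linear in coordinates and therefore its own derivative. By `val_reparam`
it is the identity on the components of order zero, the only ones that a differential equation sees.
-/
theorem expr_act_eventuallyEq (hs : 1 ≤ s) {p : ImmT n m s X} {ψ : XChart n m X}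
    (hp : p ∈ W s ψ) (α : LocalDiff n) :
    (ImmT.charts n m s X).expr ψ (fun p' => (p'.act (DiffGroup.mk s α)).coord ψ)
      =ᶠ[𝓝 (p.coord ψ)] reparam α := by
  filter_upwards [(isOpen_velDom ψ).mem_nhds (coord_mem_velDom hp)] with w hw
  rw [expr_immT hs _ hw, velocity_act, coord_velocity, reparam_apply]
  · refine jetOf_congr ?_
    have h := (α.contDiffAt.continuousAt.tendsto.eventually
      (α.map_zero ▸ eventually_poly_mem ψ.1.open_target hw.1))
    filter_upwards [h] with t ht
    exact ψ.1.right_inv ht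
  · simp only [Immersion.comp, α.map_zero]
    exact polyImm_zero_mem hs hw

/-- The determinant of the jet of a local diffeomorphism is its Jacobian determinant. -/
theorem DiffGroup.det_mk (hs : 1 ≤ s) (α : LocalDiff n) :
    (DiffGroup.mk s α).det =
      (Matrix.of fun i j => fderiv ℝ α.toFun 0 (Pi.single j 1) i).det := by
  unfold DiffGroup.det
  congr 1
  ext i j
  have h : ({j} : Multiset (Fin n)).card ≤ s := by simpa using hs
  simp only [Matrix.of_apply, h, dif_pos]
  rw [← partialD_singleton α.contDiffAt]
  rfl

theorem DiffGroup.det_ne_zero (hs : 1 ≤ s) (a : DiffGroup n s) : a.det ≠ 0 := by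
  obtain ⟨α, rfl⟩ := a.exists_mk_eq
  rw [DiffGroup.det_mk hs, ← isUnit_iff_ne_zero, ← Matrix.isUnit_iff_isUnit_det,
    ← Matrix.mulVec_injective_iff_isUnit]
  have h := (α.invertible 0 α.zero_mem).1
  convert h using 1
  funext v i
  rw [fderiv_apply_eq_sum]
  simp [Matrix.mulVec, dotProduct, mul_comm]

theorem det_xMat_act (hs : 1 ≤ s) {p : ImmT n m s X} {ψ : XChart n m X}
    (hp : p.target ∈ ψ.1.source) (a : DiffGroup n s) :
    (xMat ((p.act a).coord ψ)).det = (xMat (p.coord ψ)).det * a.det := by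
  obtain ⟨γ, rfl⟩ := exists_velocity_eq p
  obtain ⟨α, rfl⟩ := a.exists_mk_eq
  have hp' : (γ.comp α).toFun 0 ∈ ψ.1.source := by
    simpa [Immersion.comp, α.map_zero] using hp
  rw [velocity_act, coord_velocity hp, coord_velocity hp', DiffGroup.det_mk hs, ← Matrix.det_mul]
  congr 1
  ext i j
  have hc := contDiffAt_chart γ ψ hp
  have hc' := contDiffAt_chart (γ.comp α) ψ hp'
  rw [xMat_jetOf hs hc', Matrix.mul_apply]
  have h1 : HasFDerivAt (fun t => ψ.1 (γ.toFun t)) (fderiv ℝ (fun t => ψ.1 (γ.toFun t)) 0)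
      (α.toFun 0) := by
    rw [α.map_zero]
    exact (hc.differentiableAt (by simp)).hasFDerivAt
  have h2 := h1.comp 0 (α.contDiffAt.differentiableAt (by simp)).hasFDerivAt
  have h3 : ((fun t => ψ.1 (γ.toFun t)) ∘ α.toFun) = fun t => ψ.1 ((γ.comp α).toFun t) := rfl
  rw [h3] at h2
  rw [h2.fderiv]
  have h4 := congrFun (xMat_jetOf_mulVec hs hc (fderiv ℝ α.toFun 0 (Pi.single j 1))) i
  rw [baseCLM_apply] at h4
  exact h4.symm

theorem act_mem_W_iff (hs : 1 ≤ s) (p : ImmT n m s X) (a : DiffGroup n s) (ψ : XChart n m X) :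
    p.act a ∈ W s ψ ↔ p ∈ W s ψ := by
  simp only [W, mem_ofPred_eq, target_act]
  refine and_congr_right fun h => ?_
  rw [det_xMat_act hs h]
  simp [DiffGroup.det_ne_zero hs a]

end Velocities

/-! ### The Grassmann manifold in charts -/

section GrassmannCharts

variable {n m s : ℕ} {X : Type u} [TopologicalSpace X]
  [ChartedSpace (EuclideanSpace ℝ (Fin (n + m))) X] [IsManifold (𝓡 (n + m)) ∞ X]

theorem contDiffAt_jetOf {c : (Fin n → ℝ) → Model n m} {t : Fin n → ℝ}
    (hc : ContDiffAt ℝ ∞ c t) : ContDiffAt ℝ ∞ (jetOf s c) t := by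
  rw [contDiffAt_pi]
  intro AJ
  exact (modelCoord AJ.1).contDiff.contDiffAt.comp t (contDiffAt_partialD hc _)

/-- An immersion whose first components are independent parametrises a graph. -/
theorem exists_graph (hs : 1 ≤ s) {γ : Immersion n m X} {ψ : XChart n m X}
    (hγ : velocity s γ ∈ W s ψ) :
    ∃ (α : LocalDiff n) (U U' : Set (Fin n → ℝ)) (f : Fin m → (Fin n → ℝ) → ℝ),
      IsOpen U ∧ 0 ∈ U ∧ U ⊆ chartDom γ ψ ∧
      (∀ t ∈ U, (xMat (jetOf s (fun t => ψ.1 (γ.toFun t)) t)).det ≠ 0) ∧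
      IsOpen U' ∧ (∀ σ, ContDiffOn ℝ ∞ (f σ) U') ∧
      (∀ t ∈ U, baseCLM n m (ψ.1 (γ.toFun t)) ∈ U') ∧
      (∀ t ∈ U, ∀ σ, ψ.1 (γ.toFun t) (Fin.natAdd n σ) = f σ (baseCLM n m (ψ.1 (γ.toFun t)))) ∧
      (∀ᶠ t in 𝓝 0, baseCLM n m (ψ.1 (γ.toFun (α.toFun t))) =
        baseCLM n m (ψ.1 (γ.toFun 0)) + t) ∧
      ∀ t σ, ψ.1 (γ.toFun (α.toFun t)) (Fin.natAdd n σ) =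
        f σ (baseCLM n m (ψ.1 (γ.toFun 0)) + t) := by
  set c : (Fin n → ℝ) → Model n m := fun t => ψ.1 (γ.toFun t) with hcdef
  have hγ0 : γ.toFun 0 ∈ ψ.1.source := hγ.1
  have hdet0 : (xMat (jetOf s c 0)).det ≠ 0 := by
    have := hγ.2
    rwa [coord_velocity hγ0] at this
  have hcU : ∀ t ∈ chartDom γ ψ, ContDiffAt ℝ ∞ c t := fun t ht =>
    (contDiffOn_chart_comp γ ψ).contDiffAt ((isOpen_chartDom γ ψ).mem_nhds ht)
  -- On `R` the base part of `c` has an invertible derivative, whose matrix is `(x^i_j)`.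
  set R : Set (Fin n → ℝ) := chartDom γ ψ ∩ jetOf s c ⁻¹' regSet n m s with hR
  have hRo : IsOpen R := by
    refine ContinuousOn.isOpen_inter_preimage ?_ (isOpen_chartDom γ ψ) isOpen_regSet
    exact fun t ht => (contDiffAt_jetOf (hcU t ht)).continuousAt.continuousWithinAt
  have h0R : (0 : Fin n → ℝ) ∈ R := ⟨⟨γ.zero_mem, hγ0⟩, hdet0⟩
  set x : Fin n → ℝ := baseCLM n m (c 0) with hx
  set g : (Fin n → ℝ) → (Fin n → ℝ) := fun t => baseCLM n m (c t) - x with hg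
  have hgs : ∀ t ∈ R, ContDiffAt ℝ ∞ g t := fun t ht =>
    ((baseCLM n m).contDiff.contDiffAt.comp t (hcU t ht.1)).sub contDiffAt_const
  have hgd : ∀ t ∈ R, ∃ g' : (Fin n → ℝ) ≃L[ℝ] (Fin n → ℝ),
      HasFDerivAt g (g' : (Fin n → ℝ) →L[ℝ] (Fin n → ℝ)) t := by
    intro t ht
    have h1 : HasFDerivAt g ((baseCLM n m).comp (fderiv ℝ c t)) t :=
      ((baseCLM n m).hasFDerivAt.comp t
        ((hcU t ht.1).differentiableAt (by simp)).hasFDerivAt).sub_const x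
    have hinj : Function.Injective ((baseCLM n m).comp (fderiv ℝ c t)) := by
      rw [injective_iff_map_eq_zero]
      intro v hv
      refine Matrix.eq_zero_of_mulVec_eq_zero ht.2 ?_
      rw [xMat_jetOf_mulVec hs (hcU t ht.1)]
      exact hv
    refine ⟨(LinearEquiv.ofInjectiveEndo
      ((baseCLM n m).comp (fderiv ℝ c t)).toLinearMap hinj).toContinuousLinearEquiv, ?_⟩
    have h2 : ((LinearEquiv.ofInjectiveEndo
        ((baseCLM n m).comp (fderiv ℝ c t)).toLinearMap hinj).toContinuousLinearEquiv :
        (Fin n → ℝ) →L[ℝ] (Fin n → ℝ)) = (baseCLM n m).comp (fderiv ℝ c t) := by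
      ext v i
      rfl
    rw [h2]
    exact h1
  obtain ⟨g0, hg0⟩ := hgd 0 h0R
  set e := (hgs 0 h0R).toOpenPartialHomeomorph g hg0 (by simp) with he
  have hecoe : ∀ t, e t = g t := fun t => rfl
  have h0e : (0 : Fin n → ℝ) ∈ e.source :=
    (hgs 0 h0R).mem_toOpenPartialHomeomorph_source hg0 (by simp)
  have hg00 : g 0 = 0 := by simp [hg, hx]
  have h0t : (0 : Fin n → ℝ) ∈ e.target := by
    have := e.map_source h0e
    rwa [hecoe, hg00] at this
  have hsymm0 : e.symm 0 = 0 := by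
    have := e.left_inv h0e
    rwa [hecoe, hg00] at this
  -- A `LocalDiff` must be smooth with bijective derivative on its whole domain, not only at `0`.
  -- The local inverse is so wherever its values lie in `R`.
  set D : Set (Fin n → ℝ) := e.target ∩ e.symm ⁻¹' R with hD
  have hDo : IsOpen D := e.symm.isOpen_inter_preimage hRo
  have hsm : ∀ t ∈ D, ContDiffAt ℝ ∞ e.symm t := by
    intro t ht
    obtain ⟨g', hg'⟩ := hgd _ ht.2
    exact e.contDiffAt_symm ht.1 hg' (hgs _ ht.2)
  let α : LocalDiff n :=
    { toFun := e.symm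
      dom := D
      isOpen_dom := hDo
      zero_mem := ⟨h0t, by rw [mem_preimage, hsymm0]; exact h0R⟩
      map_zero := hsymm0
      smooth := fun t ht => (hsm t ht).contDiffWithinAt
      invertible := by
        intro t ht
        obtain ⟨g', hg'⟩ := hgd _ ht.2
        have h1 : HasFDerivAt e.symm (g'.symm : (Fin n → ℝ) →L[ℝ] (Fin n → ℝ)) t :=
          e.hasFDerivAt_symm ht.1 hg'
        rw [h1.fderiv]
        exact g'.symm.bijective }
  have hbase : ∀ t ∈ e.target, baseCLM n m (c (e.symm t)) = x + t := by
    intro t ht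
    have h1 := e.right_inv ht
    rw [hecoe] at h1
    exact (sub_eq_iff_eq_add'.1 h1)
  -- The reparametrisation is `g⁻¹`, and the functions whose graph is parametrised are the last
  -- components of `c ∘ g⁻¹`, shifted back by the base point `x`.
  refine ⟨α, R ∩ (e.source ∩ e ⁻¹' D), (fun y => y - x) ⁻¹' D,
    fun σ y => c (e.symm (y - x)) (Fin.natAdd n σ), hRo.inter (e.isOpen_inter_preimage hDo),
    ⟨h0R, h0e, ?_⟩, fun t ht => ht.1.1, fun t ht => ht.1.2,
    hDo.preimage (continuous_id.sub continuous_const), ?_, ?_, ?_, ?_, ?_⟩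
  · rw [mem_preimage, hecoe, hg00]
    exact α.zero_mem
  · intro σ y hy
    refine ContDiffAt.contDiffWithinAt ?_
    have h1 : ContDiffAt ℝ ∞ (fun y => e.symm (y - x)) y :=
      ContDiffAt.comp y (hsm (y - x) hy) (contDiffAt_id.sub contDiffAt_const)
    have h2 : ContDiffAt ℝ ∞ (c ∘ fun y => e.symm (y - x)) y :=
      ContDiffAt.comp y (hcU _ hy.2.1) h1
    exact (modelCoord (Fin.natAdd n σ)).contDiff.contDiffAt.comp y h2
  · exact fun t ht => ht.2.2
  · intro t ht σ
    have h1 : e.symm (baseCLM n m (c t) - x) = t := e.left_inv ht.2.1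
    change c t (Fin.natAdd n σ) = c (e.symm (baseCLM n m (c t) - x)) (Fin.natAdd n σ)
    rw [h1]
  · filter_upwards [e.open_target.mem_nhds h0t] with t ht
    exact hbase t ht
  · intro t σ
    simp [α, c]

/-- Every velocity in `W` is equivalent to the velocity of a graph parametrisation. -/
theorem exists_act_coord_eq_canon (hs : 1 ≤ s) {p : ImmT n m s X} {ψ : XChart n m X}
    (hp : p ∈ W s ψ) : ∃ a, (p.act a).coord ψ = canon (pc (p.coord ψ)) := by
  obtain ⟨γ, rfl⟩ := exists_velocity_eq p
  obtain ⟨α, U, U', f, hU, h0, hUc, hdet, hU', hf, hmap, hcf, hb, hα⟩ := exists_graph hs hp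
  refine ⟨DiffGroup.mk s α, ?_⟩
  have hγ0 : γ.toFun 0 ∈ ψ.1.source := hp.1
  have h1 : (γ.comp α).toFun 0 ∈ ψ.1.source := by
    simpa [Immersion.comp, α.map_zero] using hγ0
  rw [velocity_act, coord_velocity h1, coord_velocity hγ0,
    jetOf_eq_canon hs (contDiffAt_chart _ ψ h1) (baseCLM n m (ψ.1 (γ.toFun 0)))
      (hb.mono fun t ht i => congrFun ht i)]
  congr 1
  funext z
  rcases z with i | ⟨σ, J⟩
  · exact (get_jetOf_zero (s := s) (c := fun t => ψ.1 (γ.toFun t)) (t := 0) _).symm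
  · simp only [pc, Sum.elim_inr]
    rw [yFun_jetOf hs hU ((contDiffOn_chart_comp γ ψ).mono hUc) hdet hU' (hf σ) hmap σ
      (fun t ht => hcf t ht σ) _ (by rw [Multiset.length_sort]; exact J.2) 0 h0]
    rw [← add_zero (baseCLM n m (ψ.1 (γ.toFun 0))), ← partialD_comp_add]
    congr 1
    funext t
    exact hα t σ

/-- The maps `γ` and `γ ∘ β` parametrise the same graph near the same point, so in both cases the
`y^σ_J` are derivatives of the same function there. -/
theorem pc_coord_act (hs : 1 ≤ s) {p : ImmT n m s X} {ψ : XChart n m X}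
    (hp : p ∈ W s ψ) (a : DiffGroup n s) : pc ((p.act a).coord ψ) = pc (p.coord ψ) := by
  have hpa := (act_mem_W_iff hs p a ψ).2 hp
  obtain ⟨γ, rfl⟩ := exists_velocity_eq p
  obtain ⟨β, rfl⟩ := a.exists_mk_eq
  obtain ⟨α, U, U', f, hU, h0, hUc, hdet, hU', hf, hmap, hcf, hb, hα⟩ := exists_graph hs hp
  have hγ0 : γ.toFun 0 ∈ ψ.1.source := hp.1
  have h1 : (γ.comp β).toFun 0 ∈ ψ.1.source := by
    simpa [Immersion.comp, β.map_zero] using hγ0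
  rw [velocity_act] at hpa ⊢
  have hβ0 : ψ.1 ((γ.comp β).toFun 0) = ψ.1 (γ.toFun 0) := by simp [Immersion.comp, β.map_zero]
  have hpa2 := hpa.2
  rw [coord_velocity h1] at hpa2
  rw [coord_velocity h1, coord_velocity hγ0]
  set c' : (Fin n → ℝ) → Model n m := fun t => ψ.1 ((γ.comp β).toFun t) with hc'
  funext z
  rcases z with i | ⟨σ, J⟩
  · simp only [pc, Sum.elim_inl]
    rw [get_jetOf_zero, get_jetOf_zero]
    exact congrArg (fun e : Model n m => e (Fin.castAdd m i)) hβ0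
  · simp only [pc, Sum.elim_inr]
    have hcU : ∀ t ∈ chartDom (γ.comp β) ψ, ContDiffAt ℝ ∞ c' t := fun t ht =>
      (contDiffOn_chart_comp (γ.comp β) ψ).contDiffAt ((isOpen_chartDom _ ψ).mem_nhds ht)
    set V : Set (Fin n → ℝ) := (chartDom (γ.comp β) ψ ∩ jetOf s c' ⁻¹' regSet n m s) ∩
      (β.dom ∩ β.toFun ⁻¹' U) with hV
    have hVo : IsOpen V := by
      refine IsOpen.inter ?_ (β.smooth.continuousOn.isOpen_inter_preimage β.isOpen_dom hU)
      refine ContinuousOn.isOpen_inter_preimage ?_ (isOpen_chartDom _ ψ) isOpen_regSet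
      exact fun t ht => (contDiffAt_jetOf (hcU t ht)).continuousAt.continuousWithinAt
    have h0V : (0 : Fin n → ℝ) ∈ V := by
      refine ⟨⟨⟨(γ.comp β).zero_mem, h1⟩, hpa2⟩, β.zero_mem, ?_⟩
      rw [mem_preimage, β.map_zero]
      exact h0
    have hJ : J.1.sort.length ≤ s := by rw [Multiset.length_sort]; exact J.2
    rw [yFun_jetOf hs hU ((contDiffOn_chart_comp γ ψ).mono hUc) hdet hU' (hf σ) hmap σ
      (fun t ht => hcf t ht σ) _ hJ 0 h0]
    rw [yFun_jetOf hs hVo ((contDiffOn_chart_comp (γ.comp β) ψ).mono fun t ht => ht.1.1)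
      (fun t ht => ht.1.2) hU' (hf σ) (fun t ht => hmap _ ht.2.2) σ
      (fun t ht => hcf _ ht.2.2 σ) _ hJ 0 h0V, hβ0]

/-- Functions on `W` which are invariant under the differential group are constant on orbits. -/
theorem mem_W_and_eq_of_rho_eq (hs : 1 ≤ s) {F : Type*} {ψ : XChart n m X}
    {f : ImmT n m s X → F} (hf : ∀ p ∈ W s ψ, ∀ a, f (p.act a) = f p) {p p' : ImmT n m s X}
    (h : rho p = rho p') (hp : p ∈ W s ψ) : p' ∈ W s ψ ∧ f p' = f p := by
  classical
  -- Extension by `none` gives an invariant function on all velocities, which descends to the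
  -- quotient. It records membership in `W` and the value at once, so both are compared without
  -- describing the relation generated by `Quot`.
  let g : ImmT n m s X → Option F := fun p => if p ∈ W s ψ then some (f p) else none
  have hg : ∀ p p' : ImmT n m s X, (∃ a : DiffGroup n s, p' = p.act a) → g p = g p' := by
    rintro q _ ⟨a, rfl⟩
    by_cases hq : q ∈ W s ψ
    · simp [g, hq, act_mem_W_iff hs, hf q hq a]
    · simp [g, hq, act_mem_W_iff hs]
  have h1 : g p = g p' := congrArg (Quot.lift g hg) h
  by_cases hp' : p' ∈ W s ψ
  · refine ⟨hp', ?_⟩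
    simp only [g, hp, hp', if_true, Option.some.injEq] at h1
    exact h1.symm
  · simp [g, hp, hp'] at h1

theorem mem_W_of_rho_eq (hs : 1 ≤ s) {ψ : XChart n m X} {p p' : ImmT n m s X}
    (h : rho p = rho p') (hp : p ∈ W s ψ) : p' ∈ W s ψ :=
  (mem_W_and_eq_of_rho_eq hs (f := fun _ => ()) (fun _ _ _ => rfl) h hp).1

theorem coord_rho (hs : 1 ≤ s) {ψ : XChart n m X} {p : ImmT n m s X} (hp : p ∈ W s ψ) :
    (rho p).coord ψ = pc (p.coord ψ) := by
  have h : ∃ p' ∈ W s ψ, rho p' = rho p := ⟨p, hp, rfl⟩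
  have h1 : (rho p).coord ψ = pc (h.choose.coord ψ) := by
    unfold GrassmannManifold.coord
    rw [dif_pos h]
    rfl
  rw [h1]
  exact (mem_W_and_eq_of_rho_eq hs (f := fun p : ImmT n m s X => pc (p.coord ψ))
    (fun p hp a => pc_coord_act hs hp a) h.choose_spec.2.symm hp).2

/-- The projection of the coordinates on the Grassmann manifold to those of `X`. -/
def hor : PCoord n m s →L[ℝ] Model n m :=
  (EuclideanSpace.equiv (Fin (n + m)) ℝ).symm.toContinuousLinearMap.comp
    (ContinuousLinearMap.pi fun A => Fin.addCases
      (motive := fun _ => PCoord n m s →L[ℝ] ℝ)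
      (fun i => ContinuousLinearMap.proj (Sum.inl i))
      (fun σ => ContinuousLinearMap.proj (Sum.inr (σ, MultiIndex.empty n s))) A)

@[simp]
theorem hor_castAdd (w : PCoord n m s) (i : Fin n) : hor w (Fin.castAdd m i) = w (Sum.inl i) := by
  simp [hor]

@[simp]
theorem hor_natAdd (w : PCoord n m s) (σ : Fin m) :
    hor w (Fin.natAdd n σ) = w (Sum.inr (σ, MultiIndex.empty n s)) := by
  simp [hor]

theorem val_canon (w : PCoord n m s) : val (canon w) = hor w := by
  ext A
  induction A using Fin.addCases with
  | left i => simp [canon_castAdd, MultiIndex.empty]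
  | right σ => simp [canon_natAdd]

theorem hor_pc (w : TCoord n m s) : hor (pc w) = val w := by
  ext A
  induction A using Fin.addCases with
  | left i => simp [pc, TCoord.get, MultiIndex.empty]
  | right σ => simp [pc, TCoord.get, MultiIndex.empty, yFun]

/-- The set of coordinate values of a chart of the Grassmann manifold. -/
def grDom (s : ℕ) (ψ : XChart n m X) : Set (PCoord n m s) := hor ⁻¹' ψ.1.target

theorem canon_mem_velDom (hs : 1 ≤ s) {ψ : XChart n m X} {w : PCoord n m s}
    (hw : w ∈ grDom s ψ) : canon w ∈ velDom s ψ := by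
  refine ⟨?_, canon_mem_regSet hs w⟩
  rw [mem_preimage, val_canon]
  exact hw

/-- The velocity of the graph parametrisation with the given coordinates. -/
def graphVel (hs : 1 ≤ s) (ψ : XChart n m X) (w : PCoord n m s) (hw : w ∈ grDom s ψ) :
    ImmT n m s X :=
  velocity s (polyImm hs ψ (canon w) (canon_mem_velDom hs hw))

theorem graphVel_mem_W (hs : 1 ≤ s) {ψ : XChart n m X} {w : PCoord n m s} (hw : w ∈ grDom s ψ) :
    graphVel hs ψ w hw ∈ W s ψ := polyImm_mem_W hs _

theorem coord_graphVel (hs : 1 ≤ s) {ψ : XChart n m X} {w : PCoord n m s} (hw : w ∈ grDom s ψ) :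
    (graphVel hs ψ w hw).coord ψ = canon w := coord_polyImm hs _

theorem coord_rho_graphVel (hs : 1 ≤ s) {ψ : XChart n m X} {w : PCoord n m s}
    (hw : w ∈ grDom s ψ) : (rho (graphVel hs ψ w hw)).coord ψ = w := by
  rw [coord_rho hs (graphVel_mem_W hs hw), coord_graphVel, pc_canon hs]

theorem coord_mem_grDom (hs : 1 ≤ s) {ψ : XChart n m X} {c : GrassmannManifold n m s X}
    (hc : c ∈ rho '' W s ψ) : c.coord ψ ∈ grDom s ψ := by
  obtain ⟨p, hp, rfl⟩ := hc
  rw [coord_rho hs hp, grDom, mem_preimage, hor_pc]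
  exact (coord_mem_velDom hp).1

/-- Thus `graphVel` is a section of `ρ` over `ρ(W)`: it has the same coordinates as the normalised
representative of the orbit, and coordinates separate velocities. -/
theorem rho_graphVel_coord (hs : 1 ≤ s) {ψ : XChart n m X} {c : GrassmannManifold n m s X}
    (hc : c ∈ rho '' W s ψ) : rho (graphVel hs ψ (c.coord ψ) (coord_mem_grDom hs hc)) = c := by
  have hc' := hc
  obtain ⟨p, hp, rfl⟩ := hc'
  obtain ⟨a, ha⟩ := exists_act_coord_eq_canon hs hp
  have h1 : graphVel hs ψ ((rho p).coord ψ) (coord_mem_grDom hs hc) = p.act a := by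
    refine coord_injective (graphVel_mem_W hs _).1 (target_act p a ▸ hp.1) ?_
    rw [coord_graphVel, ha, coord_rho hs hp]
  rw [h1]
  exact (Quot.sound ⟨a, rfl⟩).symm

theorem range_grassmann (hs : 1 ≤ s) (ψ : XChart n m X) :
    (GrassmannManifold.charts n m s X).range ψ = grDom s ψ := by
  ext w
  constructor
  · rintro ⟨c, hc, rfl⟩
    exact coord_mem_grDom hs hc
  · exact fun hw => ⟨_, ⟨_, graphVel_mem_W hs hw, rfl⟩, coord_rho_graphVel hs hw⟩

theorem expr_grassmann (hs : 1 ≤ s) {F : Type*} [Zero F] {ψ : XChart n m X}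
    (f : GrassmannManifold n m s X → F) {w : PCoord n m s} (hw : w ∈ grDom s ψ) :
    (GrassmannManifold.charts n m s X).expr ψ f w = f (rho (graphVel hs ψ w hw)) := by
  have h : ∃ c ∈ (GrassmannManifold.charts n m s X).dom ψ,
      (GrassmannManifold.charts n m s X).coord ψ c = w :=
    ⟨rho (graphVel hs ψ w hw), ⟨_, graphVel_mem_W hs hw, rfl⟩, coord_rho_graphVel hs hw⟩
  unfold ChartSystem.expr
  rw [dif_pos h]
  congr 1
  rw [← rho_graphVel_coord hs h.choose_spec.1]
  congr 2
  exact h.choose_spec.2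

theorem expr_grassmann_coord (hs : 1 ≤ s) {F : Type*} [Zero F] {ψ : XChart n m X}
    (f : GrassmannManifold n m s X → F) {c : GrassmannManifold n m s X} (hc : c ∈ rho '' W s ψ) :
    (GrassmannManifold.charts n m s X).expr ψ f (c.coord ψ) = f c := by
  rw [expr_grassmann hs f (coord_mem_grDom hs hc), rho_graphVel_coord hs hc]

/-! ### Change of charts on the Grassmann manifold -/

/-- The change of charts of the Grassmann manifold. -/
def grTrans (ψ φ : XChart n m X) (w : PCoord n m s) : PCoord n m s := pc (jetTrans ψ φ (canon w))

/-- The domain of the change of charts of the Grassmann manifold. -/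
def grTransDom (s : ℕ) (ψ φ : XChart n m X) : Set (PCoord n m s) :=
  hor ⁻¹' transDom ψ φ ∩ (fun w => jetTrans ψ φ (canon w)) ⁻¹' regSet n m s

theorem contDiffOn_jetTrans_canon (ψ φ : XChart n m X) :
    ContDiffOn ℝ ∞ (fun w : PCoord n m s => jetTrans ψ φ (canon w)) (hor ⁻¹' transDom ψ φ) :=
  (contDiffOn_jetTrans ψ φ).comp contDiff_canon.contDiffOn fun w hw => by
    rw [mem_preimage, val_canon]
    exact hw

theorem isOpen_grTransDom (ψ φ : XChart n m X) : IsOpen (grTransDom s ψ φ) :=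
  (contDiffOn_jetTrans_canon ψ φ).continuousOn.isOpen_inter_preimage
    ((isOpen_transDom ψ φ).preimage hor.continuous) isOpen_regSet

theorem contDiffOn_grTrans (ψ φ : XChart n m X) :
    ContDiffOn ℝ ∞ (grTrans ψ φ : PCoord n m s → PCoord n m s) (grTransDom s ψ φ) :=
  contDiffOn_pc.comp ((contDiffOn_jetTrans_canon ψ φ).mono inter_subset_left) fun _ hw => hw.2

theorem hor_grTrans (ψ φ : XChart n m X) (w : PCoord n m s) :
    hor (grTrans ψ φ w) = chartTrans ψ φ (hor w) := by
  rw [grTrans, hor_pc, val_jetTrans, val_canon]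

theorem grTransDom_subset (ψ φ : XChart n m X) : grTransDom s ψ φ ⊆ grDom s ψ :=
  fun _ hw => hw.1.1

theorem coord_graphVel_trans (hs : 1 ≤ s) {ψ φ : XChart n m X} {w : PCoord n m s}
    (hw : w ∈ grTransDom s ψ φ) :
    (graphVel hs ψ w (grTransDom_subset ψ φ hw)).coord φ = jetTrans ψ φ (canon w) :=
  coord_polyImm_trans hs _ (by rw [val_canon]; exact hw.1)

theorem graphVel_mem_W_trans (hs : 1 ≤ s) {ψ φ : XChart n m X} {w : PCoord n m s}
    (hw : w ∈ grTransDom s ψ φ) : graphVel hs ψ w (grTransDom_subset ψ φ hw) ∈ W s φ := by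
  refine ⟨?_, ?_⟩
  · simp only [graphVel, target_velocity, polyImm, poly_zero_eq_val, val_canon]
    exact hw.1.2
  · rw [coord_graphVel_trans hs hw]
    exact hw.2

theorem coord_mem_grTransDom (hs : 1 ≤ s) {ψ φ : XChart n m X} {c : GrassmannManifold n m s X}
    (hψ : c ∈ rho '' W s ψ) (hφ : c ∈ rho '' W s φ) : c.coord ψ ∈ grTransDom s ψ φ := by
  set q := graphVel hs ψ (c.coord ψ) (coord_mem_grDom hs hψ) with hq
  have hqψ : q ∈ W s ψ := graphVel_mem_W hs _
  have hqφ : q ∈ W s φ := by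
    obtain ⟨p, hp, hpc⟩ := hφ
    exact mem_W_of_rho_eq hs (hpc.trans (rho_graphVel_coord hs hψ).symm) hp
  have h1 := coord_trans_val hqψ hqφ.1
  have h2 := coord_eq_jetTrans hs hqψ hqφ.1
  rw [hq, coord_graphVel, val_canon] at h1
  refine ⟨h1, ?_⟩
  have h3 := hqφ.2
  rw [h2, hq, coord_graphVel] at h3
  exact h3

/-- Holds because `W` is a union of orbits; images under `ρ` would not commute with intersections in
general. -/
theorem mem_image_inter_iff (hs : 1 ≤ s) {ψ φ : XChart n m X} {c : GrassmannManifold n m s X} :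
    c ∈ rho '' (W s ψ ∩ W s φ) ↔ c ∈ rho '' W s ψ ∧ c ∈ rho '' W s φ := by
  constructor
  · rintro ⟨p, hp, rfl⟩
    exact ⟨⟨p, hp.1, rfl⟩, ⟨p, hp.2, rfl⟩⟩
  · rintro ⟨⟨p, hp, rfl⟩, ⟨p', hp', h⟩⟩
    exact ⟨p, ⟨hp, mem_W_of_rho_eq hs h hp'⟩, rfl⟩

theorem coord_eq_grTrans (hs : 1 ≤ s) {ψ φ : XChart n m X} {w : PCoord n m s}
    (hw : w ∈ grTransDom s ψ φ) :
    (rho (graphVel hs ψ w (grTransDom_subset ψ φ hw))).coord φ = grTrans ψ φ w := by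
  rw [coord_rho hs (graphVel_mem_W_trans hs hw), coord_graphVel_trans hs hw]
  rfl

theorem expr_coord_eqOn (hs : 1 ≤ s) (ψ φ : XChart n m X) :
    EqOn ((GrassmannManifold.charts n m s X).expr ψ (fun c => c.coord φ)) (grTrans ψ φ)
      (grTransDom s ψ φ) := by
  intro w hw
  rw [expr_grassmann hs _ (grTransDom_subset ψ φ hw), coord_eq_grTrans hs hw]

theorem expr_coord_eventuallyEq_grTrans (hs : 1 ≤ s) {ψ φ : XChart n m X} {w : PCoord n m s}
    (hw : w ∈ grTransDom s ψ φ) :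
    (GrassmannManifold.charts n m s X).expr ψ (fun c => c.coord φ) =ᶠ[𝓝 w] grTrans ψ φ :=
  (expr_coord_eqOn hs ψ φ).eventuallyEq_of_mem ((isOpen_grTransDom ψ φ).mem_nhds hw)

theorem differentiableAt_grTrans {ψ φ : XChart n m X} {w : PCoord n m s}
    (hw : w ∈ grTransDom s ψ φ) : DifferentiableAt ℝ (grTrans ψ φ) w :=
  ((contDiffOn_grTrans ψ φ).contDiffAt ((isOpen_grTransDom ψ φ).mem_nhds hw)).differentiableAt
    (by simp)

theorem differentiableAt_chartTrans {ψ φ : XChart n m X} {e : Model n m}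
    (he : e ∈ transDom ψ φ) : DifferentiableAt ℝ (chartTrans ψ φ) e :=
  ((contDiffOn_chartTrans ψ φ).contDiffAt ((isOpen_transDom ψ φ).mem_nhds he)).differentiableAt
    (by simp)

/-- The change of charts covers that of `X`. Hence `𝒥`, `P^ν_σ` and the pull-backs of the `ω^σ`,
which involve only order-zero components of tangent vectors, can be computed from the derivative of
`chartTrans`. -/
theorem hor_fderiv_grTrans {ψ φ : XChart n m X} {w : PCoord n m s}
    (hw : w ∈ grTransDom s ψ φ) (v : PCoord n m s) :
    hor (fderiv ℝ (grTrans ψ φ) w v) = fderiv ℝ (chartTrans ψ φ) (hor w) (hor v) := by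
  have h1 := hor.hasFDerivAt.comp w (differentiableAt_grTrans hw).hasFDerivAt
  have h2 := (differentiableAt_chartTrans hw.1).hasFDerivAt.comp w
    (hor (n := n) (m := m) (s := s)).hasFDerivAt
  have h3 : (hor ∘ grTrans ψ φ) = (chartTrans ψ φ ∘ (hor (n := n) (m := m) (s := s))) :=
    funext fun w => hor_grTrans ψ φ w
  rw [h3] at h1
  exact congrArg (fun f => f v) (h1.unique h2)

theorem hor_fderiv_expr_coord (hs : 1 ≤ s) {ψ φ : XChart n m X} {w : PCoord n m s}
    (hw : w ∈ grTransDom s ψ φ) (v : PCoord n m s) :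
    hor (fderiv ℝ ((GrassmannManifold.charts n m s X).expr ψ (fun c => c.coord φ)) w v) =
      fderiv ℝ (chartTrans ψ φ) (hor w) (hor v) := by
  rw [(expr_coord_eventuallyEq_grTrans hs hw).fderiv_eq, hor_fderiv_grTrans hw]

theorem fderiv_xBar (hs : 1 ≤ s) {ψ φ : XChart n m X} {w : PCoord n m s}
    (hw : w ∈ grTransDom s ψ φ) (j : Fin n) (v : PCoord n m s) :
    fderiv ℝ (xBar (s := s) ψ φ j) w v =
      fderiv ℝ (chartTrans ψ φ) (hor w) (hor v) (Fin.castAdd m j) := by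
  have h1 : xBar (s := s) ψ φ j =ᶠ[𝓝 w] fun w => grTrans ψ φ w (Sum.inl j) := by
    filter_upwards [(isOpen_grTransDom ψ φ).mem_nhds hw] with w' hw'
    rw [xBar, expr_grassmann hs _ (grTransDom_subset ψ φ hw'), coord_eq_grTrans hs hw']
  rw [h1.fderiv_eq, ← hor_fderiv_grTrans hw, hor_castAdd]
  have h2 := (ContinuousLinearMap.proj (R := ℝ) (φ := fun _ => ℝ)
    (Sum.inl j : Fin n ⊕ (Fin m × MultiIndex n s))).hasFDerivAt.comp w
      (differentiableAt_grTrans hw).hasFDerivAt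
  exact congrArg (fun f => f v) h2.fderiv

theorem fderiv_yBar (hs : 1 ≤ s) {ψ φ : XChart n m X} {w : PCoord n m s}
    (hw : w ∈ grTransDom s ψ φ) (ν : Fin m) (v : PCoord n m s) :
    fderiv ℝ (yBar (s := s) ψ φ ν) w v =
      fderiv ℝ (chartTrans ψ φ) (hor w) (hor v) (Fin.natAdd n ν) := by
  have h1 : yBar (s := s) ψ φ ν =ᶠ[𝓝 w]
      fun w => grTrans ψ φ w (Sum.inr (ν, MultiIndex.empty n s)) := by
    filter_upwards [(isOpen_grTransDom ψ φ).mem_nhds hw] with w' hw'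
    rw [yBar, expr_grassmann hs _ (grTransDom_subset ψ φ hw'), coord_eq_grTrans hs hw']
    simp [PCoord.get, MultiIndex.empty]
  rw [h1.fderiv_eq, ← hor_fderiv_grTrans hw, hor_natAdd]
  have h2 := (ContinuousLinearMap.proj (R := ℝ) (φ := fun _ => ℝ)
    (Sum.inr (ν, MultiIndex.empty n s) : Fin n ⊕ (Fin m × MultiIndex n s))).hasFDerivAt.comp w
      (differentiableAt_grTrans hw).hasFDerivAt
  exact congrArg (fun f => f v) h2.fderiv

end GrassmannCharts

/-! ### Local components of homogeneous equations -/

section Components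

variable {n m s : ℕ} {X : Type u} [TopologicalSpace X]
  [ChartedSpace (EuclideanSpace ℝ (Fin (n + m))) X] [IsManifold (𝓡 (n + m)) ∞ X]

theorem yFun_singleton (σ : Fin m) (i : Fin n) (w : TCoord n m s) :
    yFun σ [i] w = ∑ j, (xMat w)⁻¹ j i * w.get (Fin.natAdd n σ) {j} := by
  simp only [yFun]
  refine Finset.sum_congr rfl fun j _ => ?_
  have : (fun w : TCoord n m s => w.get (Fin.natAdd n σ) 0) = getCLM (Fin.natAdd n σ) 0 := by
    funext w
    rw [getCLM_apply]
  rw [formalD_eq, this, ContinuousLinearMap.fderiv]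
  rw [getCLM_apply]
  simp [formalDir, getCLM_apply, TCoord.get, Nat.one_le_iff_ne_zero]

/-- `x^σ_j = y^σ_i x^i_j`. -/
theorem get_natAdd_eq_sum {w : TCoord n m s} (hw : w ∈ regSet n m s) (σ : Fin m) (j : Fin n) :
    w.get (Fin.natAdd n σ) {j} = ∑ i, yFun σ [i] w * xMat w i j := by
  simp only [yFun_singleton, Finset.sum_mul]
  rw [Finset.sum_comm]
  have h : (xMat w)⁻¹ * xMat w = 1 := Matrix.nonsing_inv_mul _ (isUnit_iff_ne_zero.2 hw)
  have h1 : ∀ k, ∑ i, (xMat w)⁻¹ k i * w.get (Fin.natAdd n σ) {k} * xMat w i j =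
      (1 : Matrix (Fin n) (Fin n) ℝ) k j * w.get (Fin.natAdd n σ) {k} := by
    intro k
    rw [← h, Matrix.mul_apply, Finset.sum_mul]
    exact Finset.sum_congr rfl fun i _ => by ring
  simp [h1, Matrix.one_apply]

theorem get_pc (hs : 1 ≤ s) (w : TCoord n m s) (σ : Fin m) (i : Fin n) :
    (pc w).get σ {i} = yFun σ [i] w := by
  have h : ({i} : Multiset (Fin n)).card ≤ s := by simpa using hs
  simp [PCoord.get, pc, hs]

/-- The contact form `ω^σ` as a form on the tangent spaces of `X`. -/
def contact (σ : Fin m) (w : PCoord n m s) : Model n m →L[ℝ] ℝ :=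
  modelCoord (Fin.natAdd n σ) - ∑ i, w.get σ {i} • modelCoord (Fin.castAdd m i)

theorem contact_apply (σ : Fin m) (w : PCoord n m s) (u : Model n m) :
    contact σ w u = u (Fin.natAdd n σ) - ∑ i, w.get σ {i} * u (Fin.castAdd m i) := by
  simp [contact]

theorem omega_zero_eq (σ : Fin m) (w : PCoord n m s) : omega σ 0 w = (contact σ w).comp hor := by
  ext v
  simp [omega, contact_apply, dY, dX, MultiIndex.empty]

/-- The vectors spanning the contact element with coordinates `w`. -/
def frame (w : PCoord n m s) (j : Fin n) : Model n m :=
  WithLp.toLp 2 fun A => (canon w).get A {j}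

theorem frame_castAdd (hs : 1 ≤ s) (w : PCoord n m s) (i j : Fin n) :
    frame w j (Fin.castAdd m i) = if i = j then 1 else 0 := by
  have := congrFun (congrFun (xMat_canon hs w) i) j
  rw [Matrix.one_apply] at this
  exact this

theorem frame_natAdd (w : PCoord n m s) (σ : Fin m) (j : Fin n) :
    frame w j (Fin.natAdd n σ) = w.get σ {j} := get_canon_natAdd w σ _

/-- Decomposition of a tangent vector along a contact element. -/
theorem eq_sum_frame_add (hs : 1 ≤ s) (w : PCoord n m s) (u : Model n m) :
    u = ∑ i, u (Fin.castAdd m i) • frame w i +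
      ∑ σ, contact σ w u • EuclideanSpace.single (Fin.natAdd n σ) (1 : ℝ) := by
  ext A
  induction A using Fin.addCases with
  | left j =>
    have h : ∀ σ : Fin m, Fin.castAdd m j ≠ Fin.natAdd n σ := fun σ h => by
      have := congrArg Fin.val h
      simp at this
      omega
    simp [frame_castAdd hs, h]
  | right ν => simp [frame_natAdd, contact_apply, mul_comm, Pi.single_apply]

theorem fderiv_poly_canon (hs : 1 ≤ s) (w : PCoord n m s) (j : Fin n) :
    fderiv ℝ (poly (canon w)) 0 (Pi.single j 1) = frame w j := by
  ext A
  rw [← get_jetOf_singleton hs (contDiff_poly_right _).contDiffAt, jetOf_poly]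
  rfl

/-- The first order components of the change of charts. -/
theorem get_jetTrans_canon (hs : 1 ≤ s) {ψ φ : XChart n m X} {w : PCoord n m s}
    (hw : hor w ∈ transDom ψ φ) (A : Fin (n + m)) (j : Fin n) :
    (jetTrans ψ φ (canon w)).get A {j} = fderiv ℝ (chartTrans ψ φ) (hor w) (frame w j) A := by
  have h0 : poly (canon w) 0 = hor w := by rw [poly_zero_eq_val, val_canon]
  have h1 : ContDiffAt ℝ ∞ (chartTrans ψ φ) (poly (canon w) 0) := by
    rw [h0]
    exact (contDiffOn_chartTrans ψ φ).contDiffAt ((isOpen_transDom ψ φ).mem_nhds hw)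
  have h2 := (contDiff_poly_right (canon w)).contDiffAt (x := (0 : Fin n → ℝ))
  have h12 : ContDiffAt ℝ ∞ (fun t => chartTrans ψ φ (poly (canon w) t)) 0 := h1.comp 0 h2
  rw [jetTrans, get_jetOf_singleton hs h12]
  have h3 := (h1.differentiableAt (by simp)).hasFDerivAt.comp 0
    (h2.differentiableAt (by simp)).hasFDerivAt
  have h4 : fderiv ℝ (fun t => chartTrans ψ φ (poly (canon w) t)) 0 = _ := h3.fderiv
  rw [h4, ContinuousLinearMap.comp_apply, fderiv_poly_canon hs, h0]

/-- The matrix `(D_j x̄^i)`. -/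
def jacMat (ψ φ : XChart n m X) (w : PCoord n m s) : Matrix (Fin n) (Fin n) ℝ :=
  Matrix.of fun i j => fderiv ℝ (chartTrans ψ φ) (hor w) (frame w j) (Fin.castAdd m i)

theorem xMat_jetTrans_canon (hs : 1 ≤ s) {ψ φ : XChart n m X} {w : PCoord n m s}
    (hw : hor w ∈ transDom ψ φ) : xMat (jetTrans ψ φ (canon w)) = jacMat ψ φ w := by
  ext i j
  exact get_jetTrans_canon hs hw _ _

theorem det_jacMat_ne_zero (hs : 1 ≤ s) {ψ φ : XChart n m X} {w : PCoord n m s}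
    (hw : w ∈ grTransDom s ψ φ) : (jacMat ψ φ w).det ≠ 0 := by
  rw [← xMat_jetTrans_canon hs hw.1]
  exact hw.2

/-- The direction of `D_j` projects to the frame vector `∂/∂x^j + y^σ_j ∂/∂x^σ`. The two matrices
are transposes of each other. -/
theorem jac_eq (hs : 1 ≤ s) {ψ φ : XChart n m X} {c : GrassmannManifold n m s X}
    (hw : c.coord ψ ∈ grTransDom s ψ φ) : jac ψ φ c = (jacMat ψ φ (c.coord ψ)).det := by
  rw [jac, ← Matrix.det_transpose]
  congr 1
  ext i j
  simp only [Matrix.transpose_apply, Matrix.of_apply, jacMat, totalD]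
  rw [fderiv_xBar hs hw]
  refine congrArg (fun u => fderiv ℝ (chartTrans ψ φ) (hor (c.coord ψ)) u (Fin.castAdd m i)) ?_
  ext A
  induction A using Fin.addCases with
  | left k => simp [frame_castAdd hs]
  | right σ =>
    rw [frame_natAdd]
    simp [MultiIndex.empty]

/-- The change of charts maps contact elements to contact elements. -/
theorem fderiv_chartTrans_frame (hs : 1 ≤ s) {ψ φ : XChart n m X} {w : PCoord n m s}
    (hw : w ∈ grTransDom s ψ φ) (j : Fin n) :
    fderiv ℝ (chartTrans ψ φ) (hor w) (frame w j) =
      ∑ i, jacMat ψ φ w i j • frame (grTrans ψ φ w) i := by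
  ext A
  induction A using Fin.addCases with
  | left k => simp [frame_castAdd hs, jacMat]
  | right σ =>
    rw [← get_jetTrans_canon hs hw.1, get_natAdd_eq_sum hw.2, xMat_jetTrans_canon hs hw.1]
    simp [frame_natAdd, grTrans, get_pc hs, mul_comm]

/-- The unit vector of the coordinate `x^A`. -/
theorem val_single (A : Fin (n + m)) :
    val (Pi.single (A, MultiIndex.empty n s) 1 : TCoord n m s) = EuclideanSpace.single A 1 := by
  ext B
  simp [Pi.single_apply]

theorem form_apply_eq {𝒯 : (ImmT.charts n m s X).DForm 1} (h : IsDifferentialEquation 𝒯)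
    {ψ : XChart n m X} {p : ImmT n m s X} (hp : p.target ∈ ψ.1.source) (v : TCoord n m s) :
    𝒯.1 ψ (p.coord ψ) (fun _ => v) = ∑ A, component 𝒯 ψ A p * val v A := h ψ p hp v

/-- The derivative of the action preserves the order-zero part of a tangent vector, so equivariance
of the form becomes scaling of each component. -/
theorem component_act (hs : 1 ≤ s) {𝒯 : (ImmT.charts n m s X).DForm 1} (h : IsHomogeneous 𝒯)
    {ψ : XChart n m X} {p : ImmT n m s X} (hp : p ∈ W s ψ) (a : DiffGroup n s)
    (A : Fin (n + m)) : component 𝒯 ψ A (p.act a) = a.det * component 𝒯 ψ A p := by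
  obtain ⟨α, rfl⟩ := a.exists_mk_eq
  have hpa : (p.act (DiffGroup.mk s α)).target ∈ ψ.1.source := by
    rw [target_act]
    exact hp.1
  have h1 := h.equivariant (DiffGroup.mk s α) ψ ψ p hp.1 hpa
  have h2 := congrArg
    (fun η => η (fun _ => (Pi.single (A, MultiIndex.empty n s) 1 : TCoord n m s))) h1
  simp only [ChartSystem.pullbackAt] at h2
  rw [(expr_act_eventuallyEq hs hp α).fderiv_eq, ContinuousLinearMap.fderiv] at h2
  have h3 := form_apply_eq h.isDifferentialEquation hpa
    (reparam α (Pi.single (A, MultiIndex.empty n s) 1 : TCoord n m s))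
  rw [val_reparam, val_single] at h3
  simp only [PiLp.single_apply, mul_ite, mul_one, mul_zero, Finset.sum_ite_eq',
    Finset.mem_univ, if_true] at h3
  rw [← h3]
  exact h2

/-- `𝒯_A x^A_j = 0`. -/
theorem sum_component_mul_get (hs : 1 ≤ s) {𝒯 : (ImmT.charts n m s X).DForm 1}
    (h : IsHomogeneous 𝒯) {ψ : XChart n m X} {p : ImmT n m s X} (hp : p.target ∈ ψ.1.source)
    (j : Fin n) : ∑ A, component 𝒯 ψ A p * (p.coord ψ).get A {j} = 0 := by
  have hp' := hp
  obtain ⟨γ, rfl⟩ := exists_velocity_eq p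
  have h1 := congrArg (fun η => η (fun _ => Pi.single j 1))
    (h.pullback_jet γ ψ 0 γ.zero_mem hp)
  have hc := contDiffAt_chart γ ψ hp
  have h2 : jetCoords s ψ γ = jetOf s (fun t => ψ.1 (γ.toFun t)) := rfl
  have h3 := form_apply_eq h.isDifferentialEquation hp'
    (fderiv ℝ (jetOf s (fun t => ψ.1 (γ.toFun t))) 0 (Pi.single j 1))
  -- The prolongation covers the immersion itself, so its order-zero velocity is `x^A_j`.
  have h4 : val (fderiv ℝ (jetOf s (fun t => ψ.1 (γ.toFun t))) 0 (Pi.single j 1)) =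
      fderiv ℝ (fun t => ψ.1 (γ.toFun t)) 0 (Pi.single j 1) := by
    have h5 := (val (n := n) (m := m) (s := s)).hasFDerivAt.comp 0
      (hasFDerivAt_jetOf (s := s) hc).differentiableAt.hasFDerivAt
    have h6 : val ∘ jetOf s (fun t => ψ.1 (γ.toFun t)) = fun t => ψ.1 (γ.toFun t) :=
      funext fun t => val_jetOf _ t
    rw [h6] at h5
    rw [h5.fderiv]
    rfl
  rw [h4] at h3
  rw [coord_velocity hp] at h3 ⊢
  simp only [get_jetOf_singleton hs hc]
  rw [← h3]
  rw [h2] at h1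
  exact h1

/-- The equation vanishes on contact elements, so its components `𝒯_i` are determined by the
`𝒯_σ`. -/
theorem component_castAdd (hs : 1 ≤ s) {𝒯 : (ImmT.charts n m s X).DForm 1}
    (h : IsHomogeneous 𝒯) {ψ : XChart n m X} {p : ImmT n m s X} (hp : p ∈ W s ψ) (i : Fin n) :
    component 𝒯 ψ (Fin.castAdd m i) p =
      -∑ σ, yFun σ [i] (p.coord ψ) * component 𝒯 ψ (Fin.natAdd n σ) p := by
  set M := xMat (p.coord ψ)
  -- Substitution of `x^σ_j = y^σ_k x^k_j` in `𝒯_A x^A_j = 0` shows that the row vector `𝒯_k + y^σ_k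
  -- 𝒯_σ` is annihilated by `(x^k_j)`.
  have h1 : Matrix.vecMul (fun k => component 𝒯 ψ (Fin.castAdd m k) p +
      ∑ σ, yFun σ [k] (p.coord ψ) * component 𝒯 ψ (Fin.natAdd n σ) p) M = 0 := by
    funext j
    have h2 := sum_component_mul_get hs h hp.1 j
    rw [Fin.sum_univ_add] at h2
    simp only [get_natAdd_eq_sum hp.2] at h2
    rw [Pi.zero_apply, ← h2]
    simp only [Matrix.vecMul, dotProduct, add_mul, Finset.sum_add_distrib, Finset.sum_mul,
      Finset.mul_sum]
    congr 1
    rw [Finset.sum_comm]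
    exact Finset.sum_congr rfl fun σ _ => Finset.sum_congr rfl fun k _ => by ring
  have h3 := congrFun (Matrix.eq_zero_of_vecMul_eq_zero hp.2 h1) i
  exact eq_neg_of_add_eq_zero_left h3

/-- Numerator and denominator of `𝒯_σ / det(x)` acquire the same factor `det(a)`, so the quotient is
a function on `ρ(W)`. -/
theorem exists_isLocalForm (hs : 1 ≤ s) {𝒯 : (ImmT.charts n m s X).DForm 1}
    (h : IsHomogeneous 𝒯) (ψ : XChart n m X) :
    ∃ T : Fin m → GrassmannManifold n m s X → ℝ, IsLocalForm 𝒯 ψ T := by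
  classical
  let f : ImmT n m s X → Fin m → ℝ := fun p σ =>
    component 𝒯 ψ (Fin.natAdd n σ) p / (xMat (p.coord ψ)).det
  have hf : ∀ p ∈ W s ψ, ∀ a, f (p.act a) = f p := by
    intro p hp a
    funext σ
    simp only [f]
    rw [component_act hs h hp, det_xMat_act hs hp.1, mul_comm, mul_div_mul_right]
    exact DiffGroup.det_ne_zero hs a
  let T : Fin m → GrassmannManifold n m s X → ℝ := fun σ c =>
    if hc : ∃ p ∈ W s ψ, rho p = c then f hc.choose σ else 0
  have hT : ∀ p ∈ W s ψ, ∀ σ, T σ (rho p) = f p σ := by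
    intro p hp σ
    have hc : ∃ p' ∈ W s ψ, rho p' = rho p := ⟨p, hp, rfl⟩
    simp only [T, dif_pos hc]
    exact congrFun (mem_W_and_eq_of_rho_eq hs hf hc.choose_spec.2.symm hp).2 σ
  refine ⟨T, fun σ => ?_, fun p hp => ?_⟩
  · rw [range_grassmann hs]
    -- On graph velocities the denominator is `1`, so the coordinate expression of `T_σ` is `𝒯_σ ∘
    -- canon`.
    have h1 : ContDiffOn ℝ ∞ (fun w : PCoord n m s => 𝒯.1 ψ (canon w)
        (fun _ => Pi.single (Fin.natAdd n σ, MultiIndex.empty n s) 1)) (grDom s ψ) := by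
      have h2 : ContDiffOn ℝ ∞ (fun w : PCoord n m s => 𝒯.1 ψ (canon w)) (grDom s ψ) :=
        (𝒯.2.1 ψ).comp contDiff_canon.contDiffOn fun w hw =>
          ⟨graphVel hs ψ w hw, (graphVel_mem_W hs hw).1, coord_graphVel hs hw⟩
      exact (ContinuousAlternatingMap.apply ℝ (TCoord n m s) ℝ
        (fun _ : Fin 1 => Pi.single (Fin.natAdd n σ, MultiIndex.empty n s) 1)).contDiff.comp_contDiffOn
          h2
    refine h1.congr fun w hw => ?_
    rw [expr_grassmann hs _ hw, hT _ (graphVel_mem_W hs hw)]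
    simp only [f, component, coord_graphVel, xMat_canon hs, Matrix.det_one, div_one]
  · have h1 : ∀ σ, component 𝒯 ψ (Fin.natAdd n σ) p =
        (xMat (p.coord ψ)).det * T σ (rho p) := by
      intro σ
      rw [hT p hp]
      exact (mul_div_cancel₀ _ hp.2).symm
    refine ⟨h1, fun i => ?_⟩
    rw [component_castAdd hs h hp, neg_mul, Finset.mul_sum]
    congr 1
    refine Finset.sum_congr rfl fun σ _ => ?_
    rw [h1]
    ring

/-- `𝒯 = det(x) T_σ ω^σ` on `W`. -/
theorem IsLocalForm.form_apply (hs : 1 ≤ s) {𝒯 : (ImmT.charts n m s X).DForm 1}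
    {ψ : XChart n m X} {T : Fin m → GrassmannManifold n m s X → ℝ} (hT : IsLocalForm 𝒯 ψ T)
    {p : ImmT n m s X} (hp : p ∈ W s ψ) (u : Model n m) :
    ∑ A, component 𝒯 ψ A p * u A =
      (xMat (p.coord ψ)).det * ∑ σ, T σ (rho p) * contact σ ((rho p).coord ψ) u := by
  obtain ⟨h1, h2⟩ := hT.2 p hp
  rw [Fin.sum_univ_add]
  simp only [h1, h2, contact_apply, coord_rho hs hp, get_pc hs, mul_sub, Finset.sum_sub_distrib,
    Finset.mul_sum, neg_mul, Finset.sum_mul]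
  rw [add_comm, sub_eq_add_neg]
  congr 1
  · exact Finset.sum_congr rfl fun σ _ => by ring
  · rw [Finset.sum_comm, ← Finset.sum_neg_distrib]
    refine Finset.sum_congr rfl fun σ _ => ?_
    rw [← Finset.sum_neg_distrib]
    exact Finset.sum_congr rfl fun i _ => by ring

/-- The forms `T_σ ω^σ` of two charts differ by the factor `𝒥`. -/
theorem IsLocalForm.sum_contact_eq (hs : 1 ≤ s) {𝒯 : (ImmT.charts n m s X).DForm 1}
    (h : IsHomogeneous 𝒯) {ψ φ : XChart n m X} {T T' : Fin m → GrassmannManifold n m s X → ℝ}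
    (hT : IsLocalForm 𝒯 ψ T) (hT' : IsLocalForm 𝒯 φ T') {c : GrassmannManifold n m s X}
    (hψ : c ∈ rho '' W s ψ) (hφ : c ∈ rho '' W s φ) (u : Model n m) :
    ∑ σ, T σ c * contact σ (c.coord ψ) u =
      (jacMat ψ φ (c.coord ψ)).det * ∑ ν, T' ν c * contact ν (c.coord φ)
        (fderiv ℝ (chartTrans ψ φ) (hor (c.coord ψ)) u) := by
  have hw := coord_mem_grTransDom hs hψ hφ
  -- At this representative `det(x)` is `1` in `ψ` and equals `𝒥` in `φ`, so the factor comes from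
  -- the choice of the velocity.
  obtain ⟨p, hp⟩ : ∃ p, p = graphVel hs ψ (c.coord ψ) (coord_mem_grDom hs hψ) := ⟨_, rfl⟩
  have hpc : rho p = c := hp ▸ rho_graphVel_coord hs hψ
  have hpψ : p ∈ W s ψ := hp ▸ graphVel_mem_W hs _
  have hpφ : p ∈ W s φ := hp ▸ graphVel_mem_W_trans hs hw
  have hcψ : p.coord ψ = canon (c.coord ψ) := hp ▸ coord_graphVel hs _
  have hcφ : p.coord φ = jetTrans ψ φ (canon (c.coord ψ)) := hp ▸ coord_graphVel_trans hs hw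
  have h1 := hT.form_apply hs hpψ u
  have h2 := hT'.form_apply hs hpφ (fderiv ℝ (chartTrans ψ φ) (hor (c.coord ψ)) u)
  rw [hcψ, xMat_canon hs, Matrix.det_one, one_mul, hpc] at h1
  rw [hcφ, xMat_jetTrans_canon hs hw.1, hpc] at h2
  rw [← h1, ← h2]
  obtain ⟨v, rfl⟩ : ∃ v : TCoord n m s, val v = u := by
    refine ⟨fun AJ => u AJ.1, ?_⟩
    ext A
    rfl
  rw [← form_apply_eq h.isDifferentialEquation hpψ.1]
  have h3 := 𝒯.2.2.2 ψ φ p ⟨hpψ.1, hpφ.1⟩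
  have h4 := congrArg (fun η => η (fun _ => v)) h3
  simp only [ChartSystem.pullbackAt] at h4
  have h5 := form_apply_eq h.isDifferentialEquation hpφ.1
    (fderiv ℝ ((ImmT.charts n m s X).expr ψ (fun p' => p'.coord φ)) (p.coord ψ) v)
  rw [val_fderiv_expr_coord hs hpψ hpφ.1, hcψ, val_canon] at h5
  rw [← h5, ← hcψ]
  exact h4

/-- On the coordinate vector `∂/∂y^σ` the form `ω^σ'` is a Kronecker delta, and the pulled-back
`ω̄^ν` is by definition `P^ν_σ`. -/
theorem IsLocalForm.eq_jac_mul_sum (hs : 1 ≤ s) {𝒯 : (ImmT.charts n m s X).DForm 1}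
    (h : IsHomogeneous 𝒯) {ψ φ : XChart n m X} {T T' : Fin m → GrassmannManifold n m s X → ℝ}
    (hT : IsLocalForm 𝒯 ψ T) (hT' : IsLocalForm 𝒯 φ T') {c : GrassmannManifold n m s X}
    (hc : c ∈ rho '' (W s ψ ∩ W s φ)) (σ : Fin m) :
    T σ c = jac ψ φ c * ∑ ν, pMat ψ φ c ν σ * T' ν c := by
  obtain ⟨hψ, hφ⟩ := (mem_image_inter_iff hs).1 hc
  have hw := coord_mem_grTransDom hs hψ hφ
  have h1 := hT.sum_contact_eq hs h hT' hψ hφ (EuclideanSpace.single (Fin.natAdd n σ) 1)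
  have hne : ∀ i : Fin n, Fin.castAdd m i ≠ Fin.natAdd n σ := fun i h => by
    have := congrArg Fin.val h
    simp at this
    omega
  have h2 : ∀ σ', contact σ' (c.coord ψ) (EuclideanSpace.single (Fin.natAdd n σ) (1 : ℝ)) =
      if σ' = σ then 1 else 0 := by
    intro σ'
    simp [contact_apply, hne]
  simp only [h2, mul_ite, mul_one, mul_zero, Finset.sum_ite_eq', Finset.mem_univ, if_true] at h1
  rw [h1, jac_eq hs hw]
  congr 1
  refine Finset.sum_congr rfl fun ν _ => ?_
  have h3 : hor (Pi.single (Sum.inr (σ, MultiIndex.empty n s)) 1 : PCoord n m s) =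
      EuclideanSpace.single (Fin.natAdd n σ) (1 : ℝ) := by
    ext A
    induction A using Fin.addCases with
    | left i => simp [hne]
    | right ν => simp [Pi.single_apply]
  rw [pMat, mul_comm, contact_apply]
  simp only [deltaD, fderiv_xBar hs hw, fderiv_yBar hs hw, h3]

end Components

/-! ### Exterior algebra -/

section Wedge

variable {E : Type*} [NormedAddCommGroup E] [NormedSpace ℝ E] {q : ℕ}

theorem wedge_apply (α : E →L[ℝ] ℝ) (β : E [⋀^Fin q]→L[ℝ] ℝ) (v : Fin (q + 1) → E) :
    wedge α β v = ∑ k : Fin (q + 1), (-1) ^ (k : ℕ) * (α (v k) * β (k.removeNth v)) := by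
  rw [wedge, ContinuousAlternatingMap.alternatizeUncurryFin_apply]
  refine Finset.sum_congr rfl fun k _ => ?_
  simp

theorem wedge_add (α : E →L[ℝ] ℝ) (β β' : E [⋀^Fin q]→L[ℝ] ℝ) :
    wedge α (β + β') = wedge α β + wedge α β' := by
  ext v
  simp only [wedge_apply, ContinuousAlternatingMap.add_apply, ← Finset.sum_add_distrib]
  exact Finset.sum_congr rfl fun k _ => by ring

theorem add_wedge (α α' : E →L[ℝ] ℝ) (β : E [⋀^Fin q]→L[ℝ] ℝ) :
    wedge (α + α') β = wedge α β + wedge α' β := by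
  ext v
  simp only [wedge_apply, ContinuousAlternatingMap.add_apply, ← Finset.sum_add_distrib,
    _root_.add_apply]
  exact Finset.sum_congr rfl fun k _ => by ring

theorem smul_wedge (r : ℝ) (α : E →L[ℝ] ℝ) (β : E [⋀^Fin q]→L[ℝ] ℝ) :
    wedge (r • α) β = r • wedge α β := by
  ext v
  simp only [wedge_apply, ContinuousAlternatingMap.smul_apply, smul_eq_mul, Finset.mul_sum,
    _root_.smul_apply]
  exact Finset.sum_congr rfl fun k _ => by ring

theorem wedge_smul (r : ℝ) (α : E →L[ℝ] ℝ) (β : E [⋀^Fin q]→L[ℝ] ℝ) :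
    wedge α (r • β) = r • wedge α β := by
  ext v
  simp only [wedge_apply, ContinuousAlternatingMap.smul_apply, smul_eq_mul, Finset.mul_sum]
  exact Finset.sum_congr rfl fun k _ => by ring

theorem zero_wedge (β : E [⋀^Fin q]→L[ℝ] ℝ) : wedge (0 : E →L[ℝ] ℝ) β = 0 := by
  simpa using smul_wedge 0 (0 : E →L[ℝ] ℝ) β

theorem wedge_zero (α : E →L[ℝ] ℝ) : wedge α (0 : E [⋀^Fin q]→L[ℝ] ℝ) = 0 := by
  simpa using wedge_smul 0 α (0 : E [⋀^Fin q]→L[ℝ] ℝ)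

theorem wedge_neg (α : E →L[ℝ] ℝ) (β : E [⋀^Fin q]→L[ℝ] ℝ) : wedge α (-β) = -wedge α β := by
  ext v
  simp [wedge_apply]

theorem wedge_sub (α : E →L[ℝ] ℝ) (β β' : E [⋀^Fin q]→L[ℝ] ℝ) :
    wedge α (β - β') = wedge α β - wedge α β' := by
  rw [sub_eq_add_neg, wedge_add, wedge_neg, sub_eq_add_neg]

theorem sum_wedge {ι : Type*} (S : Finset ι) (α : ι → E →L[ℝ] ℝ) (β : E [⋀^Fin q]→L[ℝ] ℝ) :
    wedge (∑ i ∈ S, α i) β = ∑ i ∈ S, wedge (α i) β :=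
  map_sum (⟨⟨fun α => wedge α β, zero_wedge β⟩, fun a b => add_wedge a b β⟩ :
    (E →L[ℝ] ℝ) →+ E [⋀^Fin (q + 1)]→L[ℝ] ℝ) α S

theorem wedge_sum {ι : Type*} (S : Finset ι) (α : E →L[ℝ] ℝ) (β : ι → E [⋀^Fin q]→L[ℝ] ℝ) :
    wedge α (∑ i ∈ S, β i) = ∑ i ∈ S, wedge α (β i) :=
  map_sum (⟨⟨fun β => wedge α β, wedge_zero α⟩, wedge_add α⟩ :
    E [⋀^Fin q]→L[ℝ] ℝ →+ E [⋀^Fin (q + 1)]→L[ℝ] ℝ) β S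

/-- Grouping the double alternating sum by pairs of arguments leaves `a(v)b(v') - a(v')b(v)` as the
only dependence on the two forms, which is antisymmetric in them. -/
theorem wedge_anticomm (α α' : E →L[ℝ] ℝ) (β : E [⋀^Fin q]→L[ℝ] ℝ) :
    wedge α (wedge α' β) = -wedge α' (wedge α β) := by
  have h : ∀ (a b : E →L[ℝ] ℝ) (v : Fin (q + 2) → E), wedge a (wedge b β) v =
      ∑ (i : Fin (q + 1)), ∑ j ≥ i, (-1 : ℤ) ^ (i + j : ℕ) •
        ((a (v i.castSucc) * b (v j.succ) - a (v j.succ) * b (v i.castSucc)) *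
          β (j.removeNth <| i.castSucc.removeNth v)) := by
    intro a b v
    have h1 := ContinuousAlternatingMap.alternatizeUncurryFin_alternatizeUncurryFinCLM_comp_apply
      (a.smulRight (b.smulRight β)) v
    have h2 : wedge a (wedge b β) = ContinuousAlternatingMap.alternatizeUncurryFin
        ((ContinuousAlternatingMap.alternatizeUncurryFinCLM ℝ E ℝ).comp
          (a.smulRight (b.smulRight β))) := by
      unfold wedge
      congr 1
      ext x v
      simp
    rw [h2, h1]
    refine Finset.sum_congr rfl fun i _ => Finset.sum_congr rfl fun j _ => ?_
    congr 1
    simp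
    ring
  ext v
  rw [ContinuousAlternatingMap.neg_apply, h, h, ← Finset.sum_neg_distrib]
  refine Finset.sum_congr rfl fun i _ => ?_
  rw [← Finset.sum_neg_distrib]
  refine Finset.sum_congr rfl fun j _ => ?_
  rw [← smul_neg]
  congr 1
  ring

/-- The recursive definition is expansion along the first row. Multiplicativity of determinants then
gives the change of coframe in `wedgeAll_sum_smul`. -/
theorem wedgeAll_apply (α : Fin q → E →L[ℝ] ℝ) (v : Fin q → E) :
    wedgeAll q α v = (Matrix.of fun i j => α i (v j)).det := by
  induction q with
  | zero => simp [wedgeAll]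
  | succ q ih =>
    rw [wedgeAll, wedge_apply, Matrix.det_succ_row_zero]
    refine Finset.sum_congr rfl fun k _ => ?_
    rw [ih, Matrix.of_apply, mul_assoc]
    rfl

variable {E' : Type*} [NormedAddCommGroup E'] [NormedSpace ℝ E']

theorem wedge_comp (α : E →L[ℝ] ℝ) (β : E [⋀^Fin q]→L[ℝ] ℝ) (f : E' →L[ℝ] E) :
    (wedge α β).compContinuousLinearMap f =
      wedge (α.comp f) (β.compContinuousLinearMap f) := by
  ext v
  simp only [ContinuousAlternatingMap.compContinuousLinearMap_apply, wedge_apply]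
  rfl

theorem wedgeAll_comp (α : Fin q → E →L[ℝ] ℝ) (f : E' →L[ℝ] E) :
    (wedgeAll q α).compContinuousLinearMap f = wedgeAll q fun i => (α i).comp f := by
  ext v
  simp only [ContinuousAlternatingMap.compContinuousLinearMap_apply, wedgeAll_apply]
  rfl

theorem wedgeAll_sum_smul (M : Matrix (Fin q) (Fin q) ℝ) (α : Fin q → E →L[ℝ] ℝ) :
    (wedgeAll q fun i => ∑ j, M i j • α j) = M.det • wedgeAll q α := by
  ext v
  rw [ContinuousAlternatingMap.smul_apply, wedgeAll_apply, wedgeAll_apply, smul_eq_mul,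
    ← Matrix.det_mul]
  congr 1
  ext i j
  simp [Matrix.mul_apply]

theorem contDiffOn_wedge {P : Type*} [NormedAddCommGroup P] [NormedSpace ℝ P] {D : Set P}
    {α : P → E →L[ℝ] ℝ} {β : P → E [⋀^Fin q]→L[ℝ] ℝ} (hα : ContDiffOn ℝ ∞ α D)
    (hβ : ContDiffOn ℝ ∞ β D) : ContDiffOn ℝ ∞ (fun p => wedge (α p) (β p)) D := by
  have h := ContinuousLinearMap.contDiff (n := ∞) (𝕜 := ℝ) (E := E →L[ℝ] E [⋀^Fin q]→L[ℝ] ℝ)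
    (F := E [⋀^Fin (q + 1)]→L[ℝ] ℝ) (ContinuousAlternatingMap.alternatizeUncurryFinCLM ℝ E ℝ)
  exact h.comp_contDiffOn (hα.smulRight hβ)

theorem contDiffOn_wedgeAll {P : Type*} [NormedAddCommGroup P] [NormedSpace ℝ P] {D : Set P}
    {α : Fin q → P → E →L[ℝ] ℝ} (hα : ∀ i, ContDiffOn ℝ ∞ (α i) D) :
    ContDiffOn ℝ ∞ (fun p => wedgeAll q fun i => α i p) D := by
  induction q with
  | zero => exact contDiffOn_const
  | succ q ih => exact contDiffOn_wedge (hα 0) (ih fun i => hα i.succ)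

end Wedge

/-! ### Contact powers -/

section ContactPow

variable {n m s : ℕ} {D : Set (PCoord n m s)} {k q : ℕ}
  {β : PCoord n m s → PCoord n m s [⋀^Fin q]→L[ℝ] ℝ}

theorem IsContactPow.sum {ι : Type*} (S : Finset ι)
    {β : ι → PCoord n m s → PCoord n m s [⋀^Fin q]→L[ℝ] ℝ}
    (h : ∀ i, IsContactPow D k q (β i)) : IsContactPow D k q (∑ i ∈ S, β i) := by
  classical
  induction S using Finset.induction_on with
  | empty => simpa using IsContactPow.zero
  | insert i S hi ih =>
    rw [Finset.sum_insert hi]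
    exact IsContactPow.add _ _ (h i) ih

theorem IsContactPow.smul (h : IsContactPow D k q β) {f : PCoord n m s → ℝ}
    (hf : ContDiffOn ℝ ∞ f D) : IsContactPow D k q (fun w => f w • β w) := by
  induction h with
  | smooth β hβ => exact IsContactPow.smooth _ (hf.smul hβ)
  | omega_wedge σ J hJ β _ ih =>
    simp only [← wedge_smul]
    exact IsContactPow.omega_wedge σ J hJ _ ih
  | dOmega_wedge σ I hI β _ ih =>
    have : (fun w => f w • dOmegaWedge σ I (β w)) = fun w => dOmegaWedge σ I (f w • β w) := by
      funext w
      simp only [dOmegaWedge, wedge_smul, ← Finset.smul_sum, smul_neg]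
    rw [this]
    exact IsContactPow.dOmega_wedge σ I hI _ ih
  | zero =>
    refine IsContactPow.congr _ _ IsContactPow.zero fun w _ => ?_
    simp
  | add β β' _ _ ih ih' =>
    refine IsContactPow.congr _ _ (IsContactPow.add _ _ ih ih') fun w _ => ?_
    simp
  | neg β _ ih =>
    refine IsContactPow.congr _ _ (IsContactPow.neg _ ih) fun w _ => ?_
    simp
  | congr β β' _ h ih =>
    refine IsContactPow.congr _ _ ih fun w hw => ?_
    simp only [h hw]

/-- Contact factors stand in front by definition, so a new `1`-form has to be moved past them: past
`ω^σ_J` with a sign, past the `2`-form `dω^σ_I` without one. -/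
theorem IsContactPow.wedge_left (h : IsContactPow D k q β)
    {ξ : PCoord n m s → PCoord n m s →L[ℝ] ℝ} (hξ : ContDiffOn ℝ ∞ ξ D) :
    IsContactPow D k (q + 1) (fun w => wedge (ξ w) (β w)) := by
  induction h with
  | smooth β hβ => exact IsContactPow.smooth _ (contDiffOn_wedge hξ hβ)
  | omega_wedge σ J hJ β _ ih =>
    refine IsContactPow.congr _ _ (IsContactPow.neg _ (IsContactPow.omega_wedge σ J hJ _ ih))
      fun w _ => ?_
    exact wedge_anticomm _ _ _
  | dOmega_wedge σ I hI β _ ih =>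
    refine IsContactPow.congr _ _ (IsContactPow.dOmega_wedge σ I hI _ ih) fun w _ => ?_
    simp only [dOmegaWedge, wedge_neg, wedge_sum]
    congr 1
    refine Finset.sum_congr rfl fun i _ => ?_
    rw [wedge_anticomm (ξ w), wedge_anticomm (ξ w), wedge_neg, neg_neg]
  | zero =>
    refine IsContactPow.congr _ _ IsContactPow.zero fun w _ => ?_
    simp [wedge_zero]
  | add β β' _ _ ih ih' =>
    refine IsContactPow.congr _ _ (IsContactPow.add _ _ ih ih') fun w _ => ?_
    simp [wedge_add]
  | neg β _ ih =>
    refine IsContactPow.congr _ _ (IsContactPow.neg _ ih) fun w _ => ?_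
    simp [wedge_neg]
  | congr β β' _ h ih =>
    refine IsContactPow.congr _ _ ih fun w hw => ?_
    simp only [h hw]

theorem contDiff_omega_zero (σ : Fin m) :
    ContDiff ℝ ∞ (omega σ 0 : PCoord n m s → PCoord n m s →L[ℝ] ℝ) := by
  unfold omega
  refine contDiff_const.sub (ContDiff.sum fun i _ => ?_)
  refine ContDiff.smul (f := fun w : PCoord n m s => w.get σ (i ::ₘ 0)) (g := fun _ => dX i)
    ?_ contDiff_const
  unfold PCoord.get
  split_ifs
  · fun_prop
  · exact contDiff_const

/-- Changing the factors of a product of `1`-forms by combinations of the forms `ω^σ`. -/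
theorem isContactPow_wedgeAll_sub (hs : 1 ≤ s) {ξ : Fin q → PCoord n m s → PCoord n m s →L[ℝ] ℝ}
    (hξ : ∀ i, ContDiffOn ℝ ∞ (ξ i) D) {h : Fin q → Fin m → PCoord n m s → ℝ}
    (hh : ∀ i σ, ContDiffOn ℝ ∞ (h i σ) D) :
    IsContactPow D 1 q (fun w =>
      (wedgeAll q fun i => ξ i w + ∑ σ, h i σ w • omega σ 0 w) - wedgeAll q fun i => ξ i w) := by
  induction q with
  | zero =>
    refine IsContactPow.congr _ _ IsContactPow.zero fun w _ => ?_
    simp [wedgeAll]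
  | succ q ih =>
    -- Telescoping: if `B` and `A` are the products of the remaining factors with and without the
    -- corrections, the difference is `ξ_0 ∧ (B - A) + h_σ ω^σ ∧ B`.
    have h1 := (ih (fun i => hξ i.succ) (fun i => hh i.succ)).wedge_left (hξ 0)
    have hs1 : ContDiffOn ℝ ∞ (fun w => wedgeAll q fun i : Fin q =>
        ξ i.succ w + ∑ σ, h i.succ σ w • omega σ 0 w) D :=
      contDiffOn_wedgeAll (α := fun i w => ξ i.succ w + ∑ σ, h i.succ σ w • omega σ 0 w)
        fun i => (hξ i.succ).add (ContDiffOn.sum fun σ _ =>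
          (hh i.succ σ).smul (contDiff_omega_zero σ).contDiffOn)
    have h2 : IsContactPow D 1 (q + 1) (∑ σ, fun w => wedge (omega σ 0 w) (h 0 σ w •
        wedgeAll q fun i : Fin q => ξ i.succ w + ∑ σ, h i.succ σ w • omega σ 0 w)) := by
      refine IsContactPow.sum _ fun σ => IsContactPow.omega_wedge σ 0 (by simpa using hs) _ ?_
      exact IsContactPow.smooth _ ((hh 0 σ).smul hs1)
    refine IsContactPow.congr _ _ (IsContactPow.add _ _ h1 h2) fun w _ => ?_
    simp only [wedgeAll, Pi.add_apply, Finset.sum_apply, wedge_sub, add_wedge, sum_wedge,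
      smul_wedge, wedge_smul]
    abel

end ContactPow

/-! ### Riemannian metrics -/

section Metric

variable {n m : ℕ} {X : Type u} [TopologicalSpace X]
  [ChartedSpace (EuclideanSpace ℝ (Fin (n + m))) X] [IsManifold (𝓡 (n + m)) ∞ X]

/-- The pull-back of the Euclidean scalar product by a linear map. -/
def pullInner (A : Model n m →L[ℝ] Model n m) : Model n m →L[ℝ] Model n m →L[ℝ] ℝ :=
  ((ContinuousLinearMap.compL ℝ (Model n m) (Model n m) ℝ).flip A).comp ((innerSL ℝ).comp A)

theorem pullInner_apply (A : Model n m →L[ℝ] Model n m) (u v : Model n m) :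
    pullInner A u v = inner ℝ (A u) (A v) := rfl

theorem contDiff_pullInner :
    ContDiff ℝ ∞ (pullInner : (Model n m →L[ℝ] Model n m) → _) :=
  (((ContinuousLinearMap.compL ℝ (Model n m) (Model n m) ℝ).flip.contDiff).clm_comp
    (contDiff_const.clm_comp contDiff_id))

/-- The preferred charts. -/
def chartOf (x : X) : XChart n m X := ⟨chartAt _ x, IsManifold.chart_mem_maximalAtlas x⟩

theorem chartTrans_eventuallyEq (ψ φ χ : XChart n m X) {e : Model n m} (he : e ∈ transDom ψ φ) :
    chartTrans ψ χ =ᶠ[𝓝 e] chartTrans φ χ ∘ chartTrans ψ φ := by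
  filter_upwards [(isOpen_transDom ψ φ).mem_nhds he] with e' he'
  simp only [chartTrans, Function.comp_apply]
  rw [φ.1.left_inv he'.2]

theorem fderiv_chartTrans_comp (ψ φ χ : XChart n m X) {e : Model n m} (he : e ∈ transDom ψ φ)
    (hχ : ψ.1.symm e ∈ χ.1.source) :
    fderiv ℝ (chartTrans ψ χ) e =
      (fderiv ℝ (chartTrans φ χ) (chartTrans ψ φ e)).comp (fderiv ℝ (chartTrans ψ φ) e) := by
  have h1 : chartTrans ψ φ e ∈ transDom φ χ := by
    refine ⟨φ.1.map_source he.2, ?_⟩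
    simp only [chartTrans, mem_preimage]
    rwa [φ.1.left_inv he.2]
  rw [(chartTrans_eventuallyEq ψ φ χ he).fderiv_eq]
  exact ((differentiableAt_chartTrans h1).hasFDerivAt.comp e
    (differentiableAt_chartTrans he).hasFDerivAt).fderiv

theorem fderiv_chartTrans_injective (ψ φ : XChart n m X) {e : Model n m}
    (he : e ∈ transDom ψ φ) : Function.Injective (fderiv ℝ (chartTrans ψ φ) e) := by
  have h1 := fderiv_chartTrans_comp ψ φ ψ he (ψ.1.map_target he.1)
  have h2 : chartTrans ψ ψ =ᶠ[𝓝 e] id := by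
    filter_upwards [ψ.1.open_target.mem_nhds he.1] with e' he'
    exact ψ.1.right_inv he'
  rw [h2.fderiv_eq, fderiv_id] at h1
  refine Function.LeftInverse.injective
    (g := fderiv ℝ (chartTrans φ ψ) (chartTrans ψ φ e)) fun v => ?_
  exact (congrArg (fun f => f v) h1).symm

/-- Local expressions of a Riemannian metric on `X`. -/
structure IsMetric (g : XChart n m X → Model n m → Model n m →L[ℝ] Model n m →L[ℝ] ℝ) :
    Prop where
  smooth : ∀ ψ, ContDiffOn ℝ ∞ (g ψ) ψ.1.target
  pos : ∀ ψ, ∀ e ∈ ψ.1.target, ∀ u, u ≠ 0 → 0 < g ψ e u u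
  trans : ∀ ψ φ, ∀ e ∈ transDom ψ φ, ∀ u v, g ψ e u v =
    g φ (chartTrans ψ φ e) (fderiv ℝ (chartTrans ψ φ) e u) (fderiv ℝ (chartTrans ψ φ) e v)

/-- Every manifold carries a Riemannian metric. -/
theorem exists_isMetric [T2Space X] [SecondCountableTopology X] :
    ∃ g : XChart n m X → Model n m → Model n m →L[ℝ] Model n m →L[ℝ] ℝ, IsMetric g := by
  have : LocallyCompactSpace X :=
    ChartedSpace.locallyCompactSpace (EuclideanSpace ℝ (Fin (n + m))) X
  have : SigmaCompactSpace X := inferInstance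
  obtain ⟨f, hf⟩ := SmoothPartitionOfUnity.exists_isSubordinate_chartAt_source (𝓡 (n + m)) X
  -- The Euclidean product of the chart around `i`, read in `ψ`. Outside the domain of that chart
  -- the value is meaningless, but there the weight `f i` vanishes.
  let B : XChart n m X → X → Model n m → Model n m →L[ℝ] Model n m →L[ℝ] ℝ := fun ψ i e =>
    pullInner (fderiv ℝ (chartTrans ψ (chartOf i)) e)
  let g : XChart n m X → Model n m → Model n m →L[ℝ] Model n m →L[ℝ] ℝ := fun ψ e =>
    ∑ᶠ i, f i (ψ.1.symm e) • B ψ i e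
  have hfin : ∀ (x : X), {i | f i x ≠ 0}.Finite := fun x => f.locallyFinite.point_finite x
  have hg : ∀ ψ e u v, g ψ e u v = ∑ᶠ i, f i (ψ.1.symm e) * B ψ i e u v := by
    intro ψ e u v
    have h1 : Function.HasFiniteSupport fun i => f i (ψ.1.symm e) • B ψ i e :=
      (hfin (ψ.1.symm e)).subset fun i hi h => hi (by
        simp only [h]
        ext u' v'
        exact zero_mul (B ψ i e u' v'))
    let ev : (Model n m →L[ℝ] Model n m →L[ℝ] ℝ) →L[ℝ] ℝ :=
      (ContinuousLinearMap.apply ℝ ℝ v).comp (ContinuousLinearMap.apply ℝ _ u)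
    exact map_finsum ev h1
  have hmem : ∀ i x, f i x ≠ 0 → x ∈ (chartOf (n := n) (m := m) i).1.source := fun i x hx =>
    hf i (subset_tsupport _ hx)
  refine ⟨g, fun ψ => ?_, fun ψ e he u hu => ?_, fun ψ φ e he u v => ?_⟩
  · have h1 : ∀ x ∈ ψ.1.source, ContMDiffAt (𝓡 (n + m))
        𝓘(ℝ, Model n m →L[ℝ] Model n m →L[ℝ] ℝ) ∞
        (fun x => ∑ᶠ i, f i x • B ψ i (ψ.1 x)) x := by
      intro x hx
      refine f.contMDiffAt_finsum fun i hi => ?_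
      have h2 : ψ.1 x ∈ transDom ψ (chartOf i) :=
        ⟨ψ.1.map_source hx, by
          rw [mem_preimage, ψ.1.left_inv hx]
          exact hf i hi⟩
      have h3 : ContDiffAt ℝ ∞ (B ψ i) (ψ.1 x) :=
        contDiff_pullInner.contDiffAt.comp (ψ.1 x)
          (((contDiffOn_chartTrans ψ (chartOf i)).contDiffAt
            ((isOpen_transDom _ _).mem_nhds h2)).fderiv_right (m := ∞) (by simp))
      exact h3.contMDiffAt.comp x (contMDiffAt_of_mem_maximalAtlas ψ.2 hx)
    have h4 : ContMDiffOn (𝓡 (n + m)) 𝓘(ℝ, Model n m →L[ℝ] Model n m →L[ℝ] ℝ) ∞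
        ((fun x => ∑ᶠ i, f i x • B ψ i (ψ.1 x)) ∘ ψ.1.symm) ψ.1.target := by
      intro e he
      exact (h1 _ (ψ.1.map_target he)).comp_contMDiffWithinAt e
        (contMDiffOn_symm_of_mem_maximalAtlas ψ.2 e he)
    refine h4.contDiffOn.congr fun e he => ?_
    simp only [g, Function.comp_apply, ψ.1.right_inv he]
  · rw [hg]
    refine finsum_pos (fun i => ?_) ?_ ?_
    · refine mul_nonneg (f.nonneg i _) ?_
      simp only [B, pullInner_apply]
      exact real_inner_self_nonneg
    · obtain ⟨i, hi⟩ := f.exists_pos_of_mem (mem_univ (ψ.1.symm e))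
      refine ⟨i, mul_pos hi ?_⟩
      simp only [B, pullInner_apply]
      refine real_inner_self_pos.2 fun h => hu ?_
      exact fderiv_chartTrans_injective ψ (chartOf i) ⟨he, hmem i _ hi.ne'⟩ (h.trans (map_zero _).symm)
    · exact (hfin (ψ.1.symm e)).subset fun i hi h => hi (by simp [h])
  · rw [hg, hg]
    refine finsum_congr fun i => ?_
    have h1 : φ.1.symm (chartTrans ψ φ e) = ψ.1.symm e := φ.1.left_inv he.2
    rw [h1]
    by_cases hi : f i (ψ.1.symm e) = 0
    · simp [hi]
    · simp only [B, pullInner_apply]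
      rw [fderiv_chartTrans_comp ψ φ (chartOf i) he (hmem i _ hi)]
      rfl

end Metric

/-! ### The global form -/

section GlobalForm

variable {n m s : ℕ} {X : Type u} [TopologicalSpace X]
  [ChartedSpace (EuclideanSpace ℝ (Fin (n + m))) X] [IsManifold (𝓡 (n + m)) ∞ X]
  {g : XChart n m X → Model n m → Model n m →L[ℝ] Model n m →L[ℝ] ℝ}

theorem contDiff_frame (j : Fin n) : ContDiff ℝ ∞ (fun w : PCoord n m s => frame w j) := by
  rw [contDiff_euclidean]
  intro A
  have : (fun w : PCoord n m s => frame w j A) = fun w => getCLM A {j} (canon w) := by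
    funext w
    rw [getCLM_apply]
    rfl
  rw [this]
  exact (ContinuousLinearMap.contDiff _).comp contDiff_canon

/-- The Gram matrix of the vectors spanning a contact element. -/
def gram (g : XChart n m X → Model n m → Model n m →L[ℝ] Model n m →L[ℝ] ℝ) (ψ : XChart n m X)
    (w : PCoord n m s) : Matrix (Fin n) (Fin n) ℝ :=
  Matrix.of fun i j => g ψ (hor w) (frame w i) (frame w j)

/-- The components of the orthogonal projection to a contact element. -/
def tanCoef (g : XChart n m X → Model n m → Model n m →L[ℝ] Model n m →L[ℝ] ℝ) (ψ : XChart n m X)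
    (w : PCoord n m s) (j : Fin n) : Model n m →L[ℝ] ℝ :=
  ∑ i, (gram g ψ w)⁻¹ j i • g ψ (hor w) (frame w i)

theorem tanCoef_apply (ψ : XChart n m X) (w : PCoord n m s) (j : Fin n) (u : Model n m) :
    tanCoef g ψ w j u = ((gram g ψ w)⁻¹.mulVec fun i => g ψ (hor w) (frame w i) u) j := by
  simp [tanCoef, Matrix.mulVec, dotProduct]

/-- A positive definite form is nondegenerate on the span of the frame, whose vectors are
independent because their first `n` components form the identity matrix. -/
theorem det_gram_ne_zero (hs : 1 ≤ s) (hg : IsMetric g) {ψ : XChart n m X} {w : PCoord n m s}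
    (hw : w ∈ grDom s ψ) : (gram g ψ w).det ≠ 0 := by
  intro h
  obtain ⟨v, hv, hv'⟩ := Matrix.exists_mulVec_eq_zero_iff.2 h
  set u : Model n m := ∑ j, v j • frame w j with hu
  have hu0 : u ≠ 0 := by
    intro h0
    refine hv (funext fun i => ?_)
    have := congrArg (fun e : Model n m => e (Fin.castAdd m i)) h0
    simpa [hu, frame_castAdd hs] using this
  have h1 : g ψ (hor w) u u = ∑ i, v i * ((gram g ψ w).mulVec v) i := by
    have h2 : ∀ x, g ψ (hor w) x u = ∑ j, v j * g ψ (hor w) x (frame w j) := by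
      intro x
      simp [hu]
    have h3 : ∀ y, g ψ (hor w) u y = ∑ i, v i * g ψ (hor w) (frame w i) y := by
      intro y
      simp [hu]
    rw [h3]
    refine Finset.sum_congr rfl fun i _ => ?_
    rw [h2]
    congr 1
    simp only [Matrix.mulVec, dotProduct, gram, Matrix.of_apply]
    exact Finset.sum_congr rfl fun j _ => mul_comm _ _
  have h2 := hg.pos ψ (hor w) hw u hu0
  rw [h1, hv'] at h2
  simp at h2

theorem tanCoef_frame (hs : 1 ≤ s) (hg : IsMetric g) {ψ : XChart n m X} {w : PCoord n m s}
    (hw : w ∈ grDom s ψ) (j k : Fin n) : tanCoef g ψ w j (frame w k) = if j = k then 1 else 0 := by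
  have h := Matrix.nonsing_inv_mul _ (isUnit_iff_ne_zero.2 (det_gram_ne_zero hs hg hw))
  have h1 := congrFun (congrFun h j) k
  rw [Matrix.one_apply] at h1
  rw [tanCoef_apply, ← h1]
  rfl

/-- The frame is dual to the `dx^j` and annihilated by the contact forms. A functional dual to the
frame can therefore differ from `dx^j` only by a combination of the contact forms. -/
theorem tanCoef_eq (hs : 1 ≤ s) (hg : IsMetric g) {ψ : XChart n m X} {w : PCoord n m s}
    (hw : w ∈ grDom s ψ) (j : Fin n) :
    tanCoef g ψ w j = modelCoord (Fin.castAdd m j) +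
      ∑ σ, tanCoef g ψ w j (EuclideanSpace.single (Fin.natAdd n σ) 1) • contact σ w := by
  ext u
  conv_lhs => rw [eq_sum_frame_add hs w u]
  simp only [map_add, map_sum, map_smul, tanCoef_frame hs hg hw, smul_eq_mul]
  simp [mul_comm]

theorem tanCoef_comp_hor (hs : 1 ≤ s) (hg : IsMetric g) {ψ : XChart n m X} {w : PCoord n m s}
    (hw : w ∈ grDom s ψ) (j : Fin n) :
    (tanCoef g ψ w j).comp hor = dX j +
      ∑ σ, tanCoef g ψ w j (EuclideanSpace.single (Fin.natAdd n σ) 1) • omega σ 0 w := by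
  ext v
  conv_lhs => rw [tanCoef_eq hs hg hw]
  simp [omega_zero_eq, dX]

theorem contDiffOn_tanCoef (hs : 1 ≤ s) (hg : IsMetric g) (ψ : XChart n m X) (j : Fin n)
    (u : Model n m) :
    ContDiffOn ℝ ∞ (fun w : PCoord n m s => tanCoef g ψ w j u) (grDom s ψ) := by
  have h1 : ContDiffOn ℝ ∞ (fun w : PCoord n m s => g ψ (hor w)) (grDom s ψ) :=
    (hg.smooth ψ).comp hor.contDiff.contDiffOn fun w hw => hw
  have h2 : ∀ i, ContDiffOn ℝ ∞ (fun w : PCoord n m s => g ψ (hor w) (frame w i)) (grDom s ψ) :=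
    fun i => h1.clm_apply (contDiff_frame i).contDiffOn
  simp only [tanCoef_apply, Matrix.mulVec, dotProduct]
  refine ContDiffOn.sum fun i _ => ContDiffOn.mul ?_ ((h2 i).clm_apply contDiffOn_const)
  exact contDiffOn_matrix_inv (fun a b => (h2 a).clm_apply (contDiff_frame b).contDiffOn)
    (fun w hw => det_gram_ne_zero hs hg hw) _ _

/-- The orthogonal projections of two charts are related by the Jacobi matrix. -/
theorem tanCoef_trans (hs : 1 ≤ s) (hg : IsMetric g) {ψ φ : XChart n m X} {w : PCoord n m s}
    (hw : w ∈ grTransDom s ψ φ) (hw' : grTrans ψ φ w ∈ grDom s φ) (i : Fin n) (u : Model n m) :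
    tanCoef g φ (grTrans ψ φ w) i (fderiv ℝ (chartTrans ψ φ) (hor w) u) =
      ∑ j, jacMat ψ φ w i j * tanCoef g ψ w j u := by
  set a := jacMat ψ φ w with ha
  set F := fderiv ℝ (chartTrans ψ φ) (hor w) with hF
  set w' := grTrans ψ φ w with hw'def
  have h0 : ∀ x y, g ψ (hor w) x y = g φ (hor w') (F x) (F y) := by
    intro x y
    rw [hg.trans ψ φ (hor w) hw.1, hw'def, hor_grTrans]
  have hframe : ∀ j y, g ψ (hor w) (frame w j) y =
      ∑ i, a i j * g φ (hor w') (frame w' i) (F y) := by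
    intro j y
    rw [h0, fderiv_chartTrans_frame hs hw]
    simp [ha, hw'def]
  -- The derivative of the change of charts is an isometry and maps one frame to the other by the
  -- matrix `a`, so the Gram matrices are congruent.
  have hG : gram g ψ w = a.transpose * (gram g φ w' * a) := by
    ext j k
    simp only [gram, Matrix.of_apply, Matrix.mul_apply, Matrix.transpose_apply]
    rw [hframe]
    refine Finset.sum_congr rfl fun i _ => ?_
    congr 1
    rw [hF, fderiv_chartTrans_frame hs hw]
    simp [ha, hw'def, mul_comm]
  set c : Fin n → ℝ := fun i => g ψ (hor w) (frame w i) u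
  set c' : Fin n → ℝ := fun i => g φ (hor w') (frame w' i) (F u)
  have hc : c = a.transpose.mulVec c' := by
    funext j
    simp only [c, hframe, Matrix.mulVec, dotProduct, Matrix.transpose_apply, c']
  have hdet := det_gram_ne_zero hs hg (grTransDom_subset ψ φ hw)
  have hdet' := det_gram_ne_zero hs hg hw'
  have hda : a.transpose.det ≠ 0 := by
    rw [Matrix.det_transpose]
    exact det_jacMat_ne_zero hs hw
  -- With `G = aᵀ G' a` and `c = aᵀ c'`, cancelling `aᵀ` gives `a G⁻¹ c = G'⁻¹ c'`.
  have key : a.mulVec ((gram g ψ w)⁻¹.mulVec c) = (gram g φ w')⁻¹.mulVec c' := by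
    have h1 : a.transpose.mulVec ((gram g φ w').mulVec (a.mulVec ((gram g ψ w)⁻¹.mulVec c))) =
        a.transpose.mulVec c' := by
      rw [← hc, Matrix.mulVec_mulVec, Matrix.mulVec_mulVec, Matrix.mul_assoc, ← hG, Matrix.mulVec_mulVec,
        Matrix.mul_nonsing_inv _ (isUnit_iff_ne_zero.2 hdet), Matrix.one_mulVec]
    have h2 : (gram g φ w').mulVec (a.mulVec ((gram g ψ w)⁻¹.mulVec c)) = c' := by
      have h3 := Matrix.eq_zero_of_mulVec_eq_zero hda
        (v := (gram g φ w').mulVec (a.mulVec ((gram g ψ w)⁻¹.mulVec c)) - c') (by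
          rw [Matrix.mulVec_sub, h1, sub_self])
      exact sub_eq_zero.1 h3
    conv_rhs => rw [← h2]
    rw [Matrix.mulVec_mulVec _ (gram g φ w')⁻¹,
      Matrix.nonsing_inv_mul _ (isUnit_iff_ne_zero.2 hdet'), Matrix.one_mulVec]
  have h4 := congrFun key i
  rw [tanCoef_apply, ← h4]
  simp only [tanCoef_apply, Matrix.mulVec, dotProduct, c]

open Classical in
/-- The form `T_σ ω^σ ∧ β^1 ∧ ⋯ ∧ β^n`, where the `β^j` are the components of the orthogonal
projection to the contact element. -/
def globalForm (g : XChart n m X → Model n m → Model n m →L[ℝ] Model n m →L[ℝ] ℝ)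
    (T : XChart n m X → Fin m → GrassmannManifold n m s X → ℝ) (ψ : XChart n m X)
    (w : PCoord n m s) : PCoord n m s [⋀^Fin (n + 1)]→L[ℝ] ℝ :=
  if w ∈ grDom s ψ then
    wedge (∑ σ, (GrassmannManifold.charts n m s X).expr ψ (T ψ σ) w • omega σ 0 w)
      (wedgeAll n fun j => (tanCoef g ψ w j).comp hor)
  else 0

theorem contDiffOn_tanCoef_comp_hor (hs : 1 ≤ s) (hg : IsMetric g) (ψ : XChart n m X)
    (j : Fin n) :
    ContDiffOn ℝ ∞ (fun w : PCoord n m s =>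
      (tanCoef g ψ w j).comp (hor (n := n) (m := m) (s := s))) (grDom s ψ) := by
  refine ContDiffOn.congr ?_ fun w hw => tanCoef_comp_hor hs hg hw j
  exact contDiffOn_const.add (ContDiffOn.sum fun σ _ =>
    (contDiffOn_tanCoef hs hg ψ j _).smul (contDiff_omega_zero σ).contDiffOn)

variable {𝒯 : (ImmT.charts n m s X).DForm 1}
  {T : XChart n m X → Fin m → GrassmannManifold n m s X → ℝ}

/-- The form `T_σ ω^σ` is `𝒥` times the pull-back of its barred counterpart, while the barred `β^1 ∧
⋯ ∧ β^n` pulls back to `𝒥` times the unbarred product. In the wedge product the factor moves from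
one side to the other, and the result glues. -/
theorem globalForm_mem (hs : 1 ≤ s) (hg : IsMetric g) (h : IsHomogeneous 𝒯)
    (hT : ∀ ψ, IsLocalForm 𝒯 ψ (T ψ)) : globalForm g T ∈ Omega n m s X := by
  refine ⟨fun ψ => ?_, fun ψ w hw => ?_, fun ψ φ c hc => ?_⟩
  · rw [range_grassmann hs]
    have hT' := (hT ψ).1
    rw [range_grassmann hs] at hT'
    refine ContDiffOn.congr (f := fun w =>
      wedge (∑ σ, (GrassmannManifold.charts n m s X).expr ψ (T ψ σ) w • omega σ 0 w)
      (wedgeAll n fun j => (tanCoef g ψ w j).comp hor)) ?_ fun w hw => if_pos hw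
    refine contDiffOn_wedge ?_ (contDiffOn_wedgeAll
      (α := fun j w => (tanCoef g ψ w j).comp hor) (contDiffOn_tanCoef_comp_hor hs hg ψ))
    exact ContDiffOn.sum fun σ _ => (hT' σ).smul (contDiff_omega_zero σ).contDiffOn
  · rw [range_grassmann hs] at hw
    exact if_neg hw
  · obtain ⟨hψ, hφ⟩ := hc
    have hw := coord_mem_grTransDom hs hψ hφ
    have hwφ := coord_mem_grDom hs hφ
    have hc' : c.coord φ = grTrans ψ φ (c.coord ψ) := by
      rw [← coord_eq_grTrans hs hw, rho_graphVel_coord hs hψ]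
    set D := fderiv ℝ ((GrassmannManifold.charts n m s X).expr ψ (fun c => c.coord φ)) (c.coord ψ)
      with hD
    have hpull : (GrassmannManifold.charts n m s X).pullbackAt (GrassmannManifold.charts n m s X)
        id (globalForm g T) ψ φ c =
          (globalForm g T φ (c.coord φ)).compContinuousLinearMap D := rfl
    rw [hpull, globalForm, globalForm, if_pos (coord_mem_grDom hs hψ), if_pos hwφ]
    have hdet := det_jacMat_ne_zero hs hw
    have h1 : (∑ σ, (GrassmannManifold.charts n m s X).expr ψ (T ψ σ) (c.coord ψ) •
        omega σ 0 (c.coord ψ)) = (jacMat ψ φ (c.coord ψ)).det •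
        (∑ ν, (GrassmannManifold.charts n m s X).expr φ (T φ ν) (c.coord φ) •
        omega ν 0 (c.coord φ)).comp D := by
      ext v
      have h2 := (hT ψ).sum_contact_eq hs h (hT φ) hψ hφ (hor v)
      rw [← hor_fderiv_expr_coord hs hw] at h2
      simp only [expr_grassmann_coord hs _ hψ, expr_grassmann_coord hs _ hφ, omega_zero_eq,
        _root_.sum_apply, _root_.smul_apply, ContinuousLinearMap.comp_apply, smul_eq_mul]
      exact h2
    have h2 : (wedgeAll n fun j => (tanCoef g φ (c.coord φ) j).comp hor).compContinuousLinearMap D =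
        (jacMat ψ φ (c.coord ψ)).det • wedgeAll n fun j => (tanCoef g ψ (c.coord ψ) j).comp hor := by
      rw [wedgeAll_comp, ← wedgeAll_sum_smul]
      congr 1
      funext i
      ext v
      simp only [ContinuousLinearMap.comp_apply, _root_.sum_apply, _root_.smul_apply, smul_eq_mul]
      rw [hD, hor_fderiv_expr_coord hs hw, hc']
      exact tanCoef_trans hs hg hw (hc' ▸ hwφ) i (hor v)
    change _ = ContinuousAlternatingMap.compContinuousLinearMap _ D
    rw [wedge_comp, h2, wedge_smul, h1, smul_wedge]

/-- The difference is `T_σ ω^σ ∧ (β^1 ∧ ⋯ ∧ β^n - θ_0)`: the bracket already has one contact factor,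
and `ω^σ` is the second. -/
theorem isStronglyContactOn_globalForm_sub (hs : 1 ≤ s) (hg : IsMetric g)
    (hT : ∀ ψ, IsLocalForm 𝒯 ψ (T ψ)) (ψ : XChart n m X) :
    IsStronglyContactOn ((GrassmannManifold.charts n m s X).range ψ)
      (globalForm g T ψ - localForm ψ (T ψ)) := by
  have hT' := (hT ψ).1
  rw [range_grassmann hs] at hT' ⊢
  have h1 := isContactPow_wedgeAll_sub (D := grDom s ψ) hs
    (ξ := fun (j : Fin n) (_ : PCoord n m s) => dX j) (fun _ => contDiffOn_const)
    (h := fun j σ w => tanCoef g ψ w j (EuclideanSpace.single (Fin.natAdd n σ) 1))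
    (fun j σ => contDiffOn_tanCoef hs hg ψ j _)
  refine IsContactPow.congr _ _ (IsContactPow.sum Finset.univ fun σ =>
    IsContactPow.omega_wedge σ 0 (by simpa using hs) _ (h1.smul (hT' σ))) fun w hw => ?_
  simp only [Pi.sub_apply, Finset.sum_apply, globalForm, if_pos hw, localForm, theta0, sum_wedge,
    ← Finset.sum_sub_distrib, tanCoef_comp_hor hs hg hw]
  refine Finset.sum_congr rfl fun σ _ => ?_
  rw [wedge_smul, wedge_sub, smul_wedge, smul_sub]

theorem existsUnique_class [T2Space X] [SecondCountableTopology X] (hs : 1 ≤ s)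
    (h : IsHomogeneous 𝒯) (hT : ∀ ψ, IsLocalForm 𝒯 ψ (T ψ)) :
    ∃! t : Omega n m s X ⧸ OmegaContact n m s X,
      ∀ τ : Omega n m s X, (QuotientAddGroup.mk τ : Omega n m s X ⧸ OmegaContact n m s X) = t →
        ∀ ψ : XChart n m X, IsStronglyContactOn ((GrassmannManifold.charts n m s X).range ψ)
          (τ.1 ψ - localForm ψ (T ψ)) := by
  obtain ⟨g, hg⟩ := exists_isMetric (n := n) (m := m) (X := X)
  let τ₀ : Omega n m s X := ⟨globalForm g T, globalForm_mem hs hg h hT⟩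
  have h0 := isStronglyContactOn_globalForm_sub hs hg hT
  refine ⟨QuotientAddGroup.mk τ₀, fun τ hτ ψ => ?_, fun t ht => ?_⟩
  · have h1 : -τ₀ + τ ∈ OmegaContact n m s X := QuotientAddGroup.eq.1 hτ.symm
    have h2 : τ.1 ψ - localForm ψ (T ψ) =
        (-τ₀ + τ).1 ψ + (globalForm g T ψ - localForm ψ (T ψ)) := by
      change τ.1 ψ - localForm ψ (T ψ) =
        (-globalForm g T ψ + τ.1 ψ) + (globalForm g T ψ - localForm ψ (T ψ))
      abel
    rw [h2]
    exact IsContactPow.add _ _ (h1 ψ) (h0 ψ)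
  -- The condition speaks of all representatives of `t`; a single one suffices here, since in `τ₀ -
  -- τ` the local form cancels.
  · obtain ⟨τ, rfl⟩ := QuotientAddGroup.mk_surjective t
    refine QuotientAddGroup.eq.2 fun ψ => ?_
    have h2 : (-τ + τ₀).1 ψ =
        -(τ.1 ψ - localForm ψ (T ψ)) + (globalForm g T ψ - localForm ψ (T ψ)) := by
      change -τ.1 ψ + globalForm g T ψ = _
      abel
    rw [h2]
    exact IsContactPow.add _ _ (IsContactPow.neg _ (ht τ rfl ψ)) (h0 ψ)

end GlobalForm

end Grassmann

end

/-! ### The theorem -/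

theorem mainTheorem7 (n m s : ℕ) (hn : 1 ≤ n) (hs : 1 ≤ s) {X : Type u} [TopologicalSpace X]
    [T2Space X] [SecondCountableTopology X]
    [ChartedSpace (EuclideanSpace ℝ (Fin (n + m))) X] [IsManifold (𝓡 (n + m)) ∞ X]
    (𝒯 : (Grassmann.ImmT.charts n m s X).DForm 1) (h𝒯 : Grassmann.IsHomogeneous 𝒯) :
    (∀ ψ : Grassmann.XChart n m X, ∃ T : Fin m → Grassmann.GrassmannManifold n m s X → ℝ,
      Grassmann.IsLocalForm 𝒯 ψ T) ∧
    ∀ T : Grassmann.XChart n m X → Fin m → Grassmann.GrassmannManifold n m s X → ℝ,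
      (∀ ψ, Grassmann.IsLocalForm 𝒯 ψ (T ψ)) →
      (∀ ψ φ : Grassmann.XChart n m X, ∀ c ∈ Grassmann.rho '' (Grassmann.W s ψ ∩ Grassmann.W s φ),
        ∀ σ, T ψ σ c =
          Grassmann.jac ψ φ c * ∑ ν, Grassmann.pMat ψ φ c ν σ * T φ ν c) ∧
      ∃! t : Grassmann.Omega n m s X ⧸ Grassmann.OmegaContact n m s X,
        ∀ τ : Grassmann.Omega n m s X, (QuotientAddGroup.mk τ : Grassmann.Omega n m s X ⧸ Grassmann.OmegaContact n m s X) = t →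
          ∀ ψ : Grassmann.XChart n m X,
            Grassmann.IsStronglyContactOn
              ((Grassmann.GrassmannManifold.charts n m s X).range ψ)
              (τ.1 ψ - Grassmann.localForm ψ (T ψ)) := by
  refine ⟨Grassmann.exists_isLocalForm hs h𝒯, fun T hT => ⟨fun ψ φ c hc σ => ?_, ?_⟩⟩
  · exact (hT ψ).eq_jac_mul_sum hs h𝒯 (hT φ) hc σ
  · exact Grassmann.existsUnique_class hs h𝒯 hT
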